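/- Write $|0\rangle,|1\rangle$ for the standard basis of $\mathbb C^2$, $\sigma_x,\sigma_y,\sigma_z$ for the Pauli matrices, $H=\frac1{\sqrt2}\begin{pmatrix}1&1\\1&-1\end{pmatrix}$, $S=\operatorname{diag}(1,i)$, and $\mathrm{CNOT}_{2\to1}|a,b\rangle=|a\oplus b,b\rangle$. For $n\ge1$ let $\mathcal P_n$ be the group of matrices $i^l\bigotimes_{a=1}^n\sigma_x^{j_a}\sigma_z^{k_a}$, and let $\mathcal C_n$ be the Clifford group $\{C\in SU(2^n): CPC^\dagger\in\mathcal P_n \text{ for all } P\in\mathcal P_n\}$, whose elements are counted up to a global phase; an element $C$ is identified with the unitary channel $X\mapsto CXC^\dagger$. A finite non-empty set $\mathcal S$ of channels on $\mathbb C^d$ with positive weights $w_\Phi$ is a weighted channel $[t,k]$-design if for every operator $\rho$ on $(\mathbb C^d)^{\otimes t}$ $$\frac{1}{\sum_{\Phi\in \mathcal S} w_\Phi}\sum_{\Phi\in \mathcal S}w_\Phi\,\Phi^{\otimes t}(\rho)=\int_{U(dk)}\operatorname{Tr}_E\!\left[U^{\otimes t}\left(\rho\otimes|0\rangle\langle0|_E^{\otimes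 t}\right)(U^\dagger)^{\otimes t}\right]dU,$$ where $dU$ is the normalised Haar measure and the environment $E$ has dimension $k$. The Kraus rank of a channel is the least number of its Kraus operators. The Choi–Jamiołkowski state of a qubit channel is $\sigma_\Phi=(\Phi\otimes\mathrm{id})(|\psi_+\rangle\langle\psi_+|)$ with $|\psi_+\rangle=\frac1{\sqrt2}(|00\rangle+|11\rangle)$. For $C\in\mathcal C_2$ let $\Phi_C(\rho)=\operatorname{Tr}_E[C(\rho\otimes|0\rangle\langle0|)C^\dagger]$, where $E$ is the second qubit, and let the multiplicity of a channel $\Phi$ be the number of $C\in\mathcal C_2$ (up to phase) with $\Phi_C=\Phi$. Then: 1. The set $\{\Phi_C:C\in\mathcal C_2\}$ consists of exactly $48$ single-qubit channels and is the disjoint union of a set $\mathcal R_1$ of $24$ channels of Kraus rank $1$ and a set $\mathcal R_2$ of $24$ channels of Kraus rank $2$. 2. $\mathcal R_1=\mathcal C_1$, and every channel in $\mathcal R_1$ has multiplicity $96$. 3. Every channel in $\mathcal R_2$ has multiplicity $384$, and its Choi–Jamiołkowski state has eigenvalues $\{1/2,1/2,0,0\}$. 4. Exactly $18$ channels in $\mathcal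 R_2$ are mixed unitary (convex combinations of unitary channels), and each of them equals $\frac12(\Psi_1+\Psi_2)$ for two different $\Psi_1,\Psi_2\in\mathcal C_1$. The remaining $6$ are exactly the contractions $\rho\mapsto\operatorname{Tr}(\rho)\,v$ to the six vertices $v=\frac12(\mathbb I\pm\sigma)$, $\sigma\in\{\sigma_x,\sigma_y,\sigma_z\}$, of the octahedron inscribed in the Bloch sphere. 5. The channels in $\mathcal R_2$ are exactly those with Choi–Jamiołkowski state $\frac12\sum_{i=0}^1|\psi_i\rangle\langle\psi_i|$, $|\psi_i\rangle=(A\otimes B)\,\mathrm{CNOT}_{2\to1}^{\,k}(\sigma_x^j\otimes\mathbb I)|0i\rangle$, with $j,k\in\{0,1\}$ and $A,B\in\{\mathbb I,H,SH\}$; those with $k=0$ are the six contractions and those with $k=1$ are the $18$ mixed unitary channels. 6. The set $\mathcal R_1\cup\mathcal R_2$ with weight $1$ on each channel of $\mathcal R_1$ and weight $4$ on each channel of $\mathcal R_2$ is a weighted channel $[3,2]$-design on one qubit ($d=2$). -/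

import Mathlib

open scoped Matrix Kronecker

noncomputable section

namespace ChannelDesign

/-! ## Channels, Choi–Jamiołkowski states -/

/-- Linear maps on the operators on the Hilbert space with orthonormal basis `ι`. -/
abbrev SuperOp (ι : Type) : Type := Matrix ι ι ℂ →ₗ[ℂ] Matrix ι ι ℂ

section Channels

variable {ι : Type} [Fintype ι] [DecidableEq ι]

/-- The map `X ↦ U X U†`. -/
def conjBy (U : Matrix ι ι ℂ) : SuperOp ι where
  toFun X := U * X * Uᴴ
  map_add' X Y := by simp [mul_add, add_mul]
  map_smul' c X := by simp

/-- The operators `K 0, …, K (r - 1)` represent `Φ` as `Φ(ρ) = ∑ K_i ρ K_i†`. -/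
def IsKrausForm {r : ℕ} (K : Fin r → Matrix ι ι ℂ) (Φ : SuperOp ι) : Prop :=
  ∀ ρ, Φ ρ = ∑ i, K i * ρ * (K i)ᴴ

/-- Quantum channels: maps `ρ ↦ ∑ K_i ρ K_i†` with `∑ K_i† K_i = 1` (equivalently, completely
positive trace-preserving maps). -/
def IsChannel (Φ : SuperOp ι) : Prop :=
  ∃ (r : ℕ) (K : Fin r → Matrix ι ι ℂ), ∑ i, (K i)ᴴ * K i = 1 ∧ IsKrausForm K Φ

/-- The Kraus rank: the least number of Kraus operators (used for channels only). -/
def krausRank (Φ : SuperOp ι) : ℕ :=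
  sInf {r | ∃ K : Fin r → Matrix ι ι ℂ, IsKrausForm K Φ}

/-- Mixed unitary channels: convex combinations of unitary channels. -/
def IsMixedUnitary (Φ : SuperOp ι) : Prop :=
  ∃ (r : ℕ) (p : Fin r → ℝ) (U : Fin r → Matrix ι ι ℂ),
    (∀ i, 0 ≤ p i) ∧ ∑ i, p i = 1 ∧ (∀ i, U i ∈ Matrix.unitaryGroup ι ℂ) ∧
      Φ = ∑ i, (p i : ℂ) • conjBy (U i)

/-- The Choi–Jamiołkowski state `(Φ ⊗ id)(|ψ₊⟩⟨ψ₊|)` with `ψ₊ = d^{-1/2} ∑ |aa⟩`: its entry at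
`(i, a), (j, b)` is `⟨i| Φ(|a⟩⟨b|) |j⟩ / d`. -/
def choiState (Φ : SuperOp ι) : Matrix (ι × ι) (ι × ι) ℂ :=
  Matrix.of fun p q => (Fintype.card ι : ℂ)⁻¹ * Φ (Matrix.single p.2 q.2 1) p.1 q.1

/-- The tensor power `Φ^{⊗t}` on operators on `t` copies of the space, which have the basis
`Fin t → ι`: the linear map that sends `⨂ₙ |aₙ⟩⟨bₙ|` to `⨂ₙ Φ(|aₙ⟩⟨bₙ|)`. -/
def tensorPower (t : ℕ) (Φ : SuperOp ι) : SuperOp (Fin t → ι) where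
  toFun ρ := Matrix.of fun i j =>
    ∑ a : Fin t → ι, ∑ b : Fin t → ι,
      ρ a b * ∏ n, Φ (Matrix.single (a n) (b n) 1) (i n) (j n)
  map_add' X Y := by
    ext i j
    simp [add_mul, Finset.sum_add_distrib]
  map_smul' c X := by
    ext i j
    simp [Finset.mul_sum, mul_assoc]

/-- `U^{⊗t}` for an operator `U` on a system `ι` and an environment `ε`, with the `t` copies of
the system grouped together and the `t` copies of the environment grouped together. -/
def copies {ε : Type} (t : ℕ) (U : Matrix (ι × ε) (ι × ε) ℂ) :
    Matrix ((Fin t → ι) × (Fin t → ε)) ((Fin t → ι) × (Fin t → ε)) ℂ :=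
  Matrix.of fun p q => ∏ n, U (p.1 n, p.2 n) (q.1 n, q.2 n)

end Channels

/-- The partial trace over the second factor (the environment). -/
def traceEnv {α ε : Type} [Fintype ε] (M : Matrix (α × ε) (α × ε) ℂ) : Matrix α α ℂ :=
  Matrix.of fun i j => ∑ l, M (i, l) (j, l)

/-- The map `ρ ↦ Tr_E[T(ρ ⊗ |e⟩⟨e|)]` on the system that is induced by a map `T` on the system
and the environment, where the environment starts in the basis state `e`. -/
def induced {α ε : Type} [Fintype ε] [DecidableEq ε] (e : ε) (T : SuperOp (α × ε)) :
    SuperOp α where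
  toFun ρ := traceEnv (T (ρ ⊗ₖ Matrix.single e e (1 : ℂ)))
  map_add' X Y := by
    ext i j
    simp [traceEnv, Matrix.add_kronecker, Finset.sum_add_distrib]
  map_smul' c X := by
    ext i j
    simp [traceEnv, Matrix.smul_kronecker, Finset.mul_sum]

/-! ## The Haar measure of the unitary group and channel designs -/

section Haar

variable (n : Type) [Fintype n] [DecidableEq n]

instance instCompactUnitary : CompactSpace (Matrix.unitaryGroup n ℂ) := by
  have hb : IsCompact {M : Matrix n n ℂ | ∀ i j, M i j ∈ Metric.closedBall (0 : ℂ) 1} := by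
    have h := isCompact_univ_pi fun _ : n => isCompact_univ_pi fun _ : n =>
      isCompact_closedBall (0 : ℂ) 1
    simp only [Set.pi, Set.mem_univ, true_implies, Set.mem_ofPred_eq] at h
    exact h
  have hc : IsCompact (Matrix.unitaryGroup n ℂ : Set (Matrix n n ℂ)) := by
    refine hb.of_isClosed_subset (isClosed_unitary (R := Matrix n n ℂ)) ?_
    intro U hU i j
    simpa using entry_norm_bound_of_unitary hU i j
  exact isCompact_iff_compactSpace.mp hc

instance instMeasurableUnitary : MeasurableSpace (Matrix.unitaryGroup n ℂ) := borel _

instance instBorelUnitary : BorelSpace (Matrix.unitaryGroup n ℂ) := ⟨rfl⟩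

/-- The normalised Haar measure of the unitary group. -/
def haarUnitary : MeasureTheory.Measure (Matrix.unitaryGroup n ℂ) :=
  MeasureTheory.Measure.haarMeasure ⊤

end Haar

/-- The Haar average over `U(dk)` of `Tr_E[U^{⊗t} (ρ ⊗ |0⟩⟨0|^{⊗t}) (U†)^{⊗t}]`, integrated
entry by entry. -/
def haarChannelAverage (d t k : ℕ) [NeZero k]
    (ρ : Matrix (Fin t → Fin d) (Fin t → Fin d) ℂ) :
    Matrix (Fin t → Fin d) (Fin t → Fin d) ℂ :=
  Matrix.of fun i j =>
    ∫ U : Matrix.unitaryGroup (Fin d × Fin k) ℂ,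
      traceEnv (copies t U.1 *
        (ρ ⊗ₖ Matrix.single (fun _ : Fin t => (0 : Fin k)) (fun _ => 0) (1 : ℂ)) *
        (copies t U.1)ᴴ) i j ∂haarUnitary (Fin d × Fin k)

/-- The channels of the finite set `S` with the positive weights `w` form a weighted channel
`[t, k]`-design in dimension `d`. -/
def IsWeightedChannelDesign {d : ℕ} (t k : ℕ) [NeZero k]
    (S : Finset (SuperOp (Fin d))) (w : SuperOp (Fin d) → ℝ) : Prop :=
  S.Nonempty ∧ (∀ Φ ∈ S, IsChannel Φ ∧ 0 < w Φ) ∧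
    ∀ ρ : Matrix (Fin t → Fin d) (Fin t → Fin d) ℂ,
      ((∑ Φ ∈ S, w Φ : ℝ) : ℂ)⁻¹ • ∑ Φ ∈ S, (w Φ : ℂ) • tensorPower t Φ ρ =
        haarChannelAverage d t k ρ

/-! ## Pauli and Clifford groups -/

def pauliX : Matrix (Fin 2) (Fin 2) ℂ := !![0, 1; 1, 0]

def pauliY : Matrix (Fin 2) (Fin 2) ℂ := !![0, -Complex.I; Complex.I, 0]

def pauliZ : Matrix (Fin 2) (Fin 2) ℂ := !![1, 0; 0, -1]

def hadamard : Matrix (Fin 2) (Fin 2) ℂ := ((Real.sqrt 2 : ℝ) : ℂ)⁻¹ • !![1, 1; 1, -1]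

def phaseGate : Matrix (Fin 2) (Fin 2) ℂ := !![1, 0; 0, Complex.I]

/-- The controlled NOT with the second qubit as control: `|a, b⟩ ↦ |a + b, b⟩`. -/
def cnotTwoOne : Matrix (Fin 2 × Fin 2) (Fin 2 × Fin 2) ℂ :=
  Matrix.of fun p q => if p = (q.1 + q.2, q.2) then 1 else 0

/-- The one-qubit Pauli group. -/
def pauliGroupOne : Set (Matrix (Fin 2) (Fin 2) ℂ) :=
  {P | ∃ (l : Fin 4) (j k : Fin 2),
    P = Complex.I ^ (l : ℕ) • (pauliX ^ (j : ℕ) * pauliZ ^ (k : ℕ))}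

/-- The two-qubit Pauli group. -/
def pauliGroupTwo : Set (Matrix (Fin 2 × Fin 2) (Fin 2 × Fin 2) ℂ) :=
  {P | ∃ (l : Fin 4) (j₁ k₁ j₂ k₂ : Fin 2),
    P = Complex.I ^ (l : ℕ) • ((pauliX ^ (j₁ : ℕ) * pauliZ ^ (k₁ : ℕ)) ⊗ₖ
      (pauliX ^ (j₂ : ℕ) * pauliZ ^ (k₂ : ℕ)))}

/-- The Clifford unitaries for the Pauli group `Q`: the `C` of determinant one with
`C P C† ∈ Q` for all `P ∈ Q`. -/
def IsClifford {ι : Type} [Fintype ι] [DecidableEq ι] (Q : Set (Matrix ι ι ℂ))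
    (C : Matrix ι ι ℂ) : Prop :=
  C ∈ Matrix.specialUnitaryGroup ι ℂ ∧ ∀ P ∈ Q, C * P * Cᴴ ∈ Q

/-- The Clifford group up to global phases. Unitaries `C` and `C'` differ by a phase if and only
if `X ↦ C X C†` and `X ↦ C' X C'†` are equal, so the classes are identified with these maps. -/
def cliffordOps {ι : Type} [Fintype ι] [DecidableEq ι] (Q : Set (Matrix ι ι ℂ)) :
    Set (SuperOp ι) :=
  {T | ∃ C, IsClifford Q C ∧ T = conjBy C}

/-! ## The channels induced by the two-qubit Clifford group -/

/-- The image of the two-qubit Clifford group under `C ↦ (ρ ↦ Tr_E[C (ρ ⊗ |0⟩⟨0|) C†])`, where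
the second qubit is the environment. -/
def inducedChannels : Set (SuperOp (Fin 2)) :=
  induced (0 : Fin 2) '' cliffordOps pauliGroupTwo

/-- The number of elements of the two-qubit Clifford group, up to phases, that induce `Φ`. -/
def cliffordMultiplicity (Φ : SuperOp (Fin 2)) : ℕ :=
  {T ∈ cliffordOps pauliGroupTwo | induced (0 : Fin 2) T = Φ}.ncard

/-- The induced channels of Kraus rank `r`. -/
def inducedOfRank (r : ℕ) : Set (SuperOp (Fin 2)) :=
  {Φ ∈ inducedChannels | krausRank Φ = r}

/-- The six pure states `(1 ± σ)/2`, `σ` a Pauli matrix: the vertices of an octahedron inscribed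
in the Bloch sphere. -/
def octahedronVertices : Set (Matrix (Fin 2) (Fin 2) ℂ) :=
  {v | ∃ σ ∈ ({pauliX, pauliY, pauliZ} : Set (Matrix (Fin 2) (Fin 2) ℂ)),
    ∃ s ∈ ({1, -1} : Set ℂ), v = (1 / 2 : ℂ) • (1 + s • σ)}

/-- The channels that send every state to one fixed vertex of the octahedron. -/
def vertexContractions : Set (SuperOp (Fin 2)) :=
  {Φ | ∃ v ∈ octahedronVertices, ∀ ρ, Φ ρ = ρ.trace • v}

/-- The vector `(A ⊗ B) CNOT_{2→1}^k (σ_x^j ⊗ 1) |0 i⟩`. -/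
def supportKet (A B : Matrix (Fin 2) (Fin 2) ℂ) (j k i : Fin 2) : Fin 2 × Fin 2 → ℂ :=
  ((A ⊗ₖ B) * cnotTwoOne ^ (k : ℕ) * ((pauliX ^ (j : ℕ)) ⊗ₖ (1 : Matrix (Fin 2) (Fin 2) ℂ))) *ᵥ
    Pi.single (0, i) 1

/-- The maps with Choi–Jamiołkowski state `(|ψ₀⟩⟨ψ₀| + |ψ₁⟩⟨ψ₁|) / 2`, where `ψ_i` is
`(A ⊗ B) CNOT_{2→1}^k (σ_x^j ⊗ 1) |0 i⟩` with `A, B ∈ {1, H, SH}` and `j ∈ {0, 1}`. -/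
def rankTwoFamily (k : Fin 2) : Set (SuperOp (Fin 2)) :=
  {Φ | ∃ A ∈ ({1, hadamard, phaseGate * hadamard} : Set (Matrix (Fin 2) (Fin 2) ℂ)),
    ∃ B ∈ ({1, hadamard, phaseGate * hadamard} : Set (Matrix (Fin 2) (Fin 2) ℂ)),
    ∃ j : Fin 2, choiState Φ =
      (1 / 2 : ℂ) • ∑ i, Matrix.vecMulVec (supportKet A B j k i) (star (supportKet A B j k i))}

end ChannelDesign

end

open ChannelDesign

noncomputable section

namespace ChannelDesign

/-! ## Pauli operators with natural number codes -/

/-! A two-qubit Clifford operation up to phase is the same thing as its tableau: the images x₁, z₁,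
x₂, z₂ of σ_x⊗1, σ_z⊗1, 1⊗σ_x, 1⊗σ_z. Every quadruple of Hermitian Pauli operators with the right
commutation signs occurs, and it determines the operation (`exists_tableau`,
`exists_clifford_of_tableau`, `HasTableau.ext`). Since |0⟩⟨0| = (1 + σ_z)/2, the induced channel
sends a Pauli operator ρ for which ρ⊗1 has image q to half the partial trace of q + q z₂. The
partial trace doubles P in P⊗1 and kills every Pauli operator whose environment factor is
nontrivial. The channel can therefore be read off from the tableau (`induced_eq_codedMap`).

Pauli operators are coded by natural numbers, so that products and commutation signs become
arithmetic on codes. Classifying the channels and counting the tableaux over each of them are then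
finite checks (`channelCode_check`, `length_tableauxOfCode`). They leave 24 Clifford rotations, 6
contractions, and 18 maps that keep one Bloch axis and erase the other two.

The last 24 maps all have the form ρ ↦ (Tr(ρ) 1 + Tr(Qρ) W)/2, where W is a signed Pauli matrix and
Q is 1 for a contraction and a Pauli matrix otherwise. A trace-preserving map with one Kraus
operator is multiplicative, so it cannot kill an involution; this gives Kraus rank two
(`krausRank_eq_two`). A mixed unitary channel fixes 1, which a contraction does not. If Q is a Pauli
matrix, the map is the mean of two Clifford rotations that agree on Q and are opposite on the other
axes. The Choi state is (1 + W⊗Qᵀ)/4, which is diag(1/2, 1/2, 0, 0) conjugated by local gates and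
powers of CNOT (`support_state`); this yields both the spectrum and the parametrised family.

The design property says that the Clifford group is a unitary three-design. Let M commute with all
C⊗C⊗C, and expand it in Pauli products. Conjugation by Pauli operators leaves only the terms
P_a⊗P_b⊗P_c with P_c proportional to P_a P_b. The Clifford group has six orbits on the pairs (a, b)
up to phase, so at most six coefficients are free, and the six permutations of the copies account
for all of them. Hence M is a combination of permutations and commutes with every U⊗U⊗U
(`commute_cube_of_clifford`). By invariance of the Haar measure, the Haar average equals the
Clifford average. Grouping the latter by induced channel gives the multiplicities 96 and 384 as
weights, in the ratio 1 : 4 (`sum_induced`). -/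

/-- The Pauli operator `σ_x^j σ_z^k`. -/
def weyl (j k : ℕ) : Matrix (Fin 2) (Fin 2) ℂ := pauliX ^ j * pauliZ ^ k

lemma pauliX_mul_self : pauliX * pauliX = 1 := by
  ext i j; fin_cases i <;> fin_cases j <;> simp [pauliX]

lemma pauliZ_mul_self : pauliZ * pauliZ = 1 := by
  ext i j; fin_cases i <;> fin_cases j <;> simp [pauliZ]

lemma pauliZ_mul_pauliX : pauliZ * pauliX = -(pauliX * pauliZ) := by
  ext i j; fin_cases i <;> fin_cases j <;> simp [pauliX, pauliZ]

lemma pauliX_conjTranspose : pauliXᴴ = pauliX := by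
  ext i j; fin_cases i <;> fin_cases j <;> simp [pauliX]

lemma pauliZ_conjTranspose : pauliZᴴ = pauliZ := by
  ext i j; fin_cases i <;> fin_cases j <;> simp [pauliZ]

lemma pauliY_eq : pauliY = Complex.I • weyl 1 1 := by
  ext i j; fin_cases i <;> fin_cases j <;> simp [pauliX, pauliZ, pauliY, weyl]

lemma pow_eq_pow_of_mod {M : Type*} [Monoid M] {x : M} {n : ℕ} (hx : x ^ n = 1) {a b : ℕ}
    (h : a % n = b % n) : x ^ a = x ^ b := by
  rw [pow_eq_pow_mod a hx, pow_eq_pow_mod b hx, h]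

lemma pauliX_sq : pauliX ^ 2 = 1 := by rw [pow_two, pauliX_mul_self]

lemma pauliZ_sq : pauliZ ^ 2 = 1 := by rw [pow_two, pauliZ_mul_self]

lemma weyl_congr {j k j' k' : ℕ} (hj : j % 2 = j' % 2) (hk : k % 2 = k' % 2) :
    weyl j k = weyl j' k' := by
  rw [weyl, weyl, pow_eq_pow_of_mod pauliX_sq hj, pow_eq_pow_of_mod pauliZ_sq hk]

lemma pauliZ_pow_mul_pauliX_pow (k j : ℕ) :
    pauliZ ^ k * pauliX ^ j = (-1 : ℂ) ^ (k * j) • weyl j k := by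
  have h1 : ∀ j : ℕ, pauliZ * pauliX ^ j = (-1 : ℂ) ^ j • (pauliX ^ j * pauliZ) := by
    intro j
    induction j with
    | zero => simp
    | succ j ih =>
      rw [pow_succ, ← mul_assoc, ih, Matrix.smul_mul, mul_assoc, pauliZ_mul_pauliX, mul_neg,
        ← mul_assoc, smul_neg, pow_succ, mul_neg_one, neg_smul]
  induction k with
  | zero => simp [weyl]
  | succ k ih =>
    rw [pow_succ', mul_assoc, ih, Matrix.mul_smul, weyl, ← mul_assoc, h1, Matrix.smul_mul,
      smul_smul, weyl, mul_assoc, ← pow_succ', ← pow_add]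
    congr 2
    ring

lemma weyl_mul (j k j' k' : ℕ) :
    weyl j k * weyl j' k' = (-1 : ℂ) ^ (k * j') • weyl (j + j') (k + k') := by
  calc weyl j k * weyl j' k' = pauliX ^ j * (pauliZ ^ k * pauliX ^ j') * pauliZ ^ k' := by
        simp only [weyl, mul_assoc]
    _ = _ := by
        rw [pauliZ_pow_mul_pauliX_pow, weyl, weyl, pow_add, pow_add]
        simp only [Matrix.mul_smul, Matrix.smul_mul, mul_assoc]

lemma weyl_zero : weyl 0 0 = 1 := by simp [weyl]

lemma weyl_conjTranspose_mul (j k : ℕ) : (weyl j k)ᴴ * weyl j k = 1 := by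
  have hX : pauliX ^ j * pauliX ^ j = 1 := by
    rw [← pow_add, ← two_mul, pow_mul, pauliX_sq, one_pow]
  have hZ : pauliZ ^ k * pauliZ ^ k = 1 := by
    rw [← pow_add, ← two_mul, pow_mul, pauliZ_sq, one_pow]
  rw [weyl, Matrix.conjTranspose_mul, Matrix.conjTranspose_pow, Matrix.conjTranspose_pow,
    pauliX_conjTranspose, pauliZ_conjTranspose, mul_assoc, ← mul_assoc (pauliX ^ j), hX, one_mul,
    hZ]

lemma weyl_trace (j k : ℕ) : (weyl j k).trace = if j % 2 = 0 ∧ k % 2 = 0 then 2 else 0 := by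
  rw [weyl_congr (j' := j % 2) (k' := k % 2) (by simp) (by simp)]
  rcases Nat.mod_two_eq_zero_or_one j with h | h <;>
    rcases Nat.mod_two_eq_zero_or_one k with h' | h' <;>
    simp [h, h', weyl, pauliX, pauliZ, Matrix.trace_fin_two]

/-- The one-qubit Pauli operator with code `n = 4 l + 2 j + k`, that is `i^l σ_x^j σ_z^k`. -/
def pauliOne (n : ℕ) : Matrix (Fin 2) (Fin 2) ℂ := Complex.I ^ (n / 4) • weyl (n / 2) n

/-- The two-qubit Pauli operator with code `n = 16 l + 8 j₁ + 4 k₁ + 2 j₂ + k₂`. -/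
def pauliTwo (n : ℕ) : Matrix (Fin 2 × Fin 2) (Fin 2 × Fin 2) ℂ :=
  Complex.I ^ (n / 16) • (weyl (n / 8) (n / 4) ⊗ₖ weyl (n / 2) n)

/-- The multiplication of codes of one-qubit Pauli operators. -/
def mulOne (a b : ℕ) : ℕ :=
  (a / 4 + b / 4 + 2 * (a * (b / 2))) % 4 * 4 + (a / 2 + b / 2) % 2 * 2 + (a + b) % 2

/-- The multiplication of codes of two-qubit Pauli operators. -/
def mulTwo (a b : ℕ) : ℕ :=
  (a / 16 + b / 16 + 2 * (a / 4 * (b / 8) + a * (b / 2))) % 4 * 16 + (a / 8 + b / 8) % 2 * 8 +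
    (a / 4 + b / 4) % 2 * 4 + (a / 2 + b / 2) % 2 * 2 + (a + b) % 2

lemma I_pow_congr {a b : ℕ} (h : a % 4 = b % 4) : Complex.I ^ a = Complex.I ^ b :=
  pow_eq_pow_of_mod Complex.I_pow_four h

lemma neg_one_pow_eq_I_pow (n : ℕ) : (-1 : ℂ) ^ n = Complex.I ^ (2 * n) := by
  rw [pow_mul, Complex.I_sq]

lemma pauliOne_mul (a b : ℕ) : pauliOne a * pauliOne b = pauliOne (mulOne a b) := by
  simp only [pauliOne, Matrix.smul_mul, Matrix.mul_smul, weyl_mul, smul_smul]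
  rw [neg_one_pow_eq_I_pow, ← pow_add, ← pow_add, mulOne]
  -- The sign exponent is nonlinear in the codes; hiding it in a variable leaves only linear
  -- arithmetic for `omega`.
  obtain ⟨L, hL⟩ : ∃ L, L = a / 4 + b / 4 + 2 * (a * (b / 2)) := ⟨_, rfl⟩
  obtain ⟨J, hJ⟩ : ∃ J, J = a / 2 + b / 2 := ⟨_, rfl⟩
  obtain ⟨K, hK⟩ : ∃ K, K = a + b := ⟨_, rfl⟩
  rw [← hL, ← hJ, ← hK]
  congr 1
  · apply I_pow_congr
    trans L % 4
    · rw [hL]; congr 1; ring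
    · clear hL hJ hK; omega
  · clear hL hJ hK
    apply weyl_congr <;> omega

lemma pauliTwo_mul (a b : ℕ) : pauliTwo a * pauliTwo b = pauliTwo (mulTwo a b) := by
  simp only [pauliTwo, Matrix.smul_mul, Matrix.mul_smul, ← Matrix.mul_kronecker_mul, weyl_mul,
    Matrix.smul_kronecker, Matrix.kronecker_smul, smul_smul]
  rw [neg_one_pow_eq_I_pow, neg_one_pow_eq_I_pow, ← pow_add, ← pow_add, ← pow_add, mulTwo]
  obtain ⟨L, hL⟩ : ∃ L, L = a / 16 + b / 16 + 2 * (a / 4 * (b / 8) + a * (b / 2)) := ⟨_, rfl⟩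
  obtain ⟨J, hJ⟩ : ∃ J, J = a / 8 + b / 8 := ⟨_, rfl⟩
  obtain ⟨K, hK⟩ : ∃ K, K = a / 4 + b / 4 := ⟨_, rfl⟩
  obtain ⟨J', hJ'⟩ : ∃ J', J' = a / 2 + b / 2 := ⟨_, rfl⟩
  obtain ⟨K', hK'⟩ : ∃ K', K' = a + b := ⟨_, rfl⟩
  rw [← hL, ← hJ, ← hK, ← hJ', ← hK']
  congr 1
  · apply I_pow_congr
    trans L % 4
    · rw [hL]; congr 1; ring
    · clear hL hJ hK hJ' hK'; omega
  · clear hL hJ hK hJ' hK'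
    congr 1 <;> apply weyl_congr <;> omega

lemma mulTwo_lt (a b : ℕ) : mulTwo a b < 64 := by rw [mulTwo]; omega

lemma mulOne_lt (a b : ℕ) : mulOne a b < 16 := by rw [mulOne]; omega

lemma pauliTwo_zero : pauliTwo 0 = 1 := by simp [pauliTwo, weyl_zero]

lemma pauliOne_zero : pauliOne 0 = 1 := by simp [pauliOne, weyl_zero]

lemma pauliTwo_mod (a : ℕ) : pauliTwo (a % 64) = pauliTwo a := by
  unfold pauliTwo
  congr 1
  · apply I_pow_congr; omega
  · congr 1 <;> apply weyl_congr <;> omega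

lemma pauliOne_mod (a : ℕ) : pauliOne (a % 16) = pauliOne a := by
  unfold pauliOne
  congr 1
  · apply I_pow_congr; omega
  · apply weyl_congr <;> omega

lemma pauliTwo_add_sixteen (a l : ℕ) : pauliTwo (a + 16 * l) = Complex.I ^ l • pauliTwo a := by
  unfold pauliTwo
  rw [smul_smul, ← pow_add]
  congr 1
  · apply I_pow_congr; omega
  · congr 1 <;> apply weyl_congr <;> omega

lemma pauliOne_add_four (a l : ℕ) : pauliOne (a + 4 * l) = Complex.I ^ l • pauliOne a := by
  unfold pauliOne
  rw [smul_smul, ← pow_add]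
  congr 1
  · apply I_pow_congr; omega
  · apply weyl_congr <;> omega

lemma pauliOne_kronecker_one (a : ℕ) :
    pauliOne a ⊗ₖ (1 : Matrix (Fin 2) (Fin 2) ℂ) = pauliTwo (4 * a) := by
  rw [pauliOne, pauliTwo, Matrix.smul_kronecker, ← weyl_zero]
  congr 1
  · apply I_pow_congr; omega
  · congr 1 <;> apply weyl_congr <;> omega

lemma pauliTwo_trace (a : ℕ) :
    (pauliTwo a).trace = if a % 16 = 0 then 4 * Complex.I ^ (a / 16) else 0 := by
  rw [pauliTwo, Matrix.trace_smul, Matrix.trace_kronecker, weyl_trace, weyl_trace]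
  by_cases h : a % 16 = 0
  · rw [if_pos h, if_pos (by omega), if_pos (by omega), smul_eq_mul]; ring
  · rw [if_neg h]
    by_cases h1 : a / 8 % 2 = 0 ∧ a / 4 % 2 = 0
    · rw [if_neg (c := a / 2 % 2 = 0 ∧ a % 2 = 0) (by omega)]; simp
    · rw [if_neg h1]; simp

/-- A Pauli operator with nontrivial tensor part is traceless, so only a power of i remains, and the
trace fixes it. -/
lemma pauliTwo_eq_one {a : ℕ} (ha : a < 64) (h : pauliTwo a = 1) : a = 0 := by
  have ht := pauliTwo_trace a
  rw [h, Matrix.trace_one] at ht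
  by_cases h0 : a % 16 = 0
  · rw [if_pos h0] at ht
    have hl : a / 16 < 4 := by omega
    have h1 : a = 16 * (a / 16) := by omega
    generalize a / 16 = l at *
    have hI : Complex.I ^ l = 1 := by simpa using ht.symm
    interval_cases l
    · omega
    · exact absurd (congrArg Complex.re hI) (by simp)
    · exact absurd (congrArg Complex.re hI) (by norm_num)
    · exact absurd (congrArg Complex.re hI) (by simp [Complex.I_pow_three])
  · rw [if_neg h0] at ht
    simp at ht

lemma pauliTwo_conjTranspose_mul (a : ℕ) : (pauliTwo a)ᴴ * pauliTwo a = 1 := by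
  rw [pauliTwo, Matrix.conjTranspose_smul, Matrix.conjTranspose_kronecker, Matrix.smul_mul,
    Matrix.mul_smul, ← Matrix.mul_kronecker_mul, weyl_conjTranspose_mul, weyl_conjTranspose_mul,
    smul_smul, Matrix.one_kronecker_one, star_pow, ← mul_pow]
  simp

lemma pauliTwo_mul_conjTranspose (a : ℕ) : pauliTwo a * (pauliTwo a)ᴴ = 1 :=
  mul_eq_one_comm.mp (pauliTwo_conjTranspose_mul a)

lemma pauliOne_conjTranspose_mul (a : ℕ) : (pauliOne a)ᴴ * pauliOne a = 1 := by
  rw [pauliOne, Matrix.conjTranspose_smul, Matrix.smul_mul,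
    Matrix.mul_smul, weyl_conjTranspose_mul, smul_smul, star_pow, ← mul_pow]
  simp

lemma pauliOne_mul_conjTranspose (a : ℕ) : pauliOne a * (pauliOne a)ᴴ = 1 :=
  mul_eq_one_comm.mp (pauliOne_conjTranspose_mul a)

/-- Every Pauli operator has order dividing four, so b³ inverts b, and equal operators a, b give b³a
= 1. The check recovers a = b from this. Finite checks are phrased with `Nat.beq` and Booleans so
that the kernel can evaluate them by its own arithmetic on numerals. -/
lemma mulTwo_cancel : ((List.range 64).all fun b => (List.range 64).all fun a =>
    !(Nat.beq (mulTwo (mulTwo b (mulTwo b b)) a) 0) || Nat.beq a b) = true := by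
  decide +kernel

lemma mulTwo_mul_self : ((List.range 64).all fun b =>
    Nat.beq (mulTwo (mulTwo b (mulTwo b b)) b) 0) = true := by
  decide +kernel

lemma pauliTwo_injOn {a b : ℕ} (ha : a < 64) (hb : b < 64) (h : pauliTwo a = pauliTwo b) :
    a = b := by
  have h1 := List.all_eq_true.mp (List.all_eq_true.mp mulTwo_cancel b (List.mem_range.mpr hb)) a
    (List.mem_range.mpr ha)
  have h2 := List.all_eq_true.mp mulTwo_mul_self b (List.mem_range.mpr hb)
  have h3 : mulTwo (mulTwo b (mulTwo b b)) a = 0 := by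
    refine pauliTwo_eq_one (mulTwo_lt _ _) ?_
    rw [← pauliTwo_mul, h, pauliTwo_mul, Nat.eq_of_beq_eq_true h2, pauliTwo_zero]
  simp only [h3, Nat.beq_refl, Bool.not_true, Bool.false_or] at h1
  exact Nat.eq_of_beq_eq_true h1

lemma pauliOne_injOn {a b : ℕ} (ha : a < 16) (hb : b < 16) (h : pauliOne a = pauliOne b) :
    a = b := by
  have := pauliTwo_injOn (a := 4 * a) (b := 4 * b) (by omega) (by omega)
    (by rw [← pauliOne_kronecker_one, h, pauliOne_kronecker_one])
  omega

lemma pauliTwo_mul_eq_iff {a b c : ℕ} (hc : c < 64) :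
    pauliTwo a * pauliTwo b = pauliTwo c ↔ mulTwo a b = c := by
  rw [pauliTwo_mul]
  exact ⟨fun h => pauliTwo_injOn (mulTwo_lt _ _) hc h, fun h => by rw [h]⟩

lemma pauliTwo_hermitian {a : ℕ} (h : mulTwo a a = 0) : (pauliTwo a)ᴴ = pauliTwo a := by
  have h1 : pauliTwo a * pauliTwo a = 1 := by rw [pauliTwo_mul, h, pauliTwo_zero]
  calc (pauliTwo a)ᴴ = (pauliTwo a)ᴴ * (pauliTwo a * pauliTwo a) := by rw [h1, mul_one]
    _ = _ := by rw [← mul_assoc, pauliTwo_conjTranspose_mul, one_mul]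

lemma pauliOne_hermitian {a : ℕ} (h : mulOne a a = 0) : (pauliOne a)ᴴ = pauliOne a := by
  have h1 : pauliOne a * pauliOne a = 1 := by rw [pauliOne_mul, h, pauliOne_zero]
  calc (pauliOne a)ᴴ = (pauliOne a)ᴴ * (pauliOne a * pauliOne a) := by rw [h1, mul_one]
    _ = _ := by rw [← mul_assoc, pauliOne_conjTranspose_mul, one_mul]

lemma mem_pauliGroupOne_iff {P : Matrix (Fin 2) (Fin 2) ℂ} :
    P ∈ pauliGroupOne ↔ ∃ a < 16, P = pauliOne a := by
  constructor
  · rintro ⟨l, j, k, rfl⟩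
    refine ⟨4 * l + 2 * j + k, by omega, ?_⟩
    rw [pauliOne]
    congr 1
    · apply I_pow_congr; omega
    · apply weyl_congr <;> omega
  · rintro ⟨a, ha, rfl⟩
    refine ⟨⟨a / 4, by omega⟩, ⟨a / 2 % 2, by omega⟩, ⟨a % 2, by omega⟩, ?_⟩
    rw [pauliOne]
    congr 1
    apply weyl_congr <;> simp

lemma mem_pauliGroupTwo_iff {P : Matrix (Fin 2 × Fin 2) (Fin 2 × Fin 2) ℂ} :
    P ∈ pauliGroupTwo ↔ ∃ a < 64, P = pauliTwo a := by
  constructor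
  · rintro ⟨l, j, k, j', k', rfl⟩
    refine ⟨16 * l + 8 * j + 4 * k + 2 * j' + k', by omega, ?_⟩
    rw [pauliTwo]
    congr 1
    · apply I_pow_congr; omega
    · congr 1 <;> apply weyl_congr <;> omega
  · rintro ⟨a, ha, rfl⟩
    refine ⟨⟨a / 16, by omega⟩, ⟨a / 8 % 2, by omega⟩, ⟨a / 4 % 2, by omega⟩,
      ⟨a / 2 % 2, by omega⟩, ⟨a % 2, by omega⟩, ?_⟩
    rw [pauliTwo]
    congr 2 <;> apply weyl_congr <;> simp

lemma pauliTwo_mem (a : ℕ) : pauliTwo a ∈ pauliGroupTwo :=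
  mem_pauliGroupTwo_iff.mpr ⟨a % 64, by omega, (pauliTwo_mod a).symm⟩

lemma pauliOne_mem (a : ℕ) : pauliOne a ∈ pauliGroupOne :=
  mem_pauliGroupOne_iff.mpr ⟨a % 16, by omega, (pauliOne_mod a).symm⟩

/-! ## Operator bases that are orthogonal for the trace form -/

/-- The operators `P u` form an orthogonal operator basis with squared length `c`. -/
def IsOperatorFrame {κ n : Type} [Fintype κ] [DecidableEq n] (P : κ → Matrix n n ℂ) (c : ℂ) :
    Prop :=
  ∀ i j k l, ∑ u, P u i j * star (P u k l) = if i = k ∧ j = l then c else 0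

lemma IsOperatorFrame.kronecker {κ κ' n n' : Type} [Fintype κ] [Fintype κ'] [DecidableEq n]
    [DecidableEq n'] {P : κ → Matrix n n ℂ} {P' : κ' → Matrix n' n' ℂ} {c c' : ℂ}
    (h : IsOperatorFrame P c) (h' : IsOperatorFrame P' c') :
    IsOperatorFrame (fun u : κ × κ' => P u.1 ⊗ₖ P' u.2) (c * c') := by
  rintro ⟨i, i'⟩ ⟨j, j'⟩ ⟨k, k'⟩ ⟨l, l'⟩
  have := congrArg₂ (· * ·) (h i j k l) (h' i' j' k' l')
  simp only [Finset.sum_mul_sum] at this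
  rw [Fintype.sum_prod_type]
  simp only [Matrix.kroneckerMap_apply, star_mul', Prod.mk.injEq]
  rw [show (if (i = k ∧ i' = k') ∧ j = l ∧ j' = l' then c * c' else 0)
    = (if i = k ∧ j = l then c else 0) * (if i' = k' ∧ j' = l' then c' else 0) by
      split_ifs <;> simp_all, ← this]
  exact Finset.sum_congr rfl fun u _ => Finset.sum_congr rfl fun v _ => by ring

lemma IsOperatorFrame.expand {κ n : Type} [Fintype κ] [Fintype n] [DecidableEq n]
    {P : κ → Matrix n n ℂ} {c : ℂ} (h : IsOperatorFrame P c) (M : Matrix n n ℂ) :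
    c • M = ∑ u, (P u * M).trace • (P u)ᴴ := by
  ext k l
  simp only [Matrix.smul_apply, Matrix.sum_apply, Matrix.conjTranspose_apply, Matrix.trace,
    Matrix.diag, Matrix.mul_apply, smul_eq_mul, Finset.sum_mul]
  rw [Finset.sum_comm]
  simp only [fun i => Finset.sum_comm (s := (Finset.univ : Finset κ))
    (t := (Finset.univ : Finset n)) (f := fun u j => P u i j * M j i * star (P u l k))]
  have : ∀ i j, ∑ u, P u i j * M j i * star (P u l k)
      = if i = l ∧ j = k then c * M j i else 0 := by
    intro i j
    have := congrArg (· * M j i) (h i j l k)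
    simp only [Finset.sum_mul, ite_mul, zero_mul] at this
    rw [← this]
    exact Finset.sum_congr rfl fun u _ => by ring
  simp only [this, ite_and, Finset.sum_ite_irrel, Finset.sum_ite_eq', Finset.mem_univ, if_true,
    Finset.sum_const_zero]

lemma weyl_frame : IsOperatorFrame (fun u : Fin 2 × Fin 2 => weyl u.1 u.2) 2 := by
  intro i j k l
  fin_cases i <;> fin_cases j <;> fin_cases k <;> fin_cases l <;>
    simp [Fintype.sum_prod_type, weyl, pauliX, pauliZ] <;> norm_num

lemma pauliTwo_frame : IsOperatorFrame (fun u : Fin 16 => pauliTwo u) 4 := by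
  have h := weyl_frame.kronecker weyl_frame
  intro i j k l
  rw [show (4 : ℂ) = 2 * 2 by norm_num, ← h i j k l]
  -- A code below 16 carries no phase. It splits into two base-four digits, one per qubit, and each
  -- digit into its σ_x and σ_z bits.
  let e : Fin 16 ≃ (Fin 2 × Fin 2) × Fin 2 × Fin 2 :=
    finProdFinEquiv (m := 4) (n := 4) |>.symm.trans
      ((finProdFinEquiv (m := 2) (n := 2)).symm.prodCongr (finProdFinEquiv (m := 2) (n := 2)).symm)
  refine Fintype.sum_equiv e _ _ fun u => ?_
  have : pauliTwo u = weyl (e u).1.1 (e u).1.2 ⊗ₖ weyl (e u).2.1 (e u).2.2 := by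
    rw [pauliTwo, Nat.div_eq_of_lt u.2, pow_zero, one_smul]
    congr 1 <;> apply weyl_congr <;>
      simp [e, finProdFinEquiv, Fin.divNat, Fin.modNat] <;> omega
  simp only [this]

lemma IsOperatorFrame.expand' {κ n : Type} [Fintype κ] [Fintype n] [DecidableEq n]
    {P : κ → Matrix n n ℂ} {c : ℂ} (h : IsOperatorFrame P c) (M : Matrix n n ℂ) :
    star c • M = ∑ u, star (P u * Mᴴ).trace • P u := by
  have := congrArg Matrix.conjTranspose (h.expand Mᴴ)
  rw [Matrix.conjTranspose_smul, Matrix.conjTranspose_conjTranspose,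
    Matrix.conjTranspose_sum] at this
  simpa only [Matrix.conjTranspose_smul, Matrix.conjTranspose_conjTranspose] using this

lemma IsOperatorFrame.linearMap_ext {κ n V : Type} [Fintype κ] [Fintype n] [DecidableEq n]
    [AddCommGroup V] [Module ℂ V] {P : κ → Matrix n n ℂ} {c : ℂ} (h : IsOperatorFrame P c)
    (hc : c ≠ 0) {f g : Matrix n n ℂ →ₗ[ℂ] V} (hfg : ∀ u, f (P u) = g (P u)) : f = g := by
  ext1 M
  have hM : M = (star c)⁻¹ • ∑ u, star (P u * Mᴴ).trace • P u := by
    rw [← h.expand', smul_smul, inv_mul_cancel₀ (star_ne_zero.mpr hc), one_smul]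
  rw [hM]
  simp only [map_smul, map_sum, hfg]

/-- The twirl ∑ P_u M P_u† equals a multiple of the trace of M times 1 by completeness of the frame,
and a nonzero multiple of M if M commutes with the unitary P_u. -/
lemma IsOperatorFrame.scalar_of_commute {κ n : Type} [Fintype κ] [Nonempty κ] [Fintype n]
    [DecidableEq n] {P : κ → Matrix n n ℂ} {c : ℂ} (h : IsOperatorFrame P c)
    (hP : ∀ u, P u * (P u)ᴴ = 1) {M : Matrix n n ℂ} (hM : ∀ u, P u * M = M * P u) :
    ∃ z : ℂ, M = z • 1 := by
  have h1 : ∑ u, P u * M * (P u)ᴴ = (Fintype.card κ : ℂ) • M := by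
    rw [Finset.sum_congr rfl fun u _ => by rw [hM u, mul_assoc, hP u, mul_one]]
    simp [Nat.cast_smul_eq_nsmul]
  have h2 : ∑ u, P u * M * (P u)ᴴ = (c * M.trace) • (1 : Matrix n n ℂ) := by
    ext i k
    simp only [Matrix.sum_apply, Matrix.mul_apply, Matrix.conjTranspose_apply, Finset.sum_mul,
      Matrix.smul_apply, Matrix.one_apply, smul_eq_mul]
    rw [Finset.sum_comm]
    have : ∀ l, ∑ u, ∑ j, P u i j * M j l * star (P u k l) = if i = k then c * M l l else 0 := by
      intro l
      rw [Finset.sum_comm]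
      have : ∀ j, ∑ u, P u i j * M j l * star (P u k l)
          = if i = k ∧ j = l then c * M j l else 0 := by
        intro j
        have := congrArg (· * M j l) (h i j k l)
        simp only [Finset.sum_mul, ite_mul, zero_mul] at this
        rw [← this]
        exact Finset.sum_congr rfl fun u _ => by ring
      simp only [this, ite_and, Finset.sum_ite_irrel, Finset.sum_ite_eq', Finset.mem_univ,
        if_true, Finset.sum_const_zero]
    simp only [this, Finset.sum_ite_irrel, Finset.sum_const_zero, ← Finset.mul_sum, mul_ite,
      mul_one, mul_zero]
    rfl
  have hcard : (Fintype.card κ : ℂ) ≠ 0 := Nat.cast_ne_zero.mpr Fintype.card_ne_zero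
  refine ⟨(Fintype.card κ : ℂ)⁻¹ * (c * M.trace), ?_⟩
  rw [mul_smul, ← h2, h1, smul_smul, inv_mul_cancel₀ hcard, one_smul]

/-! ## Implementing symmetries by unitaries of determinant one -/

-- Schur's argument: U†U commutes with all X s, hence is a scalar, and the scalar is positive
-- because U†U is a nonzero positive semidefinite matrix. Rescaling U makes it unitary, and a phase
-- then adjusts the determinant.
open scoped ComplexOrder in
lemma exists_specialUnitary_of_intertwiner {ι σ : Type} [Fintype ι] [DecidableEq ι] [Nonempty ι]
    {X A : σ → Matrix ι ι ℂ} (hX : ∀ s, (X s)ᴴ = X s) (hA : ∀ s, (A s)ᴴ = A s)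
    (hcomm : ∀ M : Matrix ι ι ℂ, (∀ s, M * X s = X s * M) → ∃ c : ℂ, M = c • 1)
    {U : Matrix ι ι ℂ} (hU : U ≠ 0) (h : ∀ s, U * X s = A s * U) :
    ∃ V ∈ Matrix.specialUnitaryGroup ι ℂ, ∀ s, V * X s * Vᴴ = A s := by
  have h' : ∀ s, Uᴴ * A s = X s * Uᴴ := by
    intro s
    have := congrArg Matrix.conjTranspose (h s)
    rw [Matrix.conjTranspose_mul, Matrix.conjTranspose_mul, hX, hA] at this
    exact this.symm
  obtain ⟨c, hc⟩ := hcomm (Uᴴ * U) fun s => by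
    rw [mul_assoc, h, ← mul_assoc, h', mul_assoc]
  obtain ⟨i⟩ := ‹Nonempty ι›
  have hci : c = (Uᴴ * U) i i := by rw [hc]; simp
  have hpos : 0 ≤ c := by
    rw [hci]
    exact (Matrix.posSemidef_conjTranspose_mul_self U).diag_nonneg
  have hc0 : c ≠ 0 := by
    rintro rfl
    rw [zero_smul] at hc
    exact hU (Matrix.conjTranspose_mul_self_eq_zero.mp hc)
  obtain ⟨r, hr, rfl⟩ : ∃ r : ℝ, 0 < r ∧ c = (r : ℂ) := by
    have h1 := Complex.nonneg_iff.mp hpos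
    have h2 : c = (c.re : ℂ) := Complex.ext (by simp) (by simp [← h1.2])
    refine ⟨c.re, lt_of_le_of_ne h1.1 fun h0 => hc0 ?_, h2⟩
    rw [h2, ← h0]; simp
  have hs : ((Real.sqrt r : ℝ) : ℂ) * ((Real.sqrt r : ℝ) : ℂ) = r := by
    rw [← Complex.ofReal_mul, Real.mul_self_sqrt hr.le]
  have hs0 : ((Real.sqrt r : ℝ) : ℂ) ≠ 0 :=
    Complex.ofReal_ne_zero.mpr (Real.sqrt_pos.mpr hr).ne'
  set V₀ : Matrix ι ι ℂ := ((Real.sqrt r : ℝ) : ℂ)⁻¹ • U with hV₀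
  have hV₀u : V₀ᴴ * V₀ = 1 := by
    rw [hV₀, Matrix.conjTranspose_smul, Matrix.smul_mul, Matrix.mul_smul, hc, smul_smul,
      smul_smul, star_inv₀]
    have : star ((Real.sqrt r : ℝ) : ℂ) = ((Real.sqrt r : ℝ) : ℂ) := Complex.conj_ofReal _
    rw [this, ← hs]
    rw [mul_mul_mul_comm, inv_mul_cancel₀ hs0, one_mul, one_smul]
  have hdet : star V₀.det * V₀.det = 1 := by
    rw [← Matrix.det_conjTranspose, ← Matrix.det_mul, hV₀u, Matrix.det_one]
  have hdet0 : V₀.det ≠ 0 := right_ne_zero_of_mul_eq_one hdet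
  have : Nonempty ι := ⟨i⟩
  -- Scaling by w multiplies the determinant by w to the power of the dimension, hence the root; w
  -- has modulus one because the determinant does.
  obtain ⟨w, hw⟩ := IsAlgClosed.exists_pow_nat_eq (V₀.det)⁻¹ (Fintype.card_pos (α := ι))
  have hw1 : ‖w‖ = 1 := by
    have h1 : ‖V₀.det‖ = 1 := by
      have := congrArg norm hdet
      rw [norm_mul, norm_star, norm_one, ← pow_two] at this
      exact (pow_eq_one_iff_of_nonneg (norm_nonneg _) two_ne_zero).mp this
    have := congrArg norm hw
    rw [norm_pow, norm_inv, h1, inv_one] at this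
    exact (pow_eq_one_iff_of_nonneg (norm_nonneg _) Fintype.card_ne_zero).mp this
  have hww : star w * w = 1 := by
    have := Complex.conj_mul' w
    rw [hw1] at this
    simpa using this
  have hV : (w • V₀)ᴴ * (w • V₀) = 1 := by
    rw [Matrix.conjTranspose_smul, Matrix.smul_mul, Matrix.mul_smul, hV₀u, smul_smul, hww, one_smul]
  refine ⟨w • V₀, ?_, fun s => ?_⟩
  · rw [Matrix.mem_specialUnitaryGroup_iff, Matrix.mem_unitaryGroup_iff']
    refine ⟨hV, ?_⟩
    rw [Matrix.det_smul, hw, inv_mul_cancel₀ hdet0]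
  · have : w • V₀ * X s = A s * (w • V₀) := by
      rw [hV₀, Matrix.smul_mul, Matrix.smul_mul, h, Matrix.mul_smul, Matrix.mul_smul]
    rw [this, mul_assoc, mul_eq_one_comm.mp hV, mul_one]

lemma trace_eq_zero_of_anticommute {ι : Type} [Fintype ι] [DecidableEq ι] {A B : Matrix ι ι ℂ}
    (hA : A * A = 1) (h : A * B = -(B * A)) : B.trace = 0 := by
  have h1 : (A * B * A).trace = -B.trace := by
    rw [h, Matrix.neg_mul, mul_assoc, hA, mul_one, Matrix.trace_neg]
  rw [Matrix.trace_mul_comm, ← mul_assoc, hA, one_mul] at h1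
  linear_combination h1 / 2

/-- p/4 projects onto the common +1 eigenspace of B₁ and B₂, and its trace is 1 since B₁, B₂ and
B₁B₂ each anticommute with an involution. A nonzero column v of p plays the role of |00⟩, and U has
the column A₁^a A₂^b v at |ab⟩. The four relations then follow from the commutation rules. -/
lemma exists_intertwiner_two {A₁ B₁ A₂ B₂ : Matrix (Fin 2 × Fin 2) (Fin 2 × Fin 2) ℂ}
    (hA₁ : A₁ * A₁ = 1) (hB₁ : B₁ * B₁ = 1) (hA₂ : A₂ * A₂ = 1) (hB₂ : B₂ * B₂ = 1)
    (h₁ : A₁ * B₁ = -(B₁ * A₁)) (h₂ : A₂ * B₂ = -(B₂ * A₂)) (hA : A₁ * A₂ = A₂ * A₁)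
    (hAB : A₁ * B₂ = B₂ * A₁) (hBA : B₁ * A₂ = A₂ * B₁) (hB : B₁ * B₂ = B₂ * B₁) :
    ∃ U : Matrix (Fin 2 × Fin 2) (Fin 2 × Fin 2) ℂ, U ≠ 0 ∧ U * (pauliX ⊗ₖ 1) = A₁ * U ∧
      U * (pauliZ ⊗ₖ 1) = B₁ * U ∧ U * (1 ⊗ₖ pauliX) = A₂ * U ∧ U * (1 ⊗ₖ pauliZ) = B₂ * U := by
  set p := (1 + B₁) * (1 + B₂) with hp
  have hB₁p : B₁ * p = p := by
    rw [hp, ← mul_assoc, mul_add B₁, mul_one, hB₁, add_comm B₁ 1]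
  have hB₂p : B₂ * p = p := by
    have : p = (1 + B₂) * (1 + B₁) := by
      rw [hp]; simp only [mul_add, add_mul, mul_one, one_mul, hB]; abel
    rw [this, ← mul_assoc, mul_add B₂, mul_one, hB₂, add_comm B₂ 1]
  have htr : p.trace = 4 := by
    have e1 := trace_eq_zero_of_anticommute hA₁ h₁
    have e2 := trace_eq_zero_of_anticommute hA₂ h₂
    have e3 : (B₁ * B₂).trace = 0 := trace_eq_zero_of_anticommute hA₁ (by
      rw [← mul_assoc, h₁, neg_mul, mul_assoc, hAB, mul_assoc])
    rw [hp]
    simp only [mul_add, add_mul, mul_one, one_mul, Matrix.trace_add, e1, e2, e3, Matrix.trace_one]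
    simp
  obtain ⟨j, hj⟩ : ∃ j, p j j ≠ 0 := by
    by_contra! hcon
    simp [Matrix.trace, hcon] at htr
  have cancel : ∀ {A : Matrix (Fin 2 × Fin 2) (Fin 2 × Fin 2) ℂ}, A * A = 1 →
      ∀ M, A * (A * M) = M := fun h M => by rw [← mul_assoc, h, one_mul]
  have comm : ∀ {A B : Matrix (Fin 2 × Fin 2) (Fin 2 × Fin 2) ℂ}, A * B = B * A →
      ∀ M, B * (A * M) = A * (B * M) := fun h M => by rw [← mul_assoc, ← h, mul_assoc]
  have anti : ∀ {A B : Matrix (Fin 2 × Fin 2) (Fin 2 × Fin 2) ℂ}, A * B = -(B * A) →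
      ∀ M, B * (A * M) = -(A * (B * M)) := fun h M => by
    rw [← mul_assoc, ← mul_assoc, h, neg_mul, neg_neg]
  let W : Fin 2 × Fin 2 → Matrix (Fin 2 × Fin 2) (Fin 2 × Fin 2) ℂ :=
    fun q => ![![p, A₂ * p], ![A₁ * p, A₁ * (A₂ * p)]] q.1 q.2
  let U : Matrix (Fin 2 × Fin 2) (Fin 2 × Fin 2) ℂ := Matrix.of fun i q => W q i j
  have hmul : ∀ (A : Matrix (Fin 2 × Fin 2) (Fin 2 × Fin 2) ℂ) i q, (A * U) i q = (A * W q) i j := fun A i q => by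
    simp [U, Matrix.mul_apply]
  refine ⟨U, fun h0 => hj (congrFun (congrFun h0 j) (0, 0)), ?_, ?_, ?_, ?_⟩
  · ext i ⟨a, b⟩
    rw [hmul, Matrix.mul_apply]
    fin_cases a <;> fin_cases b <;>
      simp [W, U, Fintype.sum_prod_type, pauliX, Matrix.one_apply,
        cancel hA₁]
  · ext i ⟨a, b⟩
    rw [hmul, Matrix.mul_apply]
    fin_cases a <;> fin_cases b <;>
      simp [W, U, Fintype.sum_prod_type, pauliZ, Matrix.one_apply,
        anti h₁, comm hBA.symm, hB₁p]
  · ext i ⟨a, b⟩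
    rw [hmul, Matrix.mul_apply]
    fin_cases a <;> fin_cases b <;>
      simp [W, U, Fintype.sum_prod_type, pauliX, Matrix.one_apply,
        cancel hA₂, comm hA]
  · ext i ⟨a, b⟩
    rw [hmul, Matrix.mul_apply]
    fin_cases a <;> fin_cases b <;>
      simp [W, U, Fintype.sum_prod_type, pauliZ, Matrix.one_apply,
        anti h₂, comm hAB, hB₂p]

lemma exists_intertwiner_one {A B : Matrix (Fin 2) (Fin 2) ℂ}
    (hA : A * A = 1) (hB : B * B = 1) (h : A * B = -(B * A)) :
    ∃ U : Matrix (Fin 2) (Fin 2) ℂ, U ≠ 0 ∧ U * pauliX = A * U ∧ U * pauliZ = B * U := by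
  set p := 1 + B with hp
  have hBp : B * p = p := by rw [hp, mul_add, mul_one, hB, add_comm B 1]
  have htr : p.trace = 2 := by
    rw [hp, Matrix.trace_add, trace_eq_zero_of_anticommute hA h, Matrix.trace_one]
    simp
  obtain ⟨j, hj⟩ : ∃ j, p j j ≠ 0 := by
    by_contra! hcon
    simp [Matrix.trace, hcon] at htr
  have anti : B * (A * p) = -(A * (B * p)) := by
    rw [← mul_assoc, ← mul_assoc, h, neg_mul, neg_neg]
  have cancel : A * (A * p) = p := by rw [← mul_assoc, hA, one_mul]
  let W : Fin 2 → Matrix (Fin 2) (Fin 2) ℂ := ![p, A * p]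
  let U : Matrix (Fin 2) (Fin 2) ℂ := Matrix.of fun i q => W q i j
  have hmul : ∀ (A : Matrix (Fin 2) (Fin 2) ℂ) i q, (A * U) i q = (A * W q) i j := fun A i q => by
    simp [U, Matrix.mul_apply]
  refine ⟨U, fun h0 => hj (congrFun (congrFun h0 j) 0), ?_, ?_⟩
  · ext i a
    rw [hmul, Matrix.mul_apply]
    fin_cases a <;> simp [W, U, pauliX, cancel]
  · ext i a
    rw [hmul, Matrix.mul_apply]
    fin_cases a <;> simp [W, U, pauliZ, anti, hBp]

/-! ## Commutation relations -/

/-- The exponent `s` in `P Q = (-1)^s Q P` for the one-qubit Pauli operators with codes `a`, `b`. -/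
def sympOne (a b : ℕ) : ℕ := (a * (b / 2) + b * (a / 2)) % 2

/-- The exponent `s` in `P Q = (-1)^s Q P` for the two-qubit Pauli operators with codes `a`, `b`. -/
def sympTwo (a b : ℕ) : ℕ :=
  (a / 4 * (b / 8) + b / 4 * (a / 8) + a * (b / 2) + b * (a / 2)) % 2

lemma neg_one_pow_congr {a b : ℕ} (h : a % 2 = b % 2) : (-1 : ℂ) ^ a = (-1) ^ b :=
  pow_eq_pow_of_mod (by norm_num) h

lemma weyl_comm (j k j' k' : ℕ) :
    weyl j k * weyl j' k' = (-1 : ℂ) ^ (k * j' + k' * j) • (weyl j' k' * weyl j k) := by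
  rw [weyl_mul, weyl_mul, smul_smul, ← pow_add, add_comm j, add_comm k]
  congr 1
  apply neg_one_pow_congr
  omega

lemma pauliOne_comm (a b : ℕ) :
    pauliOne a * pauliOne b = (-1 : ℂ) ^ sympOne a b • (pauliOne b * pauliOne a) := by
  simp only [pauliOne, Matrix.smul_mul, Matrix.mul_smul, weyl_comm (a / 2) a, smul_smul]
  congr 1
  rw [neg_one_pow_congr (a := a * (b / 2) + b * (a / 2)) (b := sympOne a b) (by simp [sympOne])]
  ring

lemma pauliTwo_comm (a b : ℕ) :
    pauliTwo a * pauliTwo b = (-1 : ℂ) ^ sympTwo a b • (pauliTwo b * pauliTwo a) := by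
  simp only [pauliTwo, Matrix.smul_mul, Matrix.mul_smul, ← Matrix.mul_kronecker_mul,
    weyl_comm (a / 2) a, weyl_comm (a / 8) (a / 4), Matrix.smul_kronecker, Matrix.kronecker_smul,
    smul_smul]
  congr 1
  rw [neg_one_pow_congr (a := sympTwo a b)
    (b := (a * (b / 2) + b * (a / 2)) + (a / 4 * (b / 8) + b / 4 * (a / 8)))
    (by rw [sympTwo, Nat.mod_mod]; congr 1; ring), pow_add]
  ring

lemma neg_one_pow_injOn {a b : ℕ} (ha : a < 2) (hb : b < 2) (h : (-1 : ℂ) ^ a = (-1) ^ b) :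
    a = b := by
  interval_cases a <;> interval_cases b <;> first | rfl | norm_num at h

lemma sympTwo_lt (a b : ℕ) : sympTwo a b < 2 := Nat.mod_lt _ two_pos

lemma sympOne_lt (a b : ℕ) : sympOne a b < 2 := Nat.mod_lt _ two_pos

lemma pauliTwo_ne_zero (a : ℕ) : pauliTwo a ≠ 0 := by
  intro h
  have := pauliTwo_mul_conjTranspose a
  rw [h, zero_mul] at this
  exact zero_ne_one this

lemma pauliOne_ne_zero (a : ℕ) : pauliOne a ≠ 0 := by
  intro h
  have := pauliOne_mul_conjTranspose a
  rw [h, zero_mul] at this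
  exact zero_ne_one this

lemma sympTwo_unique {a b s : ℕ} (hs : s < 2)
    (h : pauliTwo a * pauliTwo b = (-1 : ℂ) ^ s • (pauliTwo b * pauliTwo a)) :
    sympTwo a b = s := by
  refine neg_one_pow_injOn (sympTwo_lt _ _) hs ?_
  rw [pauliTwo_comm, pauliTwo_mul] at h
  exact smul_left_injective ℂ (pauliTwo_ne_zero _) h

lemma sympOne_unique {a b s : ℕ} (hs : s < 2)
    (h : pauliOne a * pauliOne b = (-1 : ℂ) ^ s • (pauliOne b * pauliOne a)) :
    sympOne a b = s := by
  refine neg_one_pow_injOn (sympOne_lt _ _) hs ?_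
  rw [pauliOne_comm, pauliOne_mul] at h
  exact smul_left_injective ℂ (pauliOne_ne_zero _) h

/-! ## Generators of the Pauli groups -/

lemma pauliTwo_eight : pauliTwo 8 = pauliX ⊗ₖ 1 := by
  rw [pauliTwo, show weyl (8 / 8) (8 / 4) = weyl 1 0 from weyl_congr rfl rfl,
    show weyl (8 / 2) 8 = weyl 0 0 from weyl_congr rfl rfl]
  simp [weyl]

lemma pauliTwo_four : pauliTwo 4 = pauliZ ⊗ₖ 1 := by
  rw [pauliTwo, show weyl (4 / 8) (4 / 4) = weyl 0 1 from weyl_congr rfl rfl,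
    show weyl (4 / 2) 4 = weyl 0 0 from weyl_congr rfl rfl]
  simp [weyl]

lemma pauliTwo_two : pauliTwo 2 = 1 ⊗ₖ pauliX := by
  rw [pauliTwo, show weyl (2 / 8) (2 / 4) = weyl 0 0 from weyl_congr rfl rfl,
    show weyl (2 / 2) 2 = weyl 1 0 from weyl_congr rfl rfl]
  simp [weyl]

lemma pauliTwo_one : pauliTwo 1 = 1 ⊗ₖ pauliZ := by
  rw [pauliTwo, show weyl (1 / 8) (1 / 4) = weyl 0 0 from weyl_congr rfl rfl,
    show weyl (1 / 2) 1 = weyl 0 1 from weyl_congr rfl rfl]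
  simp [weyl]

lemma pauliOne_two : pauliOne 2 = pauliX := by
  rw [pauliOne, show weyl (2 / 2) 2 = weyl 1 0 from weyl_congr rfl rfl]
  simp [weyl]

lemma pauliOne_one : pauliOne 1 = pauliZ := by
  rw [pauliOne, show weyl (1 / 2) 1 = weyl 0 1 from weyl_congr rfl rfl]
  simp [weyl]

lemma pauliOne_seven : pauliOne 7 = pauliY := by
  rw [pauliY_eq, pauliOne, show weyl (7 / 2) 7 = weyl 1 1 from weyl_congr rfl rfl]
  simp

lemma kronecker_one_pow (A : Matrix (Fin 2) (Fin 2) ℂ) (n : ℕ) :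
    (A ⊗ₖ (1 : Matrix (Fin 2) (Fin 2) ℂ)) ^ n = (A ^ n) ⊗ₖ 1 := by
  induction n with
  | zero => simp
  | succ n ih => rw [pow_succ, ih, ← Matrix.mul_kronecker_mul, pow_succ, one_mul]

lemma one_kronecker_pow (A : Matrix (Fin 2) (Fin 2) ℂ) (n : ℕ) :
    ((1 : Matrix (Fin 2) (Fin 2) ℂ) ⊗ₖ A) ^ n = 1 ⊗ₖ (A ^ n) := by
  induction n with
  | zero => simp
  | succ n ih => rw [pow_succ, ih, ← Matrix.mul_kronecker_mul, pow_succ, one_mul]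

lemma pauliTwo_eq_generators (a : ℕ) :
    pauliTwo a = Complex.I ^ (a / 16) • (pauliTwo 8 ^ (a / 8) * pauliTwo 4 ^ (a / 4) *
      pauliTwo 2 ^ (a / 2) * pauliTwo 1 ^ a) := by
  rw [pauliTwo_eight, pauliTwo_four, pauliTwo_two, pauliTwo_one, kronecker_one_pow,
    kronecker_one_pow, one_kronecker_pow, one_kronecker_pow, ← Matrix.mul_kronecker_mul,
    ← Matrix.mul_kronecker_mul, ← Matrix.mul_kronecker_mul]
  simp only [mul_one, one_mul]
  rfl

lemma pauliOne_eq_generators (a : ℕ) :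
    pauliOne a = Complex.I ^ (a / 4) • (pauliOne 2 ^ (a / 2) * pauliOne 1 ^ a) := by
  rw [pauliOne_two, pauliOne_one]
  rfl

lemma pauliTwo_generators_commutant {M : Matrix (Fin 2 × Fin 2) (Fin 2 × Fin 2) ℂ}
    (h : ∀ g ∈ ({8, 4, 2, 1} : Set ℕ), M * pauliTwo g = pauliTwo g * M) :
    ∃ c : ℂ, M = c • 1 := by
  refine pauliTwo_frame.scalar_of_commute (fun u => pauliTwo_mul_conjTranspose u) fun u => ?_
  have hc : ∀ g ∈ ({8, 4, 2, 1} : Set ℕ), Commute (pauliTwo g) M := fun g hg => (h g hg).symm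
  change Commute (pauliTwo u) M
  rw [pauliTwo_eq_generators]
  refine Commute.smul_left (((Commute.mul_left (Commute.mul_left ?_ ?_) ?_)).mul_left ?_) _
  all_goals exact (hc _ (by simp)).pow_left _

lemma weyl_generators_commutant {M : Matrix (Fin 2) (Fin 2) ℂ}
    (hX : M * pauliX = pauliX * M) (hZ : M * pauliZ = pauliZ * M) : ∃ c : ℂ, M = c • 1 := by
  refine weyl_frame.scalar_of_commute (fun u => ?_) fun u => ?_
  · exact mul_eq_one_comm.mp (weyl_conjTranspose_mul _ _)
  · have hX' : Commute pauliX M := hX.symm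
    have hZ' : Commute pauliZ M := hZ.symm
    exact (hX'.pow_left _).mul_left (hZ'.pow_left _)

/-! ## Conjugation by unitaries -/

lemma conjBy_apply {ι : Type} [Fintype ι] [DecidableEq ι] (U X : Matrix ι ι ℂ) :
    conjBy U X = U * X * Uᴴ := rfl

lemma conjBy_mul {ι : Type} [Fintype ι] [DecidableEq ι] {U : Matrix ι ι ℂ} (hU : Uᴴ * U = 1)
    (X Y : Matrix ι ι ℂ) : conjBy U (X * Y) = conjBy U X * conjBy U Y := by
  simp only [conjBy_apply]
  rw [show U * X * Uᴴ * (U * Y * Uᴴ) = U * X * (Uᴴ * U) * Y * Uᴴ by simp only [mul_assoc], hU,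
    mul_one]
  simp only [mul_assoc]

lemma conjBy_one {ι : Type} [Fintype ι] [DecidableEq ι] {U : Matrix ι ι ℂ} (hU : Uᴴ * U = 1) :
    conjBy U 1 = 1 := by
  rw [conjBy_apply, mul_one, mul_eq_one_comm.mp hU]

lemma conjBy_pow {ι : Type} [Fintype ι] [DecidableEq ι] {U : Matrix ι ι ℂ} (hU : Uᴴ * U = 1)
    (X : Matrix ι ι ℂ) (n : ℕ) : conjBy U (X ^ n) = conjBy U X ^ n := by
  induction n with
  | zero => rw [pow_zero, pow_zero, conjBy_one hU]
  | succ n ih => rw [pow_succ, conjBy_mul hU, ih, pow_succ]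

lemma IsClifford.conjTranspose_mul {ι : Type} [Fintype ι] [DecidableEq ι] {Q : Set (Matrix ι ι ℂ)}
    {C : Matrix ι ι ℂ} (h : IsClifford Q C) : Cᴴ * C = 1 :=
  Matrix.mem_unitaryGroup_iff'.mp (Matrix.mem_specialUnitaryGroup_iff.mp h.1).1

lemma exists_pauliTwo_pow (a n : ℕ) : ∃ b, pauliTwo a ^ n = pauliTwo b := by
  induction n with
  | zero => exact ⟨0, by rw [pow_zero, pauliTwo_zero]⟩
  | succ n ih =>
    obtain ⟨b, hb⟩ := ih
    exact ⟨mulTwo b a, by rw [pow_succ, hb, pauliTwo_mul]⟩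

lemma exists_pauliOne_pow (a n : ℕ) : ∃ b, pauliOne a ^ n = pauliOne b := by
  induction n with
  | zero => exact ⟨0, by rw [pow_zero, pauliOne_zero]⟩
  | succ n ih =>
    obtain ⟨b, hb⟩ := ih
    exact ⟨mulOne b a, by rw [pow_succ, hb, pauliOne_mul]⟩

lemma isClifford_two_of_generators {C : Matrix (Fin 2 × Fin 2) (Fin 2 × Fin 2) ℂ}
    (hC : C ∈ Matrix.specialUnitaryGroup (Fin 2 × Fin 2) ℂ)
    (h : ∀ g ∈ ({8, 4, 2, 1} : Set ℕ), ∃ b, conjBy C (pauliTwo g) = pauliTwo b) :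
    IsClifford pauliGroupTwo C := by
  refine ⟨hC, fun P hP => ?_⟩
  obtain ⟨a, -, rfl⟩ := mem_pauliGroupTwo_iff.mp hP
  have hU : Cᴴ * C = 1 :=
    Matrix.mem_unitaryGroup_iff'.mp (Matrix.mem_specialUnitaryGroup_iff.mp hC).1
  have hpow : ∀ g ∈ ({8, 4, 2, 1} : Set ℕ), ∀ n : ℕ,
      ∃ b, conjBy C (pauliTwo g) ^ n = pauliTwo b := by
    intro g hg n
    obtain ⟨b, hb⟩ := h g hg
    rw [hb]
    exact exists_pauliTwo_pow b n
  obtain ⟨b₁, h₁⟩ := hpow 8 (by simp) (a / 8)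
  obtain ⟨b₂, h₂⟩ := hpow 4 (by simp) (a / 4)
  obtain ⟨b₃, h₃⟩ := hpow 2 (by simp) (a / 2)
  obtain ⟨b₄, h₄⟩ := hpow 1 (by simp) a
  change conjBy C (pauliTwo a) ∈ _
  rw [pauliTwo_eq_generators, map_smul, conjBy_mul hU, conjBy_mul hU, conjBy_mul hU,
    conjBy_pow hU, conjBy_pow hU, conjBy_pow hU, conjBy_pow hU, h₁, h₂, h₃, h₄, pauliTwo_mul,
    pauliTwo_mul, pauliTwo_mul, ← pauliTwo_add_sixteen]
  exact pauliTwo_mem _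

lemma isClifford_one_of_generators {C : Matrix (Fin 2) (Fin 2) ℂ}
    (hC : C ∈ Matrix.specialUnitaryGroup (Fin 2) ℂ)
    (hX : ∃ b, conjBy C (pauliOne 2) = pauliOne b) (hZ : ∃ b, conjBy C (pauliOne 1) = pauliOne b) :
    IsClifford pauliGroupOne C := by
  refine ⟨hC, fun P hP => ?_⟩
  obtain ⟨a, -, rfl⟩ := mem_pauliGroupOne_iff.mp hP
  have hU : Cᴴ * C = 1 :=
    Matrix.mem_unitaryGroup_iff'.mp (Matrix.mem_specialUnitaryGroup_iff.mp hC).1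
  obtain ⟨b, hb⟩ := hX
  obtain ⟨b', hb'⟩ := hZ
  obtain ⟨c, hc⟩ := exists_pauliOne_pow b (a / 2)
  obtain ⟨c', hc'⟩ := exists_pauliOne_pow b' a
  change conjBy C (pauliOne a) ∈ _
  rw [pauliOne_eq_generators, map_smul, conjBy_mul hU, conjBy_pow hU, conjBy_pow hU, hb, hb', hc,
    hc', pauliOne_mul, ← pauliOne_add_four]
  exact pauliOne_mem _

/-! ## Clifford operations as images of the generators -/

/-- The codes of the Hermitian two-qubit Pauli operators. -/
def hermTwo : List ℕ :=
  [0, 1, 2, 4, 5, 6, 8, 9, 10, 15, 19, 23, 27, 28, 29, 30, 32, 33, 34, 36, 37, 38, 40, 41, 42, 47,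
    51, 55, 59, 60, 61, 62]

lemma hermTwo_eq_filter : hermTwo = (List.range 64).filter fun a => Nat.beq (mulTwo a a) 0 := by
  decide +kernel

lemma mem_hermTwo_iff {a : ℕ} : a ∈ hermTwo ↔ a < 64 ∧ mulTwo a a = 0 := by
  rw [hermTwo_eq_filter, List.mem_filter, List.mem_range, Nat.beq_eq]

/-- The images `(x₁, z₁, x₂, z₂)` of `σ_x ⊗ 1`, `σ_z ⊗ 1`, `1 ⊗ σ_x`, `1 ⊗ σ_z` under a Clifford
operation. -/
def IsTableau (t : ℕ × ℕ × ℕ × ℕ) : Prop :=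
  (t.1 ∈ hermTwo ∧ t.2.1 ∈ hermTwo ∧ t.2.2.1 ∈ hermTwo ∧ t.2.2.2 ∈ hermTwo) ∧
    sympTwo t.1 t.2.1 = 1 ∧ sympTwo t.2.2.1 t.2.2.2 = 1 ∧ sympTwo t.1 t.2.2.1 = 0 ∧
      sympTwo t.1 t.2.2.2 = 0 ∧ sympTwo t.2.1 t.2.2.1 = 0 ∧ sympTwo t.2.1 t.2.2.2 = 0

/-- The map `T` has the tableau `t`. -/
def HasTableau (T : SuperOp (Fin 2 × Fin 2)) (t : ℕ × ℕ × ℕ × ℕ) : Prop :=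
  T (pauliTwo 8) = pauliTwo t.1 ∧ T (pauliTwo 4) = pauliTwo t.2.1 ∧
    T (pauliTwo 2) = pauliTwo t.2.2.1 ∧ T (pauliTwo 1) = pauliTwo t.2.2.2

lemma IsTableau.lt {t : ℕ × ℕ × ℕ × ℕ} (ht : IsTableau t) :
    t.1 < 64 ∧ t.2.1 < 64 ∧ t.2.2.1 < 64 ∧ t.2.2.2 < 64 :=
  ⟨(mem_hermTwo_iff.mp ht.1.1).1, (mem_hermTwo_iff.mp ht.1.2.1).1,
    (mem_hermTwo_iff.mp ht.1.2.2.1).1, (mem_hermTwo_iff.mp ht.1.2.2.2).1⟩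

lemma HasTableau.unique {T : SuperOp (Fin 2 × Fin 2)} {t t' : ℕ × ℕ × ℕ × ℕ}
    (h : HasTableau T t) (h' : HasTableau T t') (ht : IsTableau t) (ht' : IsTableau t') :
    t = t' := by
  obtain ⟨l1, l2, l3, l4⟩ := ht.lt
  obtain ⟨l1', l2', l3', l4'⟩ := ht'.lt
  exact Prod.ext (pauliTwo_injOn l1 l1' (h.1.symm.trans h'.1))
    (Prod.ext (pauliTwo_injOn l2 l2' (h.2.1.symm.trans h'.2.1))
      (Prod.ext (pauliTwo_injOn l3 l3' (h.2.2.1.symm.trans h'.2.2.1))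
        (pauliTwo_injOn l4 l4' (h.2.2.2.symm.trans h'.2.2.2))))

/-- Conjugations are multiplicative, so the images of the generators determine those of all Pauli
operators, which span. -/
lemma HasTableau.ext {T T' : SuperOp (Fin 2 × Fin 2)} {t : ℕ × ℕ × ℕ × ℕ}
    (hT : T ∈ cliffordOps pauliGroupTwo) (hT' : T' ∈ cliffordOps pauliGroupTwo)
    (h : HasTableau T t) (h' : HasTableau T' t) : T = T' := by
  obtain ⟨C, hC, rfl⟩ := hT
  obtain ⟨C', hC', rfl⟩ := hT'
  have hU := hC.conjTranspose_mul
  have hU' := hC'.conjTranspose_mul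
  refine pauliTwo_frame.linearMap_ext (by norm_num) fun u => ?_
  obtain ⟨h1, h2, h3, h4⟩ := h
  obtain ⟨h1', h2', h3', h4'⟩ := h'
  rw [pauliTwo_eq_generators, map_smul, conjBy_mul hU, conjBy_mul hU, conjBy_mul hU,
    conjBy_pow hU, conjBy_pow hU, conjBy_pow hU, conjBy_pow hU, h1, h2, h3, h4, map_smul,
    conjBy_mul hU', conjBy_mul hU', conjBy_mul hU',
    conjBy_pow hU', conjBy_pow hU', conjBy_pow hU', conjBy_pow hU', h1', h2', h3', h4']

/-- Conjugation preserves squares and commutation signs. A Pauli operator is Hermitian exactly if it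
squares to 1, so Hermiticity of the images is read off from squares. -/
lemma exists_tableau {T : SuperOp (Fin 2 × Fin 2)} (hT : T ∈ cliffordOps pauliGroupTwo) :
    ∃ t, IsTableau t ∧ HasTableau T t := by
  obtain ⟨C, hC, rfl⟩ := hT
  have hU := hC.conjTranspose_mul
  have him : ∀ g, ∃ a < 64, conjBy C (pauliTwo g) = pauliTwo a := fun g =>
    mem_pauliGroupTwo_iff.mp (hC.2 _ (pauliTwo_mem g))
  have hherm : ∀ g a, a < 64 → mulTwo g g = 0 → conjBy C (pauliTwo g) = pauliTwo a →
      a ∈ hermTwo := by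
    intro g a ha hg h
    refine mem_hermTwo_iff.mpr ⟨ha, ?_⟩
    rw [← pauliTwo_mul_eq_iff (by norm_num), ← h, ← conjBy_mul hU, pauliTwo_mul, hg,
      pauliTwo_zero, conjBy_one hU]
  have hsymp : ∀ g g' a a', conjBy C (pauliTwo g) = pauliTwo a →
      conjBy C (pauliTwo g') = pauliTwo a' → sympTwo a a' = sympTwo g g' := by
    intro g g' a a' h h'
    refine sympTwo_unique (sympTwo_lt _ _) ?_
    rw [← h, ← h', ← conjBy_mul hU, ← conjBy_mul hU, pauliTwo_comm g g', map_smul]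
  obtain ⟨a₁, l₁, h₁⟩ := him 8
  obtain ⟨a₂, l₂, h₂⟩ := him 4
  obtain ⟨a₃, l₃, h₃⟩ := him 2
  obtain ⟨a₄, l₄, h₄⟩ := him 1
  exact ⟨(a₁, a₂, a₃, a₄), ⟨⟨hherm _ _ l₁ rfl h₁, hherm _ _ l₂ rfl h₂, hherm _ _ l₃ rfl h₃,
    hherm _ _ l₄ rfl h₄⟩, hsymp _ _ _ _ h₁ h₂, hsymp _ _ _ _ h₃ h₄, hsymp _ _ _ _ h₁ h₃,
    hsymp _ _ _ _ h₁ h₄, hsymp _ _ _ _ h₂ h₃, hsymp _ _ _ _ h₂ h₄⟩, h₁, h₂, h₃, h₄⟩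

/-- The tableau conditions are the hypotheses of `exists_intertwiner_two`. The intertwiner
normalises to determinant one because the generators have only scalars in their commutant. -/
lemma exists_clifford_of_tableau {t : ℕ × ℕ × ℕ × ℕ} (ht : IsTableau t) :
    ∃ C, IsClifford pauliGroupTwo C ∧ HasTableau (conjBy C) t := by
  obtain ⟨⟨m1, m2, m3, m4⟩, s1, s2, s3, s4, s5, s6⟩ := ht
  have sq : ∀ {a}, a ∈ hermTwo → pauliTwo a * pauliTwo a = 1 := fun h => by
    rw [pauliTwo_mul, (mem_hermTwo_iff.mp h).2, pauliTwo_zero]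
  have herm : ∀ {a}, a ∈ hermTwo → (pauliTwo a)ᴴ = pauliTwo a := fun h =>
    pauliTwo_hermitian (mem_hermTwo_iff.mp h).2
  have anti : ∀ {a b}, sympTwo a b = 1 → pauliTwo a * pauliTwo b = -(pauliTwo b * pauliTwo a) :=
    fun h => by rw [pauliTwo_comm, h, pow_one, neg_one_smul]
  have comm : ∀ {a b}, sympTwo a b = 0 → pauliTwo a * pauliTwo b = pauliTwo b * pauliTwo a :=
    fun h => by rw [pauliTwo_comm, h, pow_zero, one_smul]
  obtain ⟨U, hU, h1, h2, h3, h4⟩ := exists_intertwiner_two (sq m1) (sq m2) (sq m3) (sq m4)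
    (anti s1) (anti s2) (comm s3) (comm s4) (comm s5) (comm s6)
  rw [← pauliTwo_eight] at h1
  rw [← pauliTwo_four] at h2
  rw [← pauliTwo_two] at h3
  rw [← pauliTwo_one] at h4
  obtain ⟨C, hC, hCt⟩ := exists_specialUnitary_of_intertwiner
    (X := ![pauliTwo 8, pauliTwo 4, pauliTwo 2, pauliTwo 1])
    (A := ![pauliTwo t.1, pauliTwo t.2.1, pauliTwo t.2.2.1, pauliTwo t.2.2.2])
    (by intro s; fin_cases s <;> exact pauliTwo_hermitian rfl)
    (by intro s; fin_cases s; exacts [herm m1, herm m2, herm m3, herm m4])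
    (by
      intro M hM
      refine pauliTwo_generators_commutant fun g hg => ?_
      rcases hg with rfl | rfl | rfl | rfl
      exacts [hM 0, hM 1, hM 2, hM 3]) hU
    (by intro s; fin_cases s; exacts [h1, h2, h3, h4])
  have ht : HasTableau (conjBy C) t := ⟨hCt 0, hCt 1, hCt 2, hCt 3⟩
  refine ⟨C, isClifford_two_of_generators hC fun g hg => ?_, ht⟩
  rcases hg with rfl | rfl | rfl | rfl
  exacts [⟨_, ht.1⟩, ⟨_, ht.2.1⟩, ⟨_, ht.2.2.1⟩, ⟨_, ht.2.2.2⟩]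

/-! ## One-qubit Clifford operations -/

/-- The codes of the one-qubit Pauli operators `±σ_x`, `±σ_y`, `±σ_z`. -/
def hermOne : List ℕ := [1, 2, 7, 9, 10, 15]

lemma hermOne_eq_filter :
    hermOne = (List.range 16).filter fun a => Nat.beq (mulOne a a) 0 && !Nat.beq (a % 4) 0 := by
  decide +kernel

lemma mem_hermOne_iff {a : ℕ} : a ∈ hermOne ↔ a < 16 ∧ mulOne a a = 0 ∧ a % 4 ≠ 0 := by
  rw [hermOne_eq_filter, List.mem_filter, List.mem_range]
  simp only [Bool.and_eq_true, Nat.beq_eq, Bool.not_eq_true', ← Bool.not_eq_true]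

lemma exists_clifford_one {x z : ℕ} (hx : x ∈ hermOne) (hz : z ∈ hermOne)
    (hs : sympOne x z = 1) :
    ∃ C, IsClifford pauliGroupOne C ∧ conjBy C pauliX = pauliOne x ∧
      conjBy C pauliZ = pauliOne z := by
  have sq : ∀ {a}, a ∈ hermOne → pauliOne a * pauliOne a = 1 := fun h => by
    rw [pauliOne_mul, (mem_hermOne_iff.mp h).2.1, pauliOne_zero]
  have herm : ∀ {a}, a ∈ hermOne → (pauliOne a)ᴴ = pauliOne a := fun h =>
    pauliOne_hermitian (mem_hermOne_iff.mp h).2.1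
  obtain ⟨U, hU, h1, h2⟩ := exists_intertwiner_one (sq hx) (sq hz)
    (by rw [pauliOne_comm, hs, pow_one, neg_one_smul])
  obtain ⟨C, hC, hCt⟩ := exists_specialUnitary_of_intertwiner
    (X := ![pauliX, pauliZ]) (A := ![pauliOne x, pauliOne z])
    (by intro s; fin_cases s; exacts [pauliX_conjTranspose, pauliZ_conjTranspose])
    (by intro s; fin_cases s; exacts [herm hx, herm hz])
    (fun M hM => weyl_generators_commutant (hM 0) (hM 1)) hU
    (by intro s; fin_cases s; exacts [h1, h2])
  refine ⟨C, isClifford_one_of_generators hC ⟨x, ?_⟩ ⟨z, ?_⟩, hCt 0, hCt 1⟩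
  · rw [pauliOne_two]; exact hCt 0
  · rw [pauliOne_one]; exact hCt 1

/-- A code divisible by four is a scalar. The images of σ_x and σ_z anticommute, so neither can be
one. -/
lemma exists_images_of_clifford_one {C : Matrix (Fin 2) (Fin 2) ℂ}
    (hC : IsClifford pauliGroupOne C) :
    ∃ x ∈ hermOne, ∃ z ∈ hermOne, sympOne x z = 1 ∧ conjBy C pauliX = pauliOne x ∧
      conjBy C pauliZ = pauliOne z := by
  have hU := hC.conjTranspose_mul
  obtain ⟨x, hx, h1⟩ := mem_pauliGroupOne_iff.mp (hC.2 _ (pauliOne_mem 2))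
  obtain ⟨z, hz, h2⟩ := mem_pauliGroupOne_iff.mp (hC.2 _ (pauliOne_mem 1))
  rw [← conjBy_apply] at h1 h2
  have hs : sympOne x z = 1 := by
    refine sympOne_unique one_lt_two ?_
    rw [← h1, ← h2, ← conjBy_mul hU, ← conjBy_mul hU, pauliOne_comm 2 1, map_smul]
    rfl
  have hmul : ∀ {g a}, a < 16 → mulOne g g = 0 → conjBy C (pauliOne g) = pauliOne a →
      mulOne a a = 0 := by
    intro g a ha hg h
    refine pauliOne_injOn (mulOne_lt _ _) (by norm_num) ?_
    rw [← pauliOne_mul, ← h, ← conjBy_mul hU, pauliOne_mul, hg, pauliOne_zero, conjBy_one hU]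
  refine ⟨x, mem_hermOne_iff.mpr ⟨hx, hmul (g := 2) hx rfl h1, fun h0 => ?_⟩, z,
    mem_hermOne_iff.mpr ⟨hz, hmul (g := 1) hz rfl h2, fun h0 => ?_⟩, hs, by rwa [← pauliOne_two],
    by rwa [← pauliOne_one]⟩
  · obtain ⟨y, rfl⟩ : ∃ y, x = 4 * y := ⟨x / 4, by omega⟩
    rw [sympOne, show 4 * y * (z / 2) + z * (4 * y / 2) = 2 * (2 * y * (z / 2) + z * y) by
      rw [show 4 * y / 2 = 2 * y by omega]; ring, Nat.mul_mod_right] at hs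
    exact zero_ne_one hs
  · obtain ⟨y, rfl⟩ : ∃ y, z = 4 * y := ⟨z / 4, by omega⟩
    rw [sympOne, show x * (4 * y / 2) + 4 * y * (x / 2) = 2 * (x * y + 2 * y * (x / 2)) by
      rw [show 4 * y / 2 = 2 * y by omega]; ring, Nat.mul_mod_right] at hs
    exact zero_ne_one hs

/-! ## One-qubit maps from the images of the Pauli operators -/

/-- The linear map that sends `1, σ_x, σ_y, σ_z` to `A, B, C, D`. -/
def blochMap (A B C D : Matrix (Fin 2) (Fin 2) ℂ) : SuperOp (Fin 2) where
  toFun ρ := (1 / 2 : ℂ) • (ρ.trace • A + (pauliX * ρ).trace • B + (pauliY * ρ).trace • C +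
    (pauliZ * ρ).trace • D)
  map_add' X Y := by
    simp only [Matrix.mul_add, Matrix.trace_add, add_smul, smul_add]
    abel
  map_smul' c X := by
    simp only [Matrix.mul_smul, Matrix.trace_smul, smul_eq_mul, RingHom.id_apply, ← smul_smul,
      ← smul_add]
    rw [smul_comm]

lemma blochMap_apply (A B C D ρ : Matrix (Fin 2) (Fin 2) ℂ) :
    blochMap A B C D ρ = (1 / 2 : ℂ) • (ρ.trace • A + (pauliX * ρ).trace • B +
      (pauliY * ρ).trace • C + (pauliZ * ρ).trace • D) := rfl

lemma pauliY_mul_self : pauliY * pauliY = 1 := by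
  ext i j; fin_cases i <;> fin_cases j <;> simp [pauliY]

lemma trace_pauliX : pauliX.trace = 0 := by simp [pauliX, Matrix.trace_fin_two]

lemma trace_pauliY : pauliY.trace = 0 := by simp [pauliY, Matrix.trace_fin_two]

lemma trace_pauliZ : pauliZ.trace = 0 := by simp [pauliZ, Matrix.trace_fin_two]

lemma trace_pauliX_mul_pauliY : (pauliX * pauliY).trace = 0 := by
  simp [pauliX, pauliY, Matrix.trace_fin_two]

lemma trace_pauliX_mul_pauliZ : (pauliX * pauliZ).trace = 0 := by
  simp [pauliX, pauliZ, Matrix.trace_fin_two]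

lemma trace_pauliY_mul_pauliZ : (pauliY * pauliZ).trace = 0 := by
  simp [pauliY, pauliZ, Matrix.trace_fin_two]

lemma trace_pauliY_mul_pauliX : (pauliY * pauliX).trace = 0 := by
  rw [Matrix.trace_mul_comm, trace_pauliX_mul_pauliY]

lemma trace_pauliZ_mul_pauliX : (pauliZ * pauliX).trace = 0 := by
  rw [Matrix.trace_mul_comm, trace_pauliX_mul_pauliZ]

lemma trace_pauliZ_mul_pauliY : (pauliZ * pauliY).trace = 0 := by
  rw [Matrix.trace_mul_comm, trace_pauliY_mul_pauliZ]

lemma trace_one_two : (1 : Matrix (Fin 2) (Fin 2) ℂ).trace = 2 := by simp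

section

variable (A B C D : Matrix (Fin 2) (Fin 2) ℂ)

lemma blochMap_one : blochMap A B C D 1 = A := by
  rw [blochMap_apply, mul_one, mul_one, mul_one, trace_pauliX, trace_pauliY, trace_pauliZ,
    trace_one_two]
  simp [smul_smul]

lemma blochMap_pauliX : blochMap A B C D pauliX = B := by
  rw [blochMap_apply, pauliX_mul_self, trace_pauliY_mul_pauliX, trace_pauliZ_mul_pauliX,
    trace_pauliX, trace_one_two]
  simp [smul_smul]

lemma blochMap_pauliY : blochMap A B C D pauliY = C := by
  rw [blochMap_apply, pauliY_mul_self, trace_pauliX_mul_pauliY, trace_pauliZ_mul_pauliY,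
    trace_pauliY, trace_one_two]
  simp [smul_smul]

lemma blochMap_pauliZ : blochMap A B C D pauliZ = D := by
  rw [blochMap_apply, pauliZ_mul_self, trace_pauliX_mul_pauliZ, trace_pauliY_mul_pauliZ,
    trace_pauliZ, trace_one_two]
  simp [smul_smul]

end

lemma superOp_ext {Φ Ψ : SuperOp (Fin 2)} (h1 : Φ 1 = Ψ 1) (hX : Φ pauliX = Ψ pauliX)
    (hY : Φ pauliY = Ψ pauliY) (hZ : Φ pauliZ = Ψ pauliZ) : Φ = Ψ := by
  refine weyl_frame.linearMap_ext two_ne_zero ?_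
  rintro ⟨j, k⟩
  fin_cases j <;> fin_cases k
  · simpa [weyl] using h1
  · simpa [weyl] using hZ
  · simpa [weyl] using hX
  · rw [pauliY_eq, map_smul, map_smul] at hY
    exact smul_right_injective _ Complex.I_ne_zero hY

lemma eq_blochMap (Φ : SuperOp (Fin 2)) :
    Φ = blochMap (Φ 1) (Φ pauliX) (Φ pauliY) (Φ pauliZ) :=
  superOp_ext (blochMap_one ..).symm (blochMap_pauliX ..).symm (blochMap_pauliY ..).symm
    (blochMap_pauliZ ..).symm

/-- Zero for the code `0`, and the Pauli operator with code `n` for the code `n + 1`. -/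
def pauliOrZero : ℕ → Matrix (Fin 2) (Fin 2) ℂ
  | 0 => 0
  | n + 1 => pauliOne n

lemma pauliOrZero_injOn {a b : ℕ} (ha : a ≤ 16) (hb : b ≤ 16)
    (h : pauliOrZero a = pauliOrZero b) : a = b := by
  rcases a with _ | a <;> rcases b with _ | b
  · rfl
  · exact absurd h.symm (pauliOne_ne_zero b)
  · exact absurd h (pauliOne_ne_zero a)
  · rw [pauliOne_injOn (by omega) (by omega) h]

/-- The one-qubit map with the code `c`. -/
def codedMap (c : ℕ × ℕ × ℕ × ℕ) : SuperOp (Fin 2) :=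
  blochMap (1 + pauliOrZero c.1) (pauliOrZero c.2.1) (pauliOrZero c.2.2.1) (pauliOrZero c.2.2.2)

/-- All entries of a code of a one-qubit map are at most `16`. -/
def IsCode (c : ℕ × ℕ × ℕ × ℕ) : Prop := c.1 ≤ 16 ∧ c.2.1 ≤ 16 ∧ c.2.2.1 ≤ 16 ∧ c.2.2.2 ≤ 16

lemma codedMap_injOn {c c' : ℕ × ℕ × ℕ × ℕ} (hc : IsCode c) (hc' : IsCode c')
    (h : codedMap c = codedMap c') : c = c' := by
  have h0 := LinearMap.congr_fun h 1
  have hX := LinearMap.congr_fun h pauliX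
  have hY := LinearMap.congr_fun h pauliY
  have hZ := LinearMap.congr_fun h pauliZ
  simp only [codedMap, blochMap_one, blochMap_pauliX, blochMap_pauliY, blochMap_pauliZ] at *
  exact Prod.ext (pauliOrZero_injOn hc.1 hc'.1 (add_left_cancel h0))
    (Prod.ext (pauliOrZero_injOn hc.2.1 hc'.2.1 hX)
      (Prod.ext (pauliOrZero_injOn hc.2.2.1 hc'.2.2.1 hY)
        (pauliOrZero_injOn hc.2.2.2 hc'.2.2.2 hZ)))

/-! ## The code of an induced channel -/

/-- The code of half the partial trace over the environment of a two-qubit Pauli operator. -/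
def reduceCode (c : ℕ) : ℕ := bif Nat.beq (c % 4) 0 then c / 4 + 1 else 0

/-- The code of `i x z`. -/
def codeY (x z : ℕ) : ℕ := (16 + mulTwo x z) % 64

/-- The code of the image of a Pauli operator under the induced channel, where `q` is its image
under the Clifford operation and `z` is the image of `1 ⊗ σ_z`. -/
def inducedCode (q z : ℕ) : ℕ := reduceCode q + reduceCode (mulTwo q z)

/-- The code of the channel that is induced by the Clifford operation with tableau `t`. -/
def channelCode (t : ℕ × ℕ × ℕ × ℕ) : ℕ × ℕ × ℕ × ℕ :=
  (reduceCode t.2.2.2, inducedCode t.1 t.2.2.2, inducedCode (codeY t.1 t.2.1) t.2.2.2,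
    inducedCode t.2.1 t.2.2.2)

lemma traceEnv_pauliTwo (c : ℕ) :
    traceEnv (pauliTwo c) = (2 : ℂ) • pauliOrZero (reduceCode c) := by
  have h1 : traceEnv (pauliTwo c)
      = Complex.I ^ (c / 16) • ((weyl (c / 2) c).trace • weyl (c / 8) (c / 4)) := by
    ext i j
    simp [traceEnv, pauliTwo, Matrix.kroneckerMap_apply, Matrix.trace, Matrix.diag,
      Fin.sum_univ_two]
    ring
  rw [h1, weyl_trace]
  by_cases h : c % 4 = 0
  · have : reduceCode c = c / 4 + 1 := by simp [reduceCode, h]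
    rw [if_pos (by omega), this, pauliOrZero, pauliOne, smul_comm, smul_smul, smul_smul]
    congr 1
    · rw [show c / 4 / 4 = c / 16 by omega]
    · rw [show c / 4 / 2 = c / 8 by omega]
  · have : reduceCode c = 0 := by
      have : Nat.beq (c % 4) 0 = false := by
        rw [← Bool.not_eq_true, Nat.beq_eq]; exact h
      simp [reduceCode, this]
    rw [if_neg (by omega), this, pauliOrZero]
    simp

lemma traceEnv_add {α ε : Type} [Fintype ε] (M N : Matrix (α × ε) (α × ε) ℂ) :
    traceEnv (M + N) = traceEnv M + traceEnv N := by
  ext i j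
  simp [traceEnv, Finset.sum_add_distrib]

lemma traceEnv_smul {α ε : Type} [Fintype ε] (c : ℂ) (M : Matrix (α × ε) (α × ε) ℂ) :
    traceEnv (c • M) = c • traceEnv M := by
  ext i j
  simp [traceEnv, Finset.mul_sum]

lemma induced_apply {α ε : Type} [Fintype ε] [DecidableEq ε] (e : ε) (T : SuperOp (α × ε))
    (ρ : Matrix α α ℂ) : induced e T ρ = traceEnv (T (ρ ⊗ₖ Matrix.single e e (1 : ℂ))) := rfl

lemma single_zero_zero_eq : Matrix.single (0 : Fin 2) (0 : Fin 2) (1 : ℂ)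
    = (1 / 2 : ℂ) • (1 + pauliZ) := by
  ext i j
  fin_cases i <;> fin_cases j <;> norm_num [pauliZ, Matrix.single]

/-- The environment state is (1 + σ_z)/2, so ρ ⊗ |0⟩⟨0| is half of (ρ⊗1)(1 + 1⊗σ_z), whose image is
half of q + qz. The factor 1/2 cancels the 2 of the partial trace over a trivial environment factor.
-/
lemma induced_of_image {C : Matrix (Fin 2 × Fin 2) (Fin 2 × Fin 2) ℂ} (hC : Cᴴ * C = 1)
    {ρ : Matrix (Fin 2) (Fin 2) ℂ} {q z : ℕ} (hq : conjBy C (ρ ⊗ₖ 1) = pauliTwo q)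
    (hz : conjBy C (pauliTwo 1) = pauliTwo z) :
    induced 0 (conjBy C) ρ =
      pauliOrZero (reduceCode q) + pauliOrZero (reduceCode (mulTwo q z)) := by
  have : ρ ⊗ₖ pauliZ = (ρ ⊗ₖ 1) * pauliTwo 1 := by
    rw [pauliTwo_one, ← Matrix.mul_kronecker_mul, mul_one, one_mul]
  rw [induced_apply, single_zero_zero_eq, Matrix.kronecker_smul, Matrix.kronecker_add, this,
    map_smul, map_add, conjBy_mul hC, hq, hz, pauliTwo_mul, traceEnv_smul, traceEnv_add,
    traceEnv_pauliTwo, traceEnv_pauliTwo, ← smul_add, smul_smul]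
  norm_num

/-- This justifies adding codes as numbers in `inducedCode`, since for σ_x, σ_y and σ_z at least one
of the two terms vanishes. -/
lemma pauliOrZero_add {a b : ℕ} (h : a = 0 ∨ b = 0) :
    pauliOrZero a + pauliOrZero b = pauliOrZero (a + b) := by
  rcases h with rfl | rfl
  · rw [zero_add, pauliOrZero, zero_add]
  · rw [add_zero, pauliOrZero, add_zero]

/-! ## The two kinds of codes -/

/-- The code of `i x z` on one qubit. -/
def codeYOne (x z : ℕ) : ℕ := (4 + mulOne x z) % 16

/-- The codes of the one-qubit Clifford operations. -/
def unitaryCodes : List (ℕ × ℕ × ℕ × ℕ) :=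
  hermOne.flatMap fun x => (hermOne.filter fun z => Nat.beq (sympOne x z) 1).map fun z =>
    (0, x + 1, codeYOne x z + 1, z + 1)

/-- The codes of the contractions to the vertices of the octahedron. -/
def contractionCodes : List (ℕ × ℕ × ℕ × ℕ) := hermOne.map fun h => (h + 1, 0, 0, 0)

/-- The codes of the even mixtures of two Clifford operations. -/
def mixtureCodes : List (ℕ × ℕ × ℕ × ℕ) :=
  hermOne.flatMap fun h => [(0, h + 1, 0, 0), (0, 0, h + 1, 0), (0, 0, 0, h + 1)]

/-- Equality of codes. -/
def codeBeq (c c' : ℕ × ℕ × ℕ × ℕ) : Bool :=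
  Nat.beq c.1 c'.1 && Nat.beq c.2.1 c'.2.1 && Nat.beq c.2.2.1 c'.2.2.1 && Nat.beq c.2.2.2 c'.2.2.2

lemma codeBeq_iff {c c' : ℕ × ℕ × ℕ × ℕ} : codeBeq c c' = true ↔ c = c' := by
  simp only [codeBeq, Bool.and_eq_true, Nat.beq_eq]
  constructor
  · rintro ⟨⟨⟨h1, h2⟩, h3⟩, h4⟩
    exact Prod.ext h1 (Prod.ext h2 (Prod.ext h3 h4))
  · rintro rfl
    exact ⟨⟨⟨rfl, rfl⟩, rfl⟩, rfl⟩

/-- All codes of induced channels. -/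
def allCodes : List (ℕ × ℕ × ℕ × ℕ) := unitaryCodes ++ (contractionCodes ++ mixtureCodes)

/-- At least one of two numbers is zero. -/
def oneIsZero (a b : ℕ) : Bool := Nat.beq a 0 || Nat.beq b 0

/-- The induced channel does not depend on x₂, so x₂ is left out of the search and 0 stands in for
it. What the existence of x₂ says about z₂ is kept as the condition z₂ ≠ ±1, that is, a code not
divisible by 32. -/
lemma channelCode_check : (hermTwo.all fun z₂ => hermTwo.all fun x₁ =>
    !Nat.beq (sympTwo x₁ z₂) 0 || hermTwo.all fun z₁ =>
      !(Nat.beq (sympTwo x₁ z₁) 1 && Nat.beq (sympTwo z₁ z₂) 0) || (Nat.beq (z₂ % 32) 0 ||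
        (allCodes.any (codeBeq (channelCode (x₁, z₁, 0, z₂))) &&
        oneIsZero (reduceCode x₁) (reduceCode (mulTwo x₁ z₂)) &&
        oneIsZero (reduceCode z₁) (reduceCode (mulTwo z₁ z₂)) &&
        oneIsZero (reduceCode (codeY x₁ z₁)) (reduceCode (mulTwo (codeY x₁ z₁) z₂))))) = true := by
  decide +kernel

/-- The tableaux of the Clifford operations that induce the channel with code `c`. -/
def tableauxOfCode (c : ℕ × ℕ × ℕ × ℕ) : List (ℕ × ℕ × ℕ × ℕ) :=
  (hermTwo.filter fun z₂ => Nat.beq (reduceCode z₂) c.1).flatMap fun z₂ =>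
  (hermTwo.filter fun x₁ => Nat.beq (sympTwo x₁ z₂) 0 &&
    Nat.beq (inducedCode x₁ z₂) c.2.1).flatMap fun x₁ =>
  (hermTwo.filter fun z₁ => Nat.beq (sympTwo x₁ z₁) 1 && Nat.beq (sympTwo z₁ z₂) 0 &&
    Nat.beq (inducedCode z₁ z₂) c.2.2.2 &&
    Nat.beq (inducedCode (codeY x₁ z₁) z₂) c.2.2.1).flatMap fun z₁ =>
  (hermTwo.filter fun x₂ => Nat.beq (sympTwo x₂ z₂) 1 && Nat.beq (sympTwo x₁ x₂) 0 &&
    Nat.beq (sympTwo z₁ x₂) 0).map fun x₂ => (x₁, z₁, x₂, z₂)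

/-- For the identity channel, z₂ is one of the six ±1⊗σ, each of x₁, z₁ may or may not carry a
factor z₂, and the three commutation conditions leave 4 of the 32 Hermitian operators for x₂:
6·2·2·4 = 96. -/
lemma length_tableauxOfCode_unitary :
    (unitaryCodes.all fun c => Nat.beq (tableauxOfCode c).length 96) = true := by
  decide +kernel

/-- For a contraction, z₂ = ±σ⊗1 is prescribed, and 12, 8 and 4 choices remain for x₁, z₁ and x₂,
which makes 384. -/
lemma length_tableauxOfCode_rankTwo : ((contractionCodes ++ mixtureCodes).all fun c =>
    Nat.beq (tableauxOfCode c).length 384) = true := by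
  decide +kernel

lemma hermTwo_nodup : hermTwo.Nodup := by
  rw [hermTwo_eq_filter]
  exact List.nodup_range.filter _

lemma nodup_tableauxOfCode (c : ℕ × ℕ × ℕ × ℕ) : (tableauxOfCode c).Nodup := by
  unfold tableauxOfCode
  refine List.nodup_flatMap.mpr ⟨fun z₂ _ => List.nodup_flatMap.mpr ⟨fun x₁ _ =>
    List.nodup_flatMap.mpr ⟨fun z₁ _ => (hermTwo_nodup.filter _).map fun a b h => ?_, ?_⟩, ?_⟩, ?_⟩
  · simpa using h
  all_goals
    refine (hermTwo_nodup.filter _).imp fun {a b} hab => ?_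
    intro t h h'
    simp only [List.mem_flatMap, List.mem_map] at h h'
    aesop

lemma mem_tableauxOfCode {c t : ℕ × ℕ × ℕ × ℕ} :
    t ∈ tableauxOfCode c ↔ IsTableau t ∧ channelCode t = c := by
  obtain ⟨x₁, z₁, x₂, z₂⟩ := t
  obtain ⟨c₀, c₁, c₂, c₃⟩ := c
  simp only [tableauxOfCode, List.mem_flatMap, List.mem_map, List.mem_filter, Bool.and_eq_true,
    Nat.beq_eq, IsTableau, channelCode, Prod.mk.injEq]
  constructor
  · rintro ⟨_, h1, _, h2, _, h3, _, h4, rfl, rfl, rfl, rfl⟩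
    tauto
  · rintro ⟨h, h'⟩
    exact ⟨z₂, by tauto, x₁, by tauto, z₁, by tauto, x₂, by tauto, rfl, rfl, rfl, rfl⟩

/-! ## The induced channels and their multiplicities -/

/-- ±1 commutes with everything, but z₂ must anticommute with x₂. -/
lemma IsTableau.snd_mod_ne {t : ℕ × ℕ × ℕ × ℕ} (ht : IsTableau t) : t.2.2.2 % 32 ≠ 0 := by
  intro h
  have hs := ht.2.2.1
  obtain ⟨y, hy⟩ : ∃ y, t.2.2.2 = 32 * y := ⟨t.2.2.2 / 32, by omega⟩
  generalize t.2.2.1 = a at hs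
  rw [hy, sympTwo, show 32 * y / 8 = 4 * y by omega, show 32 * y / 4 = 8 * y by omega,
    show 32 * y / 2 = 16 * y by omega,
    show a / 4 * (4 * y) + 8 * y * (a / 8) + a * (16 * y) + 32 * y * (a / 2)
      = 2 * (a / 4 * (2 * y) + 4 * y * (a / 8) + a * (8 * y) + 16 * y * (a / 2)) by ring,
    Nat.mul_mod_right] at hs
  exact zero_ne_one hs

lemma IsTableau.check {t : ℕ × ℕ × ℕ × ℕ} (ht : IsTableau t) :
    channelCode t ∈ allCodes ∧
      (reduceCode t.1 = 0 ∨ reduceCode (mulTwo t.1 t.2.2.2) = 0) ∧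
      (reduceCode t.2.1 = 0 ∨ reduceCode (mulTwo t.2.1 t.2.2.2) = 0) ∧
      (reduceCode (codeY t.1 t.2.1) = 0 ∨ reduceCode (mulTwo (codeY t.1 t.2.1) t.2.2.2) = 0) := by
  have hz := ht.snd_mod_ne
  obtain ⟨x₁, z₁, x₂, z₂⟩ := t
  obtain ⟨⟨m1, m2, m3, m4⟩, s1, s2, s3, s4, s5, s6⟩ := ht
  have h := List.all_eq_true.mp (List.all_eq_true.mp channelCode_check _ m4) _ m1
  have hb : ∀ {a b : ℕ}, a = b → Nat.beq a b = true := fun h => Nat.beq_eq.mpr h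
  simp only [hb s4, Bool.not_true, Bool.false_or] at h
  have h := List.all_eq_true.mp h _ m2
  have hz' : Nat.beq (z₂ % 32) 0 = false := by
    rw [← Bool.not_eq_true, Nat.beq_eq]; exact hz
  simp only [hb s1, hb s6, hz', Bool.and_self, Bool.not_true, Bool.false_or, Bool.and_eq_true,
    List.any_eq_true, codeBeq_iff, oneIsZero, Bool.or_eq_true, Nat.beq_eq] at h
  obtain ⟨⟨⟨⟨c, hc, hc'⟩, h1⟩, h2⟩, h3⟩ := h
  exact ⟨by rw [← hc'] at hc; exact hc, h1, h2, h3⟩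

lemma induced_eq_codedMap {T : SuperOp (Fin 2 × Fin 2)} {t : ℕ × ℕ × ℕ × ℕ}
    (hT : T ∈ cliffordOps pauliGroupTwo) (ht : IsTableau t) (h : HasTableau T t) :
    induced 0 T = codedMap (channelCode t) := by
  obtain ⟨C, hC, rfl⟩ := hT
  have hU := hC.conjTranspose_mul
  obtain ⟨-, k1, k2, k3⟩ := ht.check
  obtain ⟨h1, h2, h3, h4⟩ := h
  have hY : conjBy C (pauliY ⊗ₖ 1) = pauliTwo (codeY t.1 t.2.1) := by
    have : pauliY ⊗ₖ (1 : Matrix (Fin 2) (Fin 2) ℂ)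
        = Complex.I • (pauliTwo 8 * pauliTwo 4) := by
      rw [pauliTwo_eight, pauliTwo_four, ← Matrix.mul_kronecker_mul, pauliY_eq,
        Matrix.smul_kronecker, mul_one, weyl, pow_one, pow_one]
    rw [this, map_smul, conjBy_mul hU, h1, h2, pauliTwo_mul, codeY, pauliTwo_mod,
      show 16 + mulTwo t.1 t.2.1 = mulTwo t.1 t.2.1 + 16 * 1 by ring, pauliTwo_add_sixteen, pow_one]
  have h0 : conjBy C (1 ⊗ₖ 1) = pauliTwo 0 := by
    rw [Matrix.one_kronecker_one, conjBy_one hU, pauliTwo_zero]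
  have e0 : mulTwo 0 t.2.2.2 = t.2.2.2 := by
    have := ht.lt.2.2.2
    refine pauliTwo_injOn (mulTwo_lt _ _) this ?_
    rw [← pauliTwo_mul, pauliTwo_zero, one_mul]
  rw [pauliTwo_eight] at h1
  rw [pauliTwo_four] at h2
  rw [eq_blochMap (induced 0 (conjBy C)), codedMap, induced_of_image hU h1 h4,
    induced_of_image hU hY h4, induced_of_image hU h2 h4, induced_of_image hU h0 h4,
    pauliOrZero_add k1, pauliOrZero_add k2, pauliOrZero_add k3, e0]
  rw [show pauliOrZero (reduceCode 0) = 1 from pauliOne_zero]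
  rfl

lemma isCode_of_mem_allCodes : ∀ c ∈ allCodes, IsCode c := by
  unfold IsCode
  decide +kernel

lemma allCodes_nodup : allCodes.Nodup := by decide +kernel

lemma exists_op_of_tableau {t : ℕ × ℕ × ℕ × ℕ} (ht : IsTableau t) :
    ∃ T ∈ cliffordOps pauliGroupTwo, HasTableau T t := by
  obtain ⟨C, hC, h⟩ := exists_clifford_of_tableau ht
  exact ⟨conjBy C, ⟨C, hC, rfl⟩, h⟩

/-- Tableaux and Clifford operations are in bijection, and the code of a channel is unique, so the
fibre over a channel is the list of tableaux with its code. -/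
lemma cliffordMultiplicity_codedMap {c : ℕ × ℕ × ℕ × ℕ} (hc : c ∈ allCodes) :
    cliffordMultiplicity (codedMap c) = (tableauxOfCode c).length := by
  rw [← List.toFinset_card_of_nodup (nodup_tableauxOfCode c), ← Set.ncard_coe_finset,
    cliffordMultiplicity]
  symm
  refine Set.ncard_congr
    (fun t ht => (exists_op_of_tableau (mem_tableauxOfCode.mp (List.mem_toFinset.mp ht)).1).choose)
    ?_ ?_ ?_
  · intro t ht
    obtain ⟨h1, h2⟩ := mem_tableauxOfCode.mp (List.mem_toFinset.mp ht)
    have hs := (exists_op_of_tableau h1).choose_spec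
    exact ⟨hs.1, by rw [induced_eq_codedMap hs.1 h1 hs.2, h2]⟩
  · intro t t' ht ht' h
    obtain ⟨h1, -⟩ := mem_tableauxOfCode.mp (List.mem_toFinset.mp ht)
    obtain ⟨h1', -⟩ := mem_tableauxOfCode.mp (List.mem_toFinset.mp ht')
    have hs := (exists_op_of_tableau h1).choose_spec
    have hs' := (exists_op_of_tableau h1').choose_spec
    change (exists_op_of_tableau h1).choose = (exists_op_of_tableau h1').choose at h
    rw [h] at hs
    exact hs.2.unique hs'.2 h1 h1'
  · rintro T ⟨hT, hTc⟩
    obtain ⟨t, ht, htT⟩ := exists_tableau hT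
    have hcode : channelCode t = c := by
      rw [induced_eq_codedMap hT ht htT] at hTc
      exact codedMap_injOn (isCode_of_mem_allCodes _ ht.check.1) (isCode_of_mem_allCodes _ hc) hTc
    have hmem : t ∈ ((tableauxOfCode c).toFinset : Set _) :=
      List.mem_toFinset.mpr (mem_tableauxOfCode.mpr ⟨ht, hcode⟩)
    have hs := (exists_op_of_tableau ht).choose_spec
    exact ⟨t, hmem, HasTableau.ext hs.1 hT hs.2 htT⟩

lemma length_tableauxOfCode {c : ℕ × ℕ × ℕ × ℕ} :
    (c ∈ unitaryCodes → (tableauxOfCode c).length = 96) ∧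
      (c ∈ contractionCodes ++ mixtureCodes → (tableauxOfCode c).length = 384) :=
  ⟨fun h => Nat.eq_of_beq_eq_true (List.all_eq_true.mp length_tableauxOfCode_unitary c h),
    fun h => Nat.eq_of_beq_eq_true (List.all_eq_true.mp length_tableauxOfCode_rankTwo c h)⟩

/-- The set of maps with codes in a list. -/
def codedMaps (l : List (ℕ × ℕ × ℕ × ℕ)) : Set (SuperOp (Fin 2)) := {Φ | ∃ c ∈ l, Φ = codedMap c}

lemma codedMaps_append (l l' : List (ℕ × ℕ × ℕ × ℕ)) :
    codedMaps (l ++ l') = codedMaps l ∪ codedMaps l' := by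
  ext Φ
  simp only [codedMaps, List.mem_append, Set.mem_union, Set.mem_ofPred_eq, or_and_right, exists_or]

lemma codedMaps_eq_image (l : List (ℕ × ℕ × ℕ × ℕ)) :
    codedMaps l = codedMap '' (l.toFinset : Set (ℕ × ℕ × ℕ × ℕ)) := by
  ext Φ
  simp only [codedMaps, Set.mem_ofPred_eq, Set.mem_image, List.coe_toFinset, eq_comm]

lemma ncard_codedMaps {l : List (ℕ × ℕ × ℕ × ℕ)} (hl : ∀ c ∈ l, IsCode c) (hn : l.Nodup) :
    (codedMaps l).ncard = l.length := by
  rw [codedMaps_eq_image, Set.InjOn.ncard_image, Set.ncard_coe_finset,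
    List.toFinset_card_of_nodup hn]
  intro c hc c' hc' h
  rw [List.coe_toFinset] at hc hc'
  exact codedMap_injOn (hl _ hc) (hl _ hc') h

lemma inducedChannels_eq : inducedChannels = codedMaps allCodes := by
  ext Φ
  constructor
  · rintro ⟨T, hT, rfl⟩
    obtain ⟨t, ht, htT⟩ := exists_tableau hT
    exact ⟨_, ht.check.1, induced_eq_codedMap hT ht htT⟩
  · rintro ⟨c, hc, rfl⟩
    have hpos : 0 < (tableauxOfCode c).length := by
      rcases List.mem_append.mp hc with h | h
      · rw [length_tableauxOfCode.1 h]; norm_num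
      · rw [length_tableauxOfCode.2 h]; norm_num
    obtain ⟨t, ht⟩ := List.exists_mem_of_length_pos hpos
    obtain ⟨h1, h2⟩ := mem_tableauxOfCode.mp ht
    obtain ⟨T, hT, hTt⟩ := exists_op_of_tableau h1
    exact ⟨T, hT, by rw [induced_eq_codedMap hT h1 hTt, h2]⟩

lemma finite_cliffordOps_two : (cliffordOps pauliGroupTwo).Finite := by
  have hsub : cliffordOps pauliGroupTwo ⊆
      ⋃ c ∈ allCodes.toFinset, {T ∈ cliffordOps pauliGroupTwo | induced 0 T = codedMap c} := by
    intro T hT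
    obtain ⟨t, ht, htT⟩ := exists_tableau hT
    simp only [Set.mem_iUnion]
    exact ⟨_, List.mem_toFinset.mpr ht.check.1, hT, induced_eq_codedMap hT ht htT⟩
  refine Set.Finite.subset (Set.Finite.biUnion (Finset.finite_toSet _) fun c hc => ?_) hsub
  -- `Set.ncard` is 0 on infinite sets, so the positive multiplicities already prove that each fibre
  -- is finite.
  refine Set.finite_of_ncard_ne_zero ?_
  have hc' := List.mem_toFinset.mp hc
  have : cliffordMultiplicity (codedMap c) ≠ 0 := by
    rw [cliffordMultiplicity_codedMap hc']
    rcases List.mem_append.mp hc' with h | h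
    · rw [length_tableauxOfCode.1 h]; norm_num
    · rw [length_tableauxOfCode.2 h]; norm_num
  exact this

/-! ## One-qubit Clifford operations -/

lemma codeYOne_add_one_pauli (x z : ℕ) :
    pauliOne (codeYOne x z) = Complex.I • (pauliOne x * pauliOne z) := by
  rw [codeYOne, pauliOne_mod, show 4 + mulOne x z = mulOne x z + 4 * 1 by ring,
    pauliOne_add_four, pow_one, pauliOne_mul]

lemma conjBy_eq_codedMap {C : Matrix (Fin 2) (Fin 2) ℂ} (hC : Cᴴ * C = 1) {x z : ℕ}
    (hx : conjBy C pauliX = pauliOne x) (hz : conjBy C pauliZ = pauliOne z) :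
    conjBy C = codedMap (0, x + 1, codeYOne x z + 1, z + 1) := by
  rw [eq_blochMap (conjBy C), conjBy_one hC, hx, hz, pauliY_eq, weyl, pow_one, pow_one, map_smul,
    conjBy_mul hC, hx, hz, ← codeYOne_add_one_pauli]
  simp [codedMap, pauliOrZero]

lemma mem_unitaryCodes {c : ℕ × ℕ × ℕ × ℕ} : c ∈ unitaryCodes ↔
    ∃ x ∈ hermOne, ∃ z ∈ hermOne, sympOne x z = 1 ∧ c = (0, x + 1, codeYOne x z + 1, z + 1) := by
  simp only [unitaryCodes, List.mem_flatMap, List.mem_map, List.mem_filter, Nat.beq_eq, and_assoc,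
    eq_comm (b := c)]

lemma cliffordOps_one_eq : cliffordOps pauliGroupOne = codedMaps unitaryCodes := by
  ext Φ
  constructor
  · rintro ⟨C, hC, rfl⟩
    obtain ⟨x, hx, z, hz, hs, h1, h2⟩ := exists_images_of_clifford_one hC
    exact ⟨_, mem_unitaryCodes.mpr ⟨x, hx, z, hz, hs, rfl⟩,
      conjBy_eq_codedMap hC.conjTranspose_mul h1 h2⟩
  · rintro ⟨c, hc, rfl⟩
    obtain ⟨x, hx, z, hz, hs, rfl⟩ := mem_unitaryCodes.mp hc
    obtain ⟨C, hC, h1, h2⟩ := exists_clifford_one hx hz hs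
    exact ⟨C, hC, (conjBy_eq_codedMap hC.conjTranspose_mul h1 h2).symm⟩

/-! ## Kraus ranks -/

lemma krausRank_eq_one {Φ : SuperOp (Fin 2)} {K : Matrix (Fin 2) (Fin 2) ℂ}
    (h : ∀ ρ, Φ ρ = K * ρ * Kᴴ) (h0 : Φ ≠ 0) : krausRank Φ = 1 := by
  refine le_antisymm (Nat.sInf_le ⟨fun _ => K, fun ρ => by simp [h ρ]⟩) ?_
  refine le_csInf ⟨1, fun _ => K, fun ρ => by simp [h ρ]⟩ ?_
  rintro r ⟨K', hK'⟩
  by_contra! hr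
  obtain rfl : r = 0 := by omega
  exact h0 (LinearMap.ext fun ρ => by rw [hK' ρ]; simp)

/-- With a single Kraus operator V, trace preservation forces V†V = 1, which makes Φ multiplicative.
Then Φ(1) = Φ(R)² = 0, which contradicts trace preservation. -/
lemma krausRank_eq_two {Φ : SuperOp (Fin 2)} {K : Fin 2 → Matrix (Fin 2) (Fin 2) ℂ}
    (hK : IsKrausForm K Φ) (htr : ∀ ρ, (Φ ρ).trace = ρ.trace) {R : Matrix (Fin 2) (Fin 2) ℂ}
    (hR : R * R = 1) (hΦR : Φ R = 0) : krausRank Φ = 2 := by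
  have h1 : Φ 1 ≠ 0 := fun h => by
    have := htr 1
    rw [h, Matrix.trace_zero, trace_one_two] at this
    exact two_ne_zero this.symm
  refine le_antisymm (Nat.sInf_le ⟨K, hK⟩) ?_
  refine le_csInf ⟨2, K, hK⟩ ?_
  rintro r ⟨K', hK'⟩
  by_contra! hr
  obtain rfl | rfl : r = 0 ∨ r = 1 := by omega
  · exact h1 (by rw [hK' 1]; simp)
  · have hform : ∀ ρ, Φ ρ = K' 0 * ρ * (K' 0)ᴴ := fun ρ => by rw [hK' ρ]; simp
    generalize K' 0 = V at hform
    have hV : Vᴴ * V = 1 := by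
      refine Matrix.ext_iff_trace_mul_right.mpr fun ρ => ?_
      rw [mul_assoc, Matrix.trace_mul_comm, ← hform, htr, one_mul]
    apply h1
    calc Φ 1 = V * (R * R) * Vᴴ := by rw [hform, hR]
      _ = V * R * (Vᴴ * V) * R * Vᴴ := by rw [hV, mul_one]; simp only [mul_assoc]
      _ = Φ R * Φ R := by rw [hform]; simp only [mul_assoc]
      _ = 0 := by rw [hΦR, zero_mul]

lemma isChannel_conjBy {ι : Type} [Fintype ι] [DecidableEq ι] {U : Matrix ι ι ℂ}
    (hU : Uᴴ * U = 1) : IsChannel (conjBy U) :=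
  ⟨1, fun _ => U, by simpa using hU, fun ρ => by simp [conjBy_apply]⟩

lemma unitary_facts {Φ : SuperOp (Fin 2)} (h : Φ ∈ codedMaps unitaryCodes) :
    IsChannel Φ ∧ krausRank Φ = 1 := by
  rw [← cliffordOps_one_eq] at h
  obtain ⟨C, hC, rfl⟩ := h
  refine ⟨isChannel_conjBy hC.conjTranspose_mul,
    krausRank_eq_one (conjBy_apply C) fun h0 => one_ne_zero (α := Matrix (Fin 2) (Fin 2) ℂ) ?_⟩
  rw [← conjBy_one hC.conjTranspose_mul, h0, LinearMap.zero_apply]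

/-! ## The maps `ρ ↦ (Tr(ρ) 1 + Tr(Q ρ) W) / 2` -/

/-- The map `ρ ↦ (Tr(ρ) 1 + Tr(Q ρ) W) / 2`. -/
def lineMap (Q W : Matrix (Fin 2) (Fin 2) ℂ) : SuperOp (Fin 2) where
  toFun ρ := (1 / 2 : ℂ) • (ρ.trace • (1 : Matrix (Fin 2) (Fin 2) ℂ) + (Q * ρ).trace • W)
  map_add' X Y := by
    simp only [Matrix.mul_add, Matrix.trace_add, add_smul, smul_add]
    abel
  map_smul' c X := by
    simp only [Matrix.mul_smul, Matrix.trace_smul, smul_eq_mul, RingHom.id_apply, ← smul_smul,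
      ← smul_add]
    rw [smul_comm]

lemma lineMap_apply (Q W ρ : Matrix (Fin 2) (Fin 2) ℂ) : lineMap Q W ρ =
    (1 / 2 : ℂ) • (ρ.trace • (1 : Matrix (Fin 2) (Fin 2) ℂ) + (Q * ρ).trace • W) := rfl

lemma codedMap_contraction (h : ℕ) : codedMap (h + 1, 0, 0, 0) = lineMap 1 (pauliOne h) := by
  ext1 ρ
  simp [codedMap, blochMap_apply, lineMap_apply, pauliOrZero]

lemma codedMap_mixture_X (h : ℕ) : codedMap (0, h + 1, 0, 0) = lineMap pauliX (pauliOne h) := by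
  ext1 ρ
  simp [codedMap, blochMap_apply, lineMap_apply, pauliOrZero]

lemma codedMap_mixture_Y (h : ℕ) : codedMap (0, 0, h + 1, 0) = lineMap pauliY (pauliOne h) := by
  ext1 ρ
  simp [codedMap, blochMap_apply, lineMap_apply, pauliOrZero]

lemma codedMap_mixture_Z (h : ℕ) : codedMap (0, 0, 0, h + 1) = lineMap pauliZ (pauliOne h) := by
  ext1 ρ
  simp [codedMap, blochMap_apply, lineMap_apply, pauliOrZero]

/-- The Pauli matrices. -/
def paulis : Set (Matrix (Fin 2) (Fin 2) ℂ) := {pauliX, pauliY, pauliZ}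

lemma pauliOne_add_eight (n : ℕ) : pauliOne (n + 8) = (-1 : ℂ) • pauliOne n := by
  rw [show n + 8 = n + 4 * 2 by ring, pauliOne_add_four, Complex.I_sq]

lemma exists_hermOne_iff {W : Matrix (Fin 2) (Fin 2) ℂ} :
    (∃ h ∈ hermOne, W = pauliOne h) ↔ ∃ σ ∈ paulis, ∃ s ∈ ({1, -1} : Set ℂ), W = s • σ := by
  constructor
  · rintro ⟨h, hh, rfl⟩
    simp only [hermOne, List.mem_cons, List.not_mem_nil, or_false] at hh
    rcases hh with rfl | rfl | rfl | rfl | rfl | rfl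
    · exact ⟨pauliZ, by simp [paulis], 1, by simp, by rw [pauliOne_one, one_smul]⟩
    · exact ⟨pauliX, by simp [paulis], 1, by simp, by rw [pauliOne_two, one_smul]⟩
    · exact ⟨pauliY, by simp [paulis], 1, by simp, by rw [pauliOne_seven, one_smul]⟩
    · exact ⟨pauliZ, by simp [paulis], -1, by simp, by rw [pauliOne_add_eight 1, pauliOne_one]⟩
    · exact ⟨pauliX, by simp [paulis], -1, by simp, by rw [pauliOne_add_eight 2, pauliOne_two]⟩
    · exact ⟨pauliY, by simp [paulis], -1, by simp, by rw [pauliOne_add_eight 7, pauliOne_seven]⟩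
  · rintro ⟨σ, hσ, s, hs, rfl⟩
    rcases hs with rfl | rfl
    · rcases hσ with rfl | rfl | rfl
      · exact ⟨2, by simp [hermOne], by rw [pauliOne_two, one_smul]⟩
      · exact ⟨7, by simp [hermOne], by rw [pauliOne_seven, one_smul]⟩
      · exact ⟨1, by simp [hermOne], by rw [pauliOne_one, one_smul]⟩
    · rcases hσ with rfl | rfl | rfl
      · exact ⟨10, by simp [hermOne], by rw [pauliOne_add_eight 2, pauliOne_two]⟩
      · exact ⟨15, by simp [hermOne], by rw [pauliOne_add_eight 7, pauliOne_seven]⟩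
      · exact ⟨9, by simp [hermOne], by rw [pauliOne_add_eight 1, pauliOne_one]⟩

lemma codedMaps_contractionCodes : codedMaps contractionCodes =
    {Φ | ∃ σ ∈ paulis, ∃ s ∈ ({1, -1} : Set ℂ), Φ = lineMap 1 (s • σ)} := by
  ext Φ
  simp only [codedMaps, contractionCodes, List.mem_map, Set.mem_ofPred_eq]
  constructor
  · rintro ⟨_, ⟨h, hh, rfl⟩, rfl⟩
    obtain ⟨σ, hσ, s, hs, e⟩ := exists_hermOne_iff.mp ⟨h, hh, rfl⟩
    exact ⟨σ, hσ, s, hs, by rw [codedMap_contraction, e]⟩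
  · rintro ⟨σ, hσ, s, hs, rfl⟩
    obtain ⟨h, hh, e⟩ := exists_hermOne_iff.mpr ⟨σ, hσ, s, hs, rfl⟩
    exact ⟨_, ⟨h, hh, rfl⟩, by rw [codedMap_contraction, e]⟩

lemma codedMaps_mixtureCodes : codedMaps mixtureCodes =
    {Φ | ∃ Q ∈ paulis, ∃ σ ∈ paulis, ∃ s ∈ ({1, -1} : Set ℂ), Φ = lineMap Q (s • σ)} := by
  ext Φ
  simp only [codedMaps, mixtureCodes, List.mem_flatMap, Set.mem_ofPred_eq]
  constructor
  · rintro ⟨c, ⟨h, hh, hc⟩, rfl⟩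
    obtain ⟨σ, hσ, s, hs, e⟩ := exists_hermOne_iff.mp ⟨h, hh, rfl⟩
    simp only [List.mem_cons, List.not_mem_nil, or_false] at hc
    rcases hc with rfl | rfl | rfl
    · exact ⟨pauliX, by simp [paulis], σ, hσ, s, hs, by rw [codedMap_mixture_X, e]⟩
    · exact ⟨pauliY, by simp [paulis], σ, hσ, s, hs, by rw [codedMap_mixture_Y, e]⟩
    · exact ⟨pauliZ, by simp [paulis], σ, hσ, s, hs, by rw [codedMap_mixture_Z, e]⟩
  · rintro ⟨Q, hQ, σ, hσ, s, hs, rfl⟩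
    obtain ⟨h, hh, e⟩ := exists_hermOne_iff.mpr ⟨σ, hσ, s, hs, rfl⟩
    rw [e]
    rcases hQ with rfl | rfl | rfl
    · exact ⟨_, ⟨h, hh, by simp⟩, (codedMap_mixture_X h).symm⟩
    · exact ⟨(0, 0, h + 1, 0), ⟨h, hh, by simp⟩, (codedMap_mixture_Y h).symm⟩
    · exact ⟨(0, 0, 0, h + 1), ⟨h, hh, by simp⟩, (codedMap_mixture_Z h).symm⟩

lemma trace_of_mem_paulis {σ : Matrix (Fin 2) (Fin 2) ℂ} (h : σ ∈ paulis) : σ.trace = 0 := by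
  rcases h with rfl | rfl | rfl
  exacts [trace_pauliX, trace_pauliY, trace_pauliZ]

lemma trace_lineMap {Q W : Matrix (Fin 2) (Fin 2) ℂ} (hW : W.trace = 0)
    (ρ : Matrix (Fin 2) (Fin 2) ℂ) : (lineMap Q W ρ).trace = ρ.trace := by
  rw [lineMap_apply, Matrix.trace_smul, Matrix.trace_add, Matrix.trace_smul, Matrix.trace_smul, hW,
    trace_one_two]
  simp only [smul_eq_mul, mul_zero, add_zero]
  ring

lemma vertexContractions_eq : vertexContractions = codedMaps contractionCodes := by
  rw [codedMaps_contractionCodes]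
  ext Φ
  have key : ∀ (W ρ : Matrix (Fin 2) (Fin 2) ℂ),
      lineMap 1 W ρ = ρ.trace • ((1 / 2 : ℂ) • (1 + W)) := fun W ρ => by
    rw [lineMap_apply, one_mul, ← smul_add, smul_comm]
  constructor
  · rintro ⟨v, ⟨σ, hσ, s, hs, rfl⟩, h⟩
    exact ⟨σ, hσ, s, hs, LinearMap.ext fun ρ => by rw [h, key]⟩
  · rintro ⟨σ, hσ, s, hs, rfl⟩
    exact ⟨_, ⟨σ, hσ, s, hs, rfl⟩, key _⟩

/-! ## Mixtures of two unitary channels -/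

/-- The code of `-P`. -/
def negCode (a : ℕ) : ℕ := (a + 7) % 16 + 1

/-- In one entry, the code `c` is the mean of the codes `u` and `v`. -/
def isMean (c u v : ℕ) : Bool :=
  bif Nat.beq c 0 then Nat.beq v (negCode u) else Nat.beq u c && Nat.beq v c

/-- Two Clifford rotations that differ by a half turn about the image of the kept axis agree there
and cancel on the other two axes. -/
lemma mixtureCodes_mean : (mixtureCodes.all fun c => unitaryCodes.any fun u =>
    unitaryCodes.any fun v => !(codeBeq u v) && isMean c.2.1 u.2.1 v.2.1 &&
      isMean c.2.2.1 u.2.2.1 v.2.2.1 && isMean c.2.2.2 u.2.2.2 v.2.2.2) = true := by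
  decide +kernel

lemma pauliOrZero_mean {c u v : ℕ} (h : isMean c (u + 1) v = true) :
    pauliOrZero c = (1 / 2 : ℂ) • (pauliOrZero (u + 1) + pauliOrZero v) := by
  unfold isMean at h
  rcases Nat.eq_zero_or_pos c with rfl | hc
  · simp only [Nat.beq_refl, cond_true, Nat.beq_eq] at h
    rw [h, negCode, pauliOrZero, pauliOrZero, pauliOrZero, pauliOne_mod, add_assoc,
      show 1 + 7 = 8 from rfl, pauliOne_add_eight]
    simp
  · have : Nat.beq c 0 = false := by rw [← Bool.not_eq_true, Nat.beq_eq]; omega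
    simp only [this, cond_false, Bool.and_eq_true, Nat.beq_eq] at h
    rw [h.1, h.2, ← two_smul ℂ, smul_smul]
    norm_num

lemma exists_mixture {Φ : SuperOp (Fin 2)} (h : Φ ∈ codedMaps mixtureCodes) :
    ∃ Ψ₁ ∈ cliffordOps pauliGroupOne, ∃ Ψ₂ ∈ cliffordOps pauliGroupOne,
      Ψ₁ ≠ Ψ₂ ∧ Φ = (1 / 2 : ℂ) • (Ψ₁ + Ψ₂) := by
  obtain ⟨c, hc, rfl⟩ := h
  have := List.all_eq_true.mp mixtureCodes_mean c hc
  simp only [List.any_eq_true, Bool.and_eq_true, Bool.not_eq_true', ← Bool.not_eq_true,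
    codeBeq_iff] at this
  obtain ⟨u, hu, v, hv, ⟨⟨huv, hX⟩, hY⟩, hZ⟩ := this
  rw [cliffordOps_one_eq]
  refine ⟨codedMap u, ⟨u, hu, rfl⟩, codedMap v, ⟨v, hv, rfl⟩, fun h => huv ?_, ?_⟩
  · exact codedMap_injOn (isCode_of_mem_allCodes _ (List.mem_append_left _ hu))
      (isCode_of_mem_allCodes _ (List.mem_append_left _ hv)) h
  · have hc0 : c.1 = 0 := by
      simp only [mixtureCodes, List.mem_flatMap, List.mem_cons, List.not_mem_nil, or_false] at hc
      obtain ⟨h, -, rfl | rfl | rfl⟩ := hc <;> rfl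
    obtain ⟨x, -, z, -, -, rfl⟩ := mem_unitaryCodes.mp hu
    obtain ⟨x', -, z', -, -, rfl⟩ := mem_unitaryCodes.mp hv
    have eX := pauliOrZero_mean hX
    have eY := pauliOrZero_mean hY
    have eZ := pauliOrZero_mean hZ
    refine superOp_ext ?_ ?_ ?_ ?_ <;>
      simp only [codedMap, LinearMap.smul_apply, LinearMap.add_apply, blochMap_one,
        blochMap_pauliX, blochMap_pauliY, blochMap_pauliZ]
    · rw [hc0, show pauliOrZero 0 = 0 from rfl, add_zero, ← two_smul ℂ, smul_smul]
      norm_num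
    · exact eX
    · exact eY
    · exact eZ

lemma inv_sqrt_two_mul_self :
    ((Real.sqrt 2 : ℝ) : ℂ)⁻¹ * ((Real.sqrt 2 : ℝ) : ℂ)⁻¹ = 1 / 2 := by
  rw [← mul_inv, ← Complex.ofReal_mul, Real.mul_self_sqrt (by norm_num)]
  norm_num

lemma star_inv_sqrt_two : star ((Real.sqrt 2 : ℝ) : ℂ)⁻¹ = ((Real.sqrt 2 : ℝ) : ℂ)⁻¹ := by
  rw [star_inv₀]
  congr 1
  exact Complex.conj_ofReal _

lemma mixture_facts {Φ : SuperOp (Fin 2)} (h : Φ ∈ codedMaps mixtureCodes) :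
    IsChannel Φ ∧ krausRank Φ = 2 ∧ IsMixedUnitary Φ := by
  obtain ⟨_, ⟨C₁, hC₁, rfl⟩, _, ⟨C₂, hC₂, rfl⟩, -, hΦ⟩ := exists_mixture h
  have hU₁ := hC₁.conjTranspose_mul
  have hU₂ := hC₂.conjTranspose_mul
  have hK : IsKrausForm ![((Real.sqrt 2 : ℝ) : ℂ)⁻¹ • C₁, ((Real.sqrt 2 : ℝ) : ℂ)⁻¹ • C₂] Φ := by
    intro ρ
    rw [hΦ, Fin.sum_univ_two]
    simp only [Matrix.cons_val_zero, Matrix.cons_val_one, Matrix.smul_mul, Matrix.mul_smul,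
      Matrix.conjTranspose_smul, star_inv_sqrt_two, smul_smul, inv_sqrt_two_mul_self]
    rw [← smul_add]
    rfl
  refine ⟨⟨2, _, ?_, hK⟩, ?_, 2, fun _ => 1 / 2, ![C₁, C₂], fun _ => by norm_num, by simp, ?_, ?_⟩
  · rw [Fin.sum_univ_two]
    simp only [Matrix.cons_val_zero, Matrix.cons_val_one, Matrix.smul_mul, Matrix.mul_smul,
      Matrix.conjTranspose_smul, star_inv_sqrt_two, smul_smul, inv_sqrt_two_mul_self, hU₁, hU₂]
    rw [← add_smul]
    norm_num
  · have h' := h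
    rw [codedMaps_mixtureCodes] at h'
    obtain ⟨Q, hQ, σ, hσ, s, hs, e⟩ := h'
    have htr : ∀ ρ, (Φ ρ).trace = ρ.trace := by
      rw [e]
      exact trace_lineMap (by rw [Matrix.trace_smul, trace_of_mem_paulis hσ, smul_zero])
    -- The involution that is killed can be any Pauli matrix other than Q.
    rcases hQ with rfl | rfl | rfl
    · exact krausRank_eq_two hK htr pauliZ_mul_self (by
        rw [e, lineMap_apply, trace_pauliX_mul_pauliZ, trace_pauliZ]; simp)
    · exact krausRank_eq_two hK htr pauliZ_mul_self (by
        rw [e, lineMap_apply, trace_pauliY_mul_pauliZ, trace_pauliZ]; simp)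
    · exact krausRank_eq_two hK htr pauliX_mul_self (by
        rw [e, lineMap_apply, trace_pauliZ_mul_pauliX, trace_pauliX]; simp)
  · intro i
    fin_cases i
    exacts [Matrix.mem_unitaryGroup_iff'.mpr hU₁, Matrix.mem_unitaryGroup_iff'.mpr hU₂]
  · rw [hΦ, Fin.sum_univ_two, smul_add]
    simp

/-! ## Contractions -/

lemma hermOne_partner : (hermOne.all fun z => hermOne.any fun x => Nat.beq (sympOne x z) 1) = true := by
  decide +kernel

/-- The Kraus operators are C|0⟩⟨i| for a Clifford unitary C that carries |0⟩⟨0| to the vertex. The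
map kills σ_x, and it sends 1 to 1 plus a nonzero Pauli operator, whereas mixed unitary channels fix
1. -/
lemma contraction_facts {Φ : SuperOp (Fin 2)} (h : Φ ∈ codedMaps contractionCodes) :
    IsChannel Φ ∧ krausRank Φ = 2 ∧ ¬ IsMixedUnitary Φ := by
  obtain ⟨c, hc, rfl⟩ := h
  obtain ⟨z, hz, rfl⟩ := List.mem_map.mp hc
  have := List.all_eq_true.mp hermOne_partner z hz
  simp only [List.any_eq_true, Nat.beq_eq] at this
  obtain ⟨x, hx, hs⟩ := this
  obtain ⟨C, hC, -, hCz⟩ := exists_clifford_one hx hz hs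
  have hU := hC.conjTranspose_mul
  rw [codedMap_contraction]
  have htr0 : (pauliOne z).trace = 0 := by
    rw [← hCz, conjBy_apply, Matrix.trace_mul_comm, ← mul_assoc, hU, one_mul, trace_pauliZ]
  have hv : C * Matrix.single 0 0 1 * Cᴴ = (1 / 2 : ℂ) • (1 + pauliOne z) := by
    rw [single_zero_zero_eq, ← conjBy_apply, map_smul, map_add, conjBy_one hU, hCz]
  have hK : IsKrausForm (fun i : Fin 2 => C * Matrix.single 0 i 1) (lineMap 1 (pauliOne z)) := by
    intro ρ
    have : ∀ i : Fin 2, C * Matrix.single 0 i 1 * ρ * (C * Matrix.single 0 i 1)ᴴ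
        = ρ i i • (C * Matrix.single 0 0 1 * Cᴴ) := by
      intro i
      have h1 : Matrix.single 0 i 1 * ρ * Matrix.single i 0 1
          = ρ i i • Matrix.single (0 : Fin 2) (0 : Fin 2) (1 : ℂ) := by
        rw [Matrix.single_mul_mul_single]
        simp [Matrix.smul_single]
      rw [Matrix.conjTranspose_mul, Matrix.conjTranspose_single, star_one,
        show C * Matrix.single 0 i 1 * ρ * (Matrix.single i 0 1 * Cᴴ)
          = C * (Matrix.single 0 i 1 * ρ * Matrix.single i 0 1) * Cᴴ by simp only [mul_assoc], h1,
        Matrix.mul_smul, Matrix.smul_mul]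
    rw [Finset.sum_congr rfl fun i _ => this i, ← Finset.sum_smul, hv, lineMap_apply, one_mul,
      ← smul_add, smul_comm]
    rfl
  refine ⟨⟨2, _, ?_, hK⟩, ?_, ?_⟩
  · have : ∀ i : Fin 2, (C * Matrix.single 0 i 1)ᴴ * (C * Matrix.single 0 i 1)
        = Matrix.single i i 1 := by
      intro i
      rw [Matrix.conjTranspose_mul, Matrix.conjTranspose_single, star_one, mul_assoc,
        ← mul_assoc Cᴴ, hU, one_mul, Matrix.single_mul_single_same, mul_one]
    rw [Finset.sum_congr rfl fun i _ => this i]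
    ext i j
    fin_cases i <;> fin_cases j <;> simp [Matrix.single]
  · refine krausRank_eq_two hK (trace_lineMap htr0) pauliX_mul_self ?_
    rw [lineMap_apply, one_mul, trace_pauliX]
    simp
  · rintro ⟨r, p, U, -, hp, hUn, e⟩
    have h1 := LinearMap.congr_fun e 1
    rw [lineMap_apply, one_mul, trace_one_two, LinearMap.sum_apply] at h1
    have : ∀ i, ((p i : ℂ) • conjBy (U i)) 1 = (p i : ℂ) • (1 : Matrix (Fin 2) (Fin 2) ℂ) := by
      intro i
      rw [LinearMap.smul_apply, conjBy_one (Matrix.mem_unitaryGroup_iff'.mp (hUn i))]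
    rw [Finset.sum_congr rfl fun i _ => this i, ← Finset.sum_smul, ← Complex.ofReal_sum, hp,
      ← smul_add, smul_smul] at h1
    norm_num at h1
    exact pauliOne_ne_zero z h1

/-! ## Choi–Jamiołkowski states -/

lemma choiState_injective : Function.Injective (choiState (ι := Fin 2)) := by
  intro Φ Ψ h
  refine Matrix.ext_linearMap ℂ fun a b => ?_
  refine LinearMap.ext_ring ?_
  ext i j
  have := congrFun (congrFun h (i, a)) (j, b)
  simpa [choiState] using this

/-- The transpose comes from Tr(Q|a⟩⟨b|) being the entry of Q at (b, a). -/
lemma choiState_lineMap (Q W : Matrix (Fin 2) (Fin 2) ℂ) :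
    choiState (lineMap Q W) = (1 / 4 : ℂ) • (1 + W ⊗ₖ Qᵀ) := by
  ext ⟨i, a⟩ ⟨j, b⟩
  have h1 : (Matrix.single a b (1 : ℂ)).trace = (1 : Matrix (Fin 2) (Fin 2) ℂ) a b := by
    rw [Matrix.one_apply]
    split_ifs with h
    · rw [h, Matrix.trace_single_eq_same]
    · rw [Matrix.trace_single_eq_of_ne _ _ _ h]
  have h2 : (Q * Matrix.single a b (1 : ℂ)).trace = Q b a := by
    rw [Matrix.trace_mul_single]
    simp
  simp only [choiState, Matrix.of_apply, lineMap_apply, h1, h2, Fintype.card_fin,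
    Matrix.smul_apply, Matrix.add_apply, Matrix.kroneckerMap_apply, Matrix.transpose_apply,
    smul_eq_mul, ← Matrix.one_kronecker_one]
  norm_num
  ring

/-- The operator whose columns are the support kets. -/
def supportOp (A B : Matrix (Fin 2) (Fin 2) ℂ) (j k : Fin 2) :
    Matrix (Fin 2 × Fin 2) (Fin 2 × Fin 2) ℂ :=
  (A ⊗ₖ B) * cnotTwoOne ^ (k : ℕ) * ((pauliX ^ (j : ℕ)) ⊗ₖ 1)

/-- The weights of the support kets. -/
def supportWeight (p : Fin 2 × Fin 2) : ℂ := if p.1 = 0 then 1 / 2 else 0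

/-- The two kets are the columns (0, 0) and (0, 1) of one operator, so the state is that operator
applied to diag(1/2, 1/2, 0, 0); once the operator is unitary, the spectrum is visible. -/
lemma sum_supportKet (A B : Matrix (Fin 2) (Fin 2) ℂ) (j k : Fin 2) :
    (1 / 2 : ℂ) • ∑ i, Matrix.vecMulVec (supportKet A B j k i) (star (supportKet A B j k i)) =
      supportOp A B j k * Matrix.diagonal supportWeight * (supportOp A B j k)ᴴ := by
  have h1 : ∀ i, Matrix.vecMulVec (supportKet A B j k i) (star (supportKet A B j k i))
      = supportOp A B j k * Matrix.single (0, i) (0, i) 1 * (supportOp A B j k)ᴴ := by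
    intro i
    have hs : star (Pi.single (0, i) 1 : Fin 2 × Fin 2 → ℂ) = Pi.single (0, i) 1 := by
      rw [← Pi.single_star, star_one]
    rw [supportKet, ← supportOp, Matrix.star_mulVec, hs, ← Matrix.mul_vecMulVec,
      ← Matrix.vecMulVec_mul, ← Matrix.single_eq_single_vecMulVec_single, mul_assoc]
  rw [Finset.sum_congr rfl fun i _ => h1 i, ← Finset.sum_mul, ← Finset.mul_sum, ← Matrix.smul_mul,
    ← Matrix.mul_smul]
  congr 2
  ext ⟨a, b⟩ ⟨c, d⟩
  fin_cases a <;> fin_cases b <;> fin_cases c <;> fin_cases d <;>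
    simp [supportWeight, Matrix.single]

lemma hadamard_conjTranspose : hadamardᴴ = hadamard := by
  rw [hadamard, Matrix.conjTranspose_smul, star_inv_sqrt_two]
  congr 1
  ext i j
  fin_cases i <;> fin_cases j <;> simp

lemma hadamard_mul_mul_hadamard (M : Matrix (Fin 2) (Fin 2) ℂ) :
    hadamard * M * hadamardᴴ = (1 / 2 : ℂ) • (!![1, 1; 1, -1] * M * !![1, 1; 1, -1]) := by
  rw [hadamard_conjTranspose, hadamard, Matrix.smul_mul, Matrix.smul_mul, Matrix.mul_smul,
    smul_smul, inv_sqrt_two_mul_self]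

lemma hadamard_unitary : hadamard * hadamardᴴ = 1 := by
  have := hadamard_mul_mul_hadamard 1
  rw [mul_one, mul_one] at this
  rw [this]
  ext i j
  fin_cases i <;> fin_cases j <;> simp <;> norm_num

lemma hadamard_conj_pauliZ : hadamard * pauliZ * hadamardᴴ = pauliX := by
  rw [hadamard_mul_mul_hadamard]
  ext i j
  fin_cases i <;> fin_cases j <;> simp [pauliZ, pauliX] <;> norm_num

lemma phaseGate_conjTranspose : phaseGateᴴ = !![1, 0; 0, -Complex.I] := by
  ext i j
  fin_cases i <;> fin_cases j <;> simp [phaseGate]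

lemma phaseGate_unitary : phaseGate * phaseGateᴴ = 1 := by
  rw [phaseGate_conjTranspose]
  ext i j
  fin_cases i <;> fin_cases j <;> simp [phaseGate]

lemma phaseGate_conj_pauliX : phaseGate * pauliX * phaseGateᴴ = pauliY := by
  rw [phaseGate_conjTranspose]
  ext i j
  fin_cases i <;> fin_cases j <;> simp [phaseGate, pauliX, pauliY]

/-- The local unitaries `1`, `H`, `SH`. -/
def localGates : Set (Matrix (Fin 2) (Fin 2) ℂ) := {1, hadamard, phaseGate * hadamard}

lemma localGates_unitary {A : Matrix (Fin 2) (Fin 2) ℂ} (hA : A ∈ localGates) : A * Aᴴ = 1 := by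
  rcases hA with rfl | rfl | rfl
  · simp
  · exact hadamard_unitary
  · rw [Matrix.conjTranspose_mul, mul_assoc, ← mul_assoc hadamard, hadamard_unitary, one_mul,
      phaseGate_unitary]

lemma localGates_conj_mem {A : Matrix (Fin 2) (Fin 2) ℂ} (hA : A ∈ localGates) :
    A * pauliZ * Aᴴ ∈ paulis := by
  rcases hA with rfl | rfl | rfl
  · simp [paulis]
  · rw [hadamard_conj_pauliZ]; simp [paulis]
  · rw [Matrix.conjTranspose_mul, show phaseGate * hadamard * pauliZ * (hadamardᴴ * phaseGateᴴ)
      = phaseGate * (hadamard * pauliZ * hadamardᴴ) * phaseGateᴴ by simp only [mul_assoc],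
      hadamard_conj_pauliZ, phaseGate_conj_pauliX]
    simp [paulis]

lemma exists_localGate {σ : Matrix (Fin 2) (Fin 2) ℂ} (hσ : σ ∈ paulis) :
    ∃ A ∈ localGates, A * pauliZ * Aᴴ = σ := by
  rcases hσ with rfl | rfl | rfl
  · exact ⟨hadamard, by simp [localGates], hadamard_conj_pauliZ⟩
  · refine ⟨phaseGate * hadamard, by simp [localGates], ?_⟩
    rw [Matrix.conjTranspose_mul, show phaseGate * hadamard * pauliZ * (hadamardᴴ * phaseGateᴴ)
      = phaseGate * (hadamard * pauliZ * hadamardᴴ) * phaseGateᴴ by simp only [mul_assoc],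
      hadamard_conj_pauliZ, phaseGate_conj_pauliX]
  · exact ⟨1, by simp [localGates], by simp⟩

lemma cnotTwoOne_unitary : cnotTwoOne * cnotTwoOneᴴ = 1 := by
  ext ⟨a, b⟩ ⟨c, d⟩
  fin_cases a <;> fin_cases b <;> fin_cases c <;> fin_cases d <;>
    simp [cnotTwoOne, Matrix.mul_apply, Fintype.sum_prod_type]

lemma cnotTwoOne_conj : cnotTwoOne * (pauliZ ⊗ₖ 1) * cnotTwoOneᴴ = pauliZ ⊗ₖ pauliZ := by
  ext ⟨a, b⟩ ⟨c, d⟩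
  fin_cases a <;> fin_cases b <;> fin_cases c <;> fin_cases d <;>
    simp [cnotTwoOne, Matrix.mul_apply, Fintype.sum_prod_type, pauliZ, Matrix.one_apply]

lemma cnotTwoOne_pow_conj (k : Fin 2) : cnotTwoOne ^ (k : ℕ) * (pauliZ ⊗ₖ 1) *
    (cnotTwoOne ^ (k : ℕ))ᴴ = pauliZ ⊗ₖ (pauliZ ^ (k : ℕ)) := by
  fin_cases k
  · simp
  · simpa using cnotTwoOne_conj

lemma pauliX_pow_conj (j : Fin 2) : pauliX ^ (j : ℕ) * pauliZ * (pauliX ^ (j : ℕ))ᴴ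
    = (-1 : ℂ) ^ (j : ℕ) • pauliZ := by
  rw [Matrix.conjTranspose_pow, pauliX_conjTranspose]
  fin_cases j
  · simp
  · ext i j
    fin_cases i <;> fin_cases j <;> simp [pauliX, pauliZ]

lemma supportOp_unitary {A B : Matrix (Fin 2) (Fin 2) ℂ} (hA : A * Aᴴ = 1) (hB : B * Bᴴ = 1)
    (j k : Fin 2) : supportOp A B j k * (supportOp A B j k)ᴴ = 1 := by
  have hX : (pauliX ^ (j : ℕ)) * (pauliX ^ (j : ℕ))ᴴ = 1 := by
    rw [Matrix.conjTranspose_pow, pauliX_conjTranspose, ← pow_add, ← two_mul, pow_mul, pauliX_sq,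
      one_pow]
  have hC : cnotTwoOne ^ (k : ℕ) * (cnotTwoOne ^ (k : ℕ))ᴴ = 1 := by
    fin_cases k
    · simp
    · simpa using cnotTwoOne_unitary
  have hX' : ((pauliX ^ (j : ℕ)) ⊗ₖ (1 : Matrix (Fin 2) (Fin 2) ℂ)) *
      ((pauliX ^ (j : ℕ)) ⊗ₖ (1 : Matrix (Fin 2) (Fin 2) ℂ))ᴴ = 1 := by
    rw [Matrix.conjTranspose_kronecker, ← Matrix.mul_kronecker_mul, hX, Matrix.conjTranspose_one,
      mul_one, Matrix.one_kronecker_one]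
  have hAB : (A ⊗ₖ B) * (A ⊗ₖ B)ᴴ = 1 := by
    rw [Matrix.conjTranspose_kronecker, ← Matrix.mul_kronecker_mul, hA, hB,
      Matrix.one_kronecker_one]
  rw [supportOp, Matrix.conjTranspose_mul, Matrix.conjTranspose_mul]
  generalize (pauliX ^ (j : ℕ)) ⊗ₖ (1 : Matrix (Fin 2) (Fin 2) ℂ) = X at *
  generalize cnotTwoOne ^ (k : ℕ) = C at *
  generalize A ⊗ₖ B = V at *
  calc V * C * X * (Xᴴ * (Cᴴ * Vᴴ)) = V * (C * (X * Xᴴ) * Cᴴ) * Vᴴ := by simp only [mul_assoc]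
    _ = 1 := by rw [hX', mul_one, hC, mul_one, hAB]

lemma diagonal_supportWeight : Matrix.diagonal supportWeight
    = (1 / 4 : ℂ) • ((1 : Matrix (Fin 2 × Fin 2) (Fin 2 × Fin 2) ℂ) + pauliZ ⊗ₖ 1) := by
  ext ⟨a, b⟩ ⟨c, d⟩
  fin_cases a <;> fin_cases b <;> fin_cases c <;> fin_cases d <;>
    norm_num [supportWeight, Matrix.diagonal_apply, pauliZ, Matrix.one_apply]

/-- The weights are (1 + σ_z⊗1)/4. Conjugation by σ_x^j gives the sign, CNOT turns σ_z⊗1 into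
σ_z⊗σ_z, and the local gates turn the axes. Thus k decides whether Q is 1 or a Pauli matrix. -/
lemma support_state {A B : Matrix (Fin 2) (Fin 2) ℂ} (hA : A * Aᴴ = 1) (hB : B * Bᴴ = 1)
    (j k : Fin 2) :
    supportOp A B j k * Matrix.diagonal supportWeight * (supportOp A B j k)ᴴ =
      (1 / 4 : ℂ) • (1 + ((-1 : ℂ) ^ (j : ℕ) • (A * pauliZ * Aᴴ)) ⊗ₖ
        (B * pauliZ ^ (k : ℕ) * Bᴴ)) := by
  have h : supportOp A B j k * (pauliZ ⊗ₖ 1) * (supportOp A B j k)ᴴ =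
      ((-1 : ℂ) ^ (j : ℕ) • (A * pauliZ * Aᴴ)) ⊗ₖ (B * pauliZ ^ (k : ℕ) * Bᴴ) := by
    calc supportOp A B j k * (pauliZ ⊗ₖ 1) * (supportOp A B j k)ᴴ
        = (A ⊗ₖ B) * (cnotTwoOne ^ (k : ℕ) * (((pauliX ^ (j : ℕ)) ⊗ₖ 1) * (pauliZ ⊗ₖ 1) *
          ((pauliX ^ (j : ℕ)) ⊗ₖ 1)ᴴ) * (cnotTwoOne ^ (k : ℕ))ᴴ) * (A ⊗ₖ B)ᴴ := by
          rw [supportOp, Matrix.conjTranspose_mul, Matrix.conjTranspose_mul]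
          simp only [mul_assoc]
      _ = _ := by
          rw [Matrix.conjTranspose_kronecker, ← Matrix.mul_kronecker_mul,
            ← Matrix.mul_kronecker_mul, Matrix.conjTranspose_one, mul_one, mul_one,
            pauliX_pow_conj, Matrix.smul_kronecker, Matrix.mul_smul, Matrix.smul_mul,
            cnotTwoOne_pow_conj, Matrix.mul_smul, Matrix.smul_mul, Matrix.conjTranspose_kronecker,
            ← Matrix.mul_kronecker_mul, ← Matrix.mul_kronecker_mul, Matrix.smul_kronecker]
  rw [diagonal_supportWeight, Matrix.mul_smul, Matrix.smul_mul, mul_add, add_mul, mul_one,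
    supportOp_unitary hA hB, h]

lemma rankTwoFamily_eq (k : Fin 2) : rankTwoFamily k = {Φ | ∃ A ∈ localGates, ∃ B ∈ localGates,
    ∃ j : Fin 2, Φ = lineMap (B * pauliZ ^ (k : ℕ) * Bᴴ)ᵀ
      ((-1 : ℂ) ^ (j : ℕ) • (A * pauliZ * Aᴴ))} := by
  have key : ∀ {Φ : SuperOp (Fin 2)} {A B : Matrix (Fin 2) (Fin 2) ℂ} {j : Fin 2},
      A ∈ localGates → B ∈ localGates → (choiState Φ = (1 / 2 : ℂ) • ∑ i, Matrix.vecMulVec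
        (supportKet A B j k i) (star (supportKet A B j k i)) ↔
      Φ = lineMap (B * pauliZ ^ (k : ℕ) * Bᴴ)ᵀ ((-1 : ℂ) ^ (j : ℕ) • (A * pauliZ * Aᴴ))) := by
    intro Φ A B j hA hB
    rw [sum_supportKet, support_state (localGates_unitary hA) (localGates_unitary hB),
      ← choiState_injective.eq_iff (b := lineMap _ _), choiState_lineMap, Matrix.transpose_transpose]
  ext Φ
  constructor
  · rintro ⟨A, hA, B, hB, j, h⟩
    exact ⟨A, hA, B, hB, j, (key hA hB).mp h⟩
  · rintro ⟨A, hA, B, hB, j, h⟩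
    exact ⟨A, hA, B, hB, j, (key hA hB).mpr h⟩

lemma exists_sign_iff {s : ℂ} : s ∈ ({1, -1} : Set ℂ) ↔ ∃ j : Fin 2, s = (-1 : ℂ) ^ (j : ℕ) := by
  constructor
  · rintro (rfl | rfl)
    exacts [⟨0, by simp⟩, ⟨1, by simp⟩]
  · rintro ⟨j, rfl⟩
    fin_cases j <;> simp

lemma rankTwoFamily_zero : rankTwoFamily 0 = codedMaps contractionCodes := by
  rw [rankTwoFamily_eq, codedMaps_contractionCodes]
  ext Φ
  constructor
  · rintro ⟨A, hA, B, hB, j, rfl⟩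
    refine ⟨_, localGates_conj_mem hA, _, exists_sign_iff.mpr ⟨j, rfl⟩, ?_⟩
    simp [localGates_unitary hB]
  · rintro ⟨σ, hσ, s, hs, rfl⟩
    obtain ⟨A, hA, rfl⟩ := exists_localGate hσ
    obtain ⟨j, rfl⟩ := exists_sign_iff.mp hs
    exact ⟨A, hA, 1, by simp [localGates], j, by simp⟩

lemma transpose_pauli {σ : Matrix (Fin 2) (Fin 2) ℂ} (hσ : σ ∈ paulis) :
    ∃ s ∈ ({1, -1} : Set ℂ), σᵀ = s • σ := by
  rcases hσ with rfl | rfl | rfl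
  · refine ⟨1, by simp, ?_⟩
    ext i j; fin_cases i <;> fin_cases j <;> simp [pauliX]
  · refine ⟨-1, by simp, ?_⟩
    ext i j; fin_cases i <;> fin_cases j <;> simp [pauliY]
  · refine ⟨1, by simp, ?_⟩
    ext i j; fin_cases i <;> fin_cases j <;> simp [pauliZ]

/-- This moves the sign from the transpose of σ_y into W, where both signs are allowed anyway. -/
lemma lineMap_smul_left (s : ℂ) (Q W : Matrix (Fin 2) (Fin 2) ℂ) :
    lineMap (s • Q) W = lineMap Q (s • W) := by
  ext1 ρ
  rw [lineMap_apply, lineMap_apply, Matrix.smul_mul, Matrix.trace_smul, smul_smul, smul_eq_mul,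
    mul_comm s]

lemma sign_mul_mem {s t : ℂ} (hs : s ∈ ({1, -1} : Set ℂ)) (ht : t ∈ ({1, -1} : Set ℂ)) :
    s * t ∈ ({1, -1} : Set ℂ) := by
  rcases hs with rfl | rfl <;> rcases ht with rfl | rfl <;> simp

lemma rankTwoFamily_one : rankTwoFamily 1 = codedMaps mixtureCodes := by
  rw [rankTwoFamily_eq, codedMaps_mixtureCodes]
  simp only [Fin.val_one, pow_one]
  ext Φ
  constructor
  · rintro ⟨A, hA, B, hB, j, rfl⟩
    obtain ⟨s, hs, e⟩ := transpose_pauli (localGates_conj_mem hB)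
    refine ⟨_, localGates_conj_mem hB, _, localGates_conj_mem hA, _,
      sign_mul_mem hs (exists_sign_iff.mpr ⟨j, rfl⟩), ?_⟩
    rw [e, lineMap_smul_left, smul_smul]
  · rintro ⟨Q, hQ, σ, hσ, s, hs, rfl⟩
    obtain ⟨A, hA, rfl⟩ := exists_localGate hσ
    obtain ⟨B, hB, rfl⟩ := exists_localGate hQ
    obtain ⟨t, ht, e⟩ := transpose_pauli (localGates_conj_mem hB)
    obtain ⟨j, hj⟩ := exists_sign_iff.mp (sign_mul_mem ht hs)
    refine ⟨A, hA, B, hB, j, ?_⟩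
    rw [e, lineMap_smul_left, ← hj, smul_smul, ← mul_assoc,
      show t * t = 1 by rcases ht with rfl | rfl <;> norm_num, one_mul]

lemma choiState_roots {Φ : SuperOp (Fin 2)} {k : Fin 2} (h : Φ ∈ rankTwoFamily k) :
    (choiState Φ).charpoly.roots = {1 / 2, 1 / 2, 0, 0} := by
  obtain ⟨A, hA, B, hB, j, h⟩ := h
  have hU := mul_eq_one_comm.mp
    (supportOp_unitary (localGates_unitary hA) (localGates_unitary hB) j k)
  rw [h, sum_supportKet, Matrix.charpoly_mul_comm, ← mul_assoc, hU, one_mul,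
    Matrix.charpoly_diagonal]
  have : ∏ i, (Polynomial.X - Polynomial.C (supportWeight i)) =
      ((Finset.univ.val.map supportWeight).map fun a => Polynomial.X - Polynomial.C a).prod := by
    rw [Multiset.map_map]
    rfl
  rw [this, Polynomial.roots_multiset_prod_X_sub_C]
  rfl

/-! ## Operators on three copies -/

/-- The product operator `A ⊗ B ⊗ D` on three copies. -/
def cube {n : Type} (A B D : Matrix n n ℂ) : Matrix (n × n × n) (n × n × n) ℂ := A ⊗ₖ (B ⊗ₖ D)

section Cube

variable {n : Type}

lemma cube_apply (A B D : Matrix n n ℂ) (i j : n × n × n) :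
    cube A B D i j = A i.1 j.1 * (B i.2.1 j.2.1 * D i.2.2 j.2.2) := rfl

lemma cube_mul [Fintype n] (A B D A' B' D' : Matrix n n ℂ) :
    cube A B D * cube A' B' D' = cube (A * A') (B * B') (D * D') := by
  simp only [cube, Matrix.mul_kronecker_mul]

lemma cube_conjTranspose (A B D : Matrix n n ℂ) : (cube A B D)ᴴ = cube Aᴴ Bᴴ Dᴴ := by
  simp only [cube, Matrix.conjTranspose_kronecker]

lemma cube_one [DecidableEq n] : cube (1 : Matrix n n ℂ) 1 1 = 1 := by
  simp only [cube, Matrix.one_kronecker_one]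

lemma cube_smul (x y z : ℂ) (A B D : Matrix n n ℂ) :
    cube (x • A) (y • B) (z • D) = (x * y * z) • cube A B D := by
  simp only [cube, Matrix.smul_kronecker, Matrix.kronecker_smul, smul_smul]
  congr 1
  ring

/-- S is c times the permutation matrix of π, so commuting with it is invariance under relabelling
by π. -/
lemma commute_of_involution {m : Type} [Fintype m] [DecidableEq m] {S K : Matrix m m ℂ}
    {π : m → m} {c : ℂ} (hπ : Function.Involutive π)
    (hS : ∀ i k, S i k = if k = π i then c else 0) (hK : ∀ i j, K (π i) j = K i (π j)) :
    Commute S K := by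
  ext i j
  rw [Matrix.mul_apply, Matrix.mul_apply]
  have h : ∀ k, (j = π k) ↔ (k = π j) := fun k =>
    ⟨fun h => by rw [h, hπ k], fun h => by rw [h, hπ j]⟩
  simp only [hS, h, mul_ite, mul_zero, Finset.sum_ite_eq', Finset.mem_univ,
    if_true, hK, mul_comm]

variable {κ : Type} [Fintype κ] [Fintype n] [DecidableEq n] {P : κ → Matrix n n ℂ} {c : ℂ}

/-- By completeness of the frame, ∑ P_u†⊗P_u is c times the swap of the two factors. -/
lemma IsOperatorFrame.commute_swap₁₂ (h : IsOperatorFrame P c) (U : Matrix n n ℂ) :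
    Commute (∑ u, cube (P u)ᴴ (P u) 1) (cube U U U) := by
  refine commute_of_involution (π := fun i => (i.2.1, i.1, i.2.2)) (c := c) (fun i => rfl) ?_ ?_
  · rintro ⟨i, i', i''⟩ ⟨k, k', k''⟩
    have := congrArg (· * (1 : Matrix n n ℂ) i'' k'') (h i' k' k i)
    simp only [Finset.sum_mul] at this
    simp only [Matrix.sum_apply, cube_apply, Matrix.conjTranspose_apply, Prod.mk.injEq]
    rw [Finset.sum_congr rfl fun u _ => by rw [← mul_assoc, mul_comm (star _)], this,
      Matrix.one_apply]
    grind
  · rintro ⟨i, i', i''⟩ ⟨k, k', k''⟩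
    simp only [cube_apply]
    ring

lemma IsOperatorFrame.commute_swap₁₃ (h : IsOperatorFrame P c) (U : Matrix n n ℂ) :
    Commute (∑ u, cube (P u)ᴴ 1 (P u)) (cube U U U) := by
  refine commute_of_involution (π := fun i => (i.2.2, i.2.1, i.1)) (c := c) (fun i => rfl) ?_ ?_
  · rintro ⟨i, i', i''⟩ ⟨k, k', k''⟩
    have := congrArg (· * (1 : Matrix n n ℂ) i' k') (h i'' k'' k i)
    simp only [Finset.sum_mul] at this
    simp only [Matrix.sum_apply, cube_apply, Matrix.conjTranspose_apply, Prod.mk.injEq]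
    rw [Finset.sum_congr rfl fun u _ => by
      rw [mul_comm, mul_assoc, mul_comm ((1 : Matrix n n ℂ) i' k')], this, Matrix.one_apply]
    grind
  · rintro ⟨i, i', i''⟩ ⟨k, k', k''⟩
    simp only [cube_apply]
    ring

lemma IsOperatorFrame.commute_swap₂₃ (h : IsOperatorFrame P c) (U : Matrix n n ℂ) :
    Commute (∑ u, cube 1 (P u)ᴴ (P u)) (cube U U U) := by
  refine commute_of_involution (π := fun i => (i.1, i.2.2, i.2.1)) (c := c) (fun i => rfl) ?_ ?_
  · rintro ⟨i, i', i''⟩ ⟨k, k', k''⟩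
    have := congrArg (· * (1 : Matrix n n ℂ) i k) (h i'' k'' k' i')
    simp only [Finset.sum_mul] at this
    simp only [Matrix.sum_apply, cube_apply, Matrix.conjTranspose_apply, Prod.mk.injEq]
    rw [Finset.sum_congr rfl fun u _ => by
      rw [mul_comm, mul_comm (star _)], this, Matrix.one_apply]
    grind
  · rintro ⟨i, i', i''⟩ ⟨k, k', k''⟩
    simp only [cube_apply]
    ring

end Cube

/-! ## Orbits of the Clifford group on pairs of Pauli operators -/

/-- Whether `x` and `z` can be completed by `y` and `w` such that `(x, y)` and `(z, w)` generate
two commuting Pauli groups. -/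
def extendsToTableau (x₁ x₂ : ℕ) : Bool :=
  hermTwo.any fun z₁ => Nat.beq (sympTwo x₁ z₁) 1 && Nat.beq (sympTwo z₁ x₂) 0 &&
    hermTwo.any fun z₂ => Nat.beq (sympTwo x₂ z₂) 1 && Nat.beq (sympTwo x₁ z₂) 0 &&
      Nat.beq (sympTwo z₁ z₂) 0

/-- Transitivity up to phase on pairs of distinct nontrivial commuting Pauli operators: each such
pair occurs as (x₁, x₂) in some tableau. Reduction mod 16 forgets the phase. -/
lemma commuting_pairs : ((List.range 16).all fun a => (List.range 16).all fun b =>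
    (Nat.beq a 0 || Nat.beq b 0 || Nat.beq a b || Nat.beq (sympTwo a b) 1) ||
      hermTwo.any fun x₁ => Nat.beq (x₁ % 16) a && hermTwo.any fun x₂ => Nat.beq (x₂ % 16) b &&
        Nat.beq (sympTwo x₁ x₂) 0 && extendsToTableau x₁ x₂) = true := by
  decide +kernel

lemma anticommuting_pairs : ((List.range 16).all fun a => (List.range 16).all fun b =>
    (Nat.beq (sympTwo a b) 0) ||
      hermTwo.any fun x₁ => Nat.beq (x₁ % 16) a && hermTwo.any fun z₁ => Nat.beq (z₁ % 16) b &&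
        Nat.beq (sympTwo x₁ z₁) 1 && hermTwo.any fun x₂ => Nat.beq (sympTwo x₁ x₂) 0 &&
          Nat.beq (sympTwo z₁ x₂) 0 && hermTwo.any fun z₂ => Nat.beq (sympTwo x₂ z₂) 1 &&
            Nat.beq (sympTwo x₁ z₂) 0 && Nat.beq (sympTwo z₁ z₂) 0) = true := by
  decide +kernel

lemma anticommuting_partner : ((List.range 16).all fun a => Nat.beq a 0 ||
    (List.range 16).any fun b => Nat.beq (sympTwo a b) 1) = true := by
  decide +kernel

lemma exists_tableau_commuting {a b : ℕ} (ha : a < 16) (hb : b < 16) (ha0 : a ≠ 0) (hb0 : b ≠ 0)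
    (hab : a ≠ b) (hs : sympTwo a b = 0) :
    ∃ t, IsTableau t ∧ t.1 % 16 = a ∧ t.2.2.1 % 16 = b := by
  have h := List.all_eq_true.mp (List.all_eq_true.mp commuting_pairs a (List.mem_range.mpr ha)) b
    (List.mem_range.mpr hb)
  simp only [Bool.or_eq_true, Nat.beq_eq, List.any_eq_true, Bool.and_eq_true, ha0, hb0, hab, hs,
    extendsToTableau, false_or, or_self, zero_ne_one] at h
  obtain ⟨x₁, m1, h1, x₂, m2, ⟨h2, h3⟩, z₁, m3, ⟨h4, h5⟩, z₂, m4, ⟨h6, h7⟩, h8⟩ := h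
  exact ⟨(x₁, z₁, x₂, z₂), ⟨⟨m1, m3, m2, m4⟩, h4, h6, h3, h7, h5, h8⟩, h1, h2⟩

lemma exists_tableau_anticommuting {a b : ℕ} (ha : a < 16) (hb : b < 16)
    (hs : sympTwo a b = 1) : ∃ t, IsTableau t ∧ t.1 % 16 = a ∧ t.2.1 % 16 = b := by
  have h := List.all_eq_true.mp (List.all_eq_true.mp anticommuting_pairs a
    (List.mem_range.mpr ha)) b (List.mem_range.mpr hb)
  simp only [Bool.or_eq_true, Nat.beq_eq, List.any_eq_true, Bool.and_eq_true, hs, false_or,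
    one_ne_zero] at h
  obtain ⟨x₁, m1, h1, z₁, m2, ⟨h2, h3⟩, x₂, m3, ⟨h4, h5⟩, z₂, m4, ⟨h6, h7⟩, h8⟩ := h
  exact ⟨(x₁, z₁, x₂, z₂), ⟨⟨m1, m2, m3, m4⟩, h3, h6, h4, h7, h5, h8⟩, h1, h2⟩

lemma exists_tableau_single {a : ℕ} (ha : a < 16) (ha0 : a ≠ 0) :
    ∃ t, IsTableau t ∧ t.1 % 16 = a := by
  have h := List.all_eq_true.mp anticommuting_partner a (List.mem_range.mpr ha)
  simp only [Bool.or_eq_true, Nat.beq_eq, List.any_eq_true, ha0, false_or] at h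
  obtain ⟨b, hb, hs⟩ := h
  obtain ⟨t, ht, h1, -⟩ := exists_tableau_anticommuting ha (List.mem_range.mp hb) hs
  exact ⟨t, ht, h1⟩

/-- If c is not ab up to phase, then abc is nontrivial and anticommutes with one of the four
generators, so conjugation by that generator flips the sign of P_a⊗P_b⊗P_c. -/
lemma separating_pauli : ((List.range 16).all fun a => (List.range 16).all fun b =>
    (List.range 16).all fun c => Nat.beq (mulTwo a b % 16) c ||
      [8, 4, 2, 1].any fun q => Nat.beq ((sympTwo q a + sympTwo q b + sympTwo q c) % 2) 1)
        = true := by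
  decide +kernel

lemma mulTwo_mod_mul : ((List.range 16).all fun a => (List.range 16).all fun b =>
    Nat.beq (mulTwo (mulTwo a b % 16) (mulTwo a b) % 16) 0) = true := by
  decide +kernel

lemma mulTwo_self_mod : ((List.range 16).all fun a => Nat.beq (mulTwo a a % 16) 0) = true := by
  decide +kernel

/-! ## Pauli operators are Clifford operators -/

lemma det_weyl_sq (j k : ℕ) : (weyl j k).det ^ 2 = 1 := by
  have hX : pauliX.det = -1 := by simp [pauliX, Matrix.det_fin_two]
  have hZ : pauliZ.det = -1 := by simp [pauliZ, Matrix.det_fin_two]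
  rw [weyl, Matrix.det_mul, Matrix.det_pow, Matrix.det_pow, hX, hZ, ← pow_add, ← pow_mul,
    mul_comm, pow_mul]
  norm_num

lemma det_pauliTwo (a : ℕ) : (pauliTwo a).det = 1 := by
  rw [pauliTwo, Matrix.det_smul, Matrix.det_kronecker]
  simp only [Fintype.card_prod, Fintype.card_fin, det_weyl_sq, mul_one]
  rw [← pow_mul, mul_comm, pow_mul, Complex.I_pow_four, one_pow]

lemma conj_pauliTwo (q a : ℕ) :
    pauliTwo q * pauliTwo a * (pauliTwo q)ᴴ = (-1 : ℂ) ^ sympTwo q a • pauliTwo a := by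
  rw [pauliTwo_comm, Matrix.smul_mul, mul_assoc, pauliTwo_mul_conjTranspose, mul_one]

lemma isClifford_pauliTwo (q : ℕ) : IsClifford pauliGroupTwo (pauliTwo q) := by
  refine ⟨Matrix.mem_specialUnitaryGroup_iff.mpr
    ⟨Matrix.mem_unitaryGroup_iff'.mpr (pauliTwo_conjTranspose_mul q), det_pauliTwo q⟩,
    fun P hP => ?_⟩
  obtain ⟨a, -, rfl⟩ := mem_pauliGroupTwo_iff.mp hP
  rw [conj_pauliTwo, neg_one_pow_eq_I_pow, ← pauliTwo_add_sixteen]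
  exact pauliTwo_mem _

/-! ## The commutant of the third tensor powers of the Clifford operators -/

section Commutant

variable {M : Matrix ((Fin 2 × Fin 2) × (Fin 2 × Fin 2) × (Fin 2 × Fin 2))
  ((Fin 2 × Fin 2) × (Fin 2 × Fin 2) × (Fin 2 × Fin 2)) ℂ}

lemma trace_cube_conj
    (hM : ∀ C, IsClifford pauliGroupTwo C → Commute (cube C C C) M)
    {C : Matrix (Fin 2 × Fin 2) (Fin 2 × Fin 2) ℂ} (hC : IsClifford pauliGroupTwo C)
    (A B D : Matrix (Fin 2 × Fin 2) (Fin 2 × Fin 2) ℂ) :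
    (cube (conjBy C A) (conjBy C B) (conjBy C D) * M).trace = (cube A B D * M).trace := by
  have hU := hC.conjTranspose_mul
  have h1 : cube (conjBy C A) (conjBy C B) (conjBy C D)
      = cube C C C * cube A B D * (cube C C C)ᴴ := by
    rw [cube_conjTranspose, cube_mul, cube_mul]
    rfl
  have h2 : (cube C C C)ᴴ * cube C C C = 1 := by
    rw [cube_conjTranspose, cube_mul, hU, cube_one]
  have h3 : (cube C C C)ᴴ * M * cube C C C = M := by
    rw [mul_assoc, ← (hM C hC).eq, ← mul_assoc, h2, one_mul]
  rw [h1, mul_assoc, Matrix.trace_mul_comm, ← mul_assoc, h3, Matrix.trace_mul_comm]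

lemma trace_cube_eq_zero
    (hM : ∀ C, IsClifford pauliGroupTwo C → Commute (cube C C C) M) {a b c : ℕ} (ha : a < 16)
    (hb : b < 16) (hc : c < 16) (h : mulTwo a b % 16 ≠ c) :
    (cube (pauliTwo a) (pauliTwo b) (pauliTwo c) * M).trace = 0 := by
  have hsep := List.all_eq_true.mp (List.all_eq_true.mp (List.all_eq_true.mp separating_pauli a
    (List.mem_range.mpr ha)) b (List.mem_range.mpr hb)) c (List.mem_range.mpr hc)
  simp only [Bool.or_eq_true, Nat.beq_eq, List.any_eq_true, h, false_or] at hsep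
  obtain ⟨q, -, hq⟩ := hsep
  have key := trace_cube_conj hM (isClifford_pauliTwo q) (pauliTwo a) (pauliTwo b) (pauliTwo c)
  simp only [conjBy_apply, conj_pauliTwo] at key
  rw [cube_smul, ← pow_add, ← pow_add, neg_one_pow_congr (b := 1) hq, pow_one, neg_one_smul,
    neg_mul, Matrix.trace_neg] at key
  linear_combination (-1 / 2 : ℂ) * key

/-- The coefficient of a pair of Pauli operators in an operator on three copies. -/
def pairCoeff (M : Matrix ((Fin 2 × Fin 2) × (Fin 2 × Fin 2) × (Fin 2 × Fin 2))
    ((Fin 2 × Fin 2) × (Fin 2 × Fin 2) × (Fin 2 × Fin 2)) ℂ)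
    (A B : Matrix (Fin 2 × Fin 2) (Fin 2 × Fin 2) ℂ) : ℂ := (cube A B (A * B)ᴴ * M).trace

lemma I_pow_mul_star (l : ℕ) : Complex.I ^ l * star (Complex.I ^ l) = 1 := by
  rw [star_pow, ← mul_pow]
  simp

/-- The adjoint of AB in the third factor cancels the phases of A and B. Hence orbits up to phase
suffice. -/
lemma pairCoeff_smul (k l : ℕ) (A B : Matrix (Fin 2 × Fin 2) (Fin 2 × Fin 2) ℂ) :
    pairCoeff M (Complex.I ^ k • A) (Complex.I ^ l • B) = pairCoeff M A B := by
  rw [pairCoeff, Matrix.smul_mul, Matrix.mul_smul, smul_smul, Matrix.conjTranspose_smul, cube_smul,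
    ← pow_add, I_pow_mul_star, one_smul, pairCoeff]

lemma pairCoeff_pauliTwo (a b : ℕ) :
    pairCoeff M (pauliTwo a) (pauliTwo b) =
      pairCoeff M (pauliTwo (a % 16)) (pauliTwo (b % 16)) := by
  have h : ∀ a, pauliTwo a = Complex.I ^ (a / 16) • pauliTwo (a % 16) := fun a => by
    rw [← pauliTwo_add_sixteen, Nat.mod_add_div]
  rw [h a, h b, pairCoeff_smul]

lemma pairCoeff_conj (hM : ∀ C, IsClifford pauliGroupTwo C → Commute (cube C C C) M)
    {C : Matrix (Fin 2 × Fin 2) (Fin 2 × Fin 2) ℂ} (hC : IsClifford pauliGroupTwo C)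
    (A B : Matrix (Fin 2 × Fin 2) (Fin 2 × Fin 2) ℂ) :
    pairCoeff M (conjBy C A) (conjBy C B) = pairCoeff M A B := by
  have : (conjBy C A * conjBy C B)ᴴ = conjBy C (A * B)ᴴ := by
    rw [← conjBy_mul hC.conjTranspose_mul, conjBy_apply, conjBy_apply, Matrix.conjTranspose_mul,
      Matrix.conjTranspose_mul, Matrix.conjTranspose_conjTranspose, mul_assoc]
  rw [pairCoeff, this, trace_cube_conj hM hC, pairCoeff]

/-- The coefficient is constant on the orbits (1, 1), (1, P), (P, 1), (P, P), distinct nontrivial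
commuting pairs, and anticommuting pairs. The six functions on the right are a basis of the
functions constant on these orbits, chosen because each is the Pauli expansion of a permutation of
the copies. -/
lemma pairCoeff_eq (hM : ∀ C, IsClifford pauliGroupTwo C → Commute (cube C C C) M) :
    ∃ z₀ z₁ z₂ z₃ z₄ z₅ : ℂ, ∀ a b : Fin 16, pairCoeff M (pauliTwo a) (pauliTwo b) =
      (if a = 0 ∧ b = 0 then z₀ else 0) + (if a = 0 then z₁ else 0) + (if b = 0 then z₂ else 0) +
        (if a = b then z₃ else 0) + z₄ + z₅ * (-1) ^ sympTwo a b := by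
  set X := pauliTwo 8
  set Z := pauliTwo 4
  set X' := pauliTwo 2
  have h₁ : ∀ b : Fin 16, b ≠ 0 → pairCoeff M (pauliTwo b) (pauliTwo b) = pairCoeff M X X ∧
      pairCoeff M 1 (pauliTwo b) = pairCoeff M 1 X ∧
      pairCoeff M (pauliTwo b) 1 = pairCoeff M X 1 := by
    intro b hb
    obtain ⟨t, ht, e⟩ := exists_tableau_single b.2 (fun h => hb (Fin.ext h))
    obtain ⟨C, hC, hCt⟩ := exists_clifford_of_tableau ht
    have h1 := conjBy_one hC.conjTranspose_mul
    refine ⟨?_, ?_, ?_⟩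
    · rw [← pairCoeff_conj hM hC X X, hCt.1, pairCoeff_pauliTwo t.1, e]
    · rw [← pairCoeff_conj hM hC 1 X, hCt.1, h1, ← pauliTwo_zero, pairCoeff_pauliTwo _ t.1, e]
    · rw [← pairCoeff_conj hM hC X 1, hCt.1, h1, ← pauliTwo_zero, pairCoeff_pauliTwo t.1, e]
  have h₂ : ∀ a b : Fin 16, sympTwo a b = 1 →
      pairCoeff M (pauliTwo a) (pauliTwo b) = pairCoeff M X Z := by
    intro a b hs
    obtain ⟨t, ht, e, e'⟩ := exists_tableau_anticommuting a.2 b.2 hs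
    obtain ⟨C, hC, hCt⟩ := exists_clifford_of_tableau ht
    rw [← pairCoeff_conj hM hC X Z, hCt.1, hCt.2.1, pairCoeff_pauliTwo t.1, e, e']
  have h₃ : ∀ a b : Fin 16, a ≠ 0 → b ≠ 0 → a ≠ b → sympTwo a b = 0 →
      pairCoeff M (pauliTwo a) (pauliTwo b) = pairCoeff M X X' := by
    intro a b ha hb hab hs
    obtain ⟨t, ht, e, e'⟩ := exists_tableau_commuting a.2 b.2 (fun h => ha (Fin.ext h))
      (fun h => hb (Fin.ext h)) (fun h => hab (Fin.ext h)) hs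
    obtain ⟨C, hC, hCt⟩ := exists_clifford_of_tableau ht
    rw [← pairCoeff_conj hM hC X X', hCt.1, hCt.2.2.1, pairCoeff_pauliTwo t.1, e, e']
  have s0 : ∀ b, sympTwo 0 b = 0 := fun b => by simp [sympTwo]
  have s0' : ∀ a, sympTwo a 0 = 0 := fun a => by simp [sympTwo]
  have saa : ∀ a, sympTwo a a = 0 := fun a => by rw [sympTwo]; omega
  -- These values solve the triangular system given by the six orbits; the last two are half the sum
  -- and half the difference of the commuting and the anticommuting value.
  refine ⟨pairCoeff M 1 1 - pairCoeff M 1 X - pairCoeff M X 1 - pairCoeff M X X +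
    2 * pairCoeff M X X', pairCoeff M 1 X - pairCoeff M X X', pairCoeff M X 1 - pairCoeff M X X',
    pairCoeff M X X - pairCoeff M X X', (pairCoeff M X X' + pairCoeff M X Z) / 2,
    (pairCoeff M X X' - pairCoeff M X Z) / 2, fun a b => ?_⟩
  by_cases ha : a = 0
  · subst ha
    by_cases hb : b = 0
    · subst hb
      simp only [and_self, if_true, Fin.val_zero, pauliTwo_zero, s0, pow_zero]
      ring
    · simp only [hb, and_false, if_true, if_false, Fin.val_zero, pauliTwo_zero, (h₁ b hb).2.1, s0,
        Ne.symm hb, pow_zero]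
      ring
  · by_cases hb : b = 0
    · subst hb
      simp only [ha, and_true, if_true, if_false, Fin.val_zero, pauliTwo_zero, (h₁ a ha).2.2, s0',
        pow_zero]
      ring
    · by_cases hab : a = b
      · subst hab
        simp only [ha, false_and, if_true, if_false, (h₁ a ha).1, saa, pow_zero]
        ring
      · simp only [ha, hb, hab, false_and, if_false]
        have hlt := sympTwo_lt a b
        obtain hs | hs : sympTwo a b = 0 ∨ sympTwo a b = 1 := by omega
        · rw [h₃ a b ha hb hab hs, hs]; ring
        · rw [h₂ a b hs, hs]; ring

lemma sum_pairCoeff (hM : ∀ C, IsClifford pauliGroupTwo C → Commute (cube C C C) M) :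
    (64 : ℂ) • M = ∑ a : Fin 16, ∑ b : Fin 16, pairCoeff M (pauliTwo a) (pauliTwo b) •
      cube (pauliTwo a)ᴴ (pauliTwo b)ᴴ (pauliTwo a * pauliTwo b) := by
  have h := (pauliTwo_frame.kronecker (pauliTwo_frame.kronecker pauliTwo_frame)).expand M
  rw [show (4 : ℂ) * (4 * 4) = 64 by norm_num] at h
  rw [h, Fintype.sum_prod_type]
  refine Finset.sum_congr rfl fun a _ => ?_
  rw [Fintype.sum_prod_type]
  refine Finset.sum_congr rfl fun b _ => ?_
  change ∑ c : Fin 16, (cube (pauliTwo a) (pauliTwo b) (pauliTwo c) * M).trace •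
    (cube (pauliTwo a) (pauliTwo b) (pauliTwo c))ᴴ = _
  have hlt : mulTwo a b % 16 < 16 := Nat.mod_lt _ (by norm_num)
  -- Only the c that equals ab up to phase survives; that phase enters the coefficient and the
  -- operator with conjugate values and cancels.
  rw [Finset.sum_eq_single ⟨mulTwo a b % 16, hlt⟩]
  · have e := List.all_eq_true.mp (List.all_eq_true.mp mulTwo_mod_mul a
      (List.mem_range.mpr a.2)) b (List.mem_range.mpr b.2)
    have e' := Nat.eq_of_beq_eq_true e
    obtain ⟨l, hl⟩ : ∃ l, mulTwo (mulTwo a b % 16) (mulTwo a b) = 0 + 16 * l :=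
      ⟨mulTwo (mulTwo a b % 16) (mulTwo a b) / 16, by omega⟩
    have hc : pauliTwo (mulTwo a b % 16) = Complex.I ^ l • (pauliTwo a * pauliTwo b)ᴴ := by
      have h1 : pauliTwo (mulTwo a b % 16) * (pauliTwo a * pauliTwo b) = Complex.I ^ l • 1 := by
        rw [pauliTwo_mul, pauliTwo_mul, hl, pauliTwo_add_sixteen, pauliTwo_zero]
      calc pauliTwo (mulTwo a b % 16)
          = pauliTwo (mulTwo a b % 16) * (pauliTwo a * pauliTwo b) *
            (pauliTwo a * pauliTwo b)ᴴ := by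
            rw [mul_assoc, pauliTwo_mul, pauliTwo_mul_conjTranspose, mul_one]
        _ = _ := by rw [h1, Matrix.smul_mul, one_mul]
    have hcube : cube (pauliTwo a) (pauliTwo b) (pauliTwo (mulTwo a b % 16))
        = Complex.I ^ l • cube (pauliTwo a) (pauliTwo b) (pauliTwo a * pauliTwo b)ᴴ := by
      have := cube_smul 1 1 (Complex.I ^ l) (pauliTwo a) (pauliTwo b) (pauliTwo a * pauliTwo b)ᴴ
      rw [one_smul, one_smul, one_mul, one_mul] at this
      rw [hc, this]
    simp only [hcube]
    rw [Matrix.smul_mul, Matrix.trace_smul, Matrix.conjTranspose_smul, smul_smul, smul_eq_mul,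
      mul_right_comm, I_pow_mul_star, one_mul, cube_conjTranspose,
      Matrix.conjTranspose_conjTranspose]
    rfl
  · intro c _ hc
    rw [trace_cube_eq_zero hM a.2 b.2 c.2 fun h => hc (Fin.ext h.symm), zero_smul]
  · intro h
    exact absurd (Finset.mem_univ _) h

/-- Inserting the six coefficients into the Pauli expansion turns it into a combination of 1, the
three scaled swaps, and the products of two swaps in either order. The commutation sign gives the
second order, since it replaces P_a P_b by P_b P_a. -/
lemma commute_cube_of_clifford
    (hM : ∀ C, IsClifford pauliGroupTwo C → Commute (cube C C C) M)
    (U : Matrix (Fin 2 × Fin 2) (Fin 2 × Fin 2) ℂ) : Commute M (cube U U U) := by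
  obtain ⟨z₀, z₁, z₂, z₃, z₄, z₅, hz⟩ := pairCoeff_eq hM
  set S₁₂ := ∑ u : Fin 16, cube (pauliTwo u)ᴴ (pauliTwo u) 1 with hS₁₂
  set S₁₃ := ∑ u : Fin 16, cube (pauliTwo u)ᴴ 1 (pauliTwo u) with hS₁₃
  set S₂₃ := ∑ u : Fin 16, cube 1 (pauliTwo u)ᴴ (pauliTwo u) with hS₂₃
  have hsum : (64 : ℂ) • M = z₀ • 1 + z₁ • S₂₃ + z₂ • S₁₃ + z₃ • S₁₂ + z₄ • (S₁₃ * S₂₃) +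
      z₅ • (S₂₃ * S₁₃) := by
    have p0 : pauliTwo ((0 : Fin 16) : ℕ) = 1 := pauliTwo_zero
    rw [sum_pairCoeff hM]
    simp only [hz, add_smul, Finset.sum_add_distrib]
    congr 1
    · congr 1
      · congr 1
        · congr 1
          · congr 1
            · simp [ite_and, ite_smul, Finset.sum_ite_irrel, pauliTwo_zero, cube_one]
            · simp only [ite_smul, zero_smul, Finset.sum_ite_irrel, Finset.sum_const_zero,
                Finset.sum_ite_eq', Finset.mem_univ, if_true, p0, Matrix.conjTranspose_one,
                one_mul, hS₂₃, Finset.smul_sum]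
          · simp only [ite_smul, zero_smul, Finset.sum_ite_eq', Finset.mem_univ, if_true, p0,
              Matrix.conjTranspose_one, mul_one, hS₁₃, Finset.smul_sum]
        · simp only [ite_smul, zero_smul, Finset.sum_ite_eq, Finset.mem_univ, if_true, hS₁₂,
            Finset.smul_sum]
          refine Finset.sum_congr rfl fun a _ => ?_
          congr 1
          have e := Nat.eq_of_beq_eq_true (List.all_eq_true.mp mulTwo_self_mod a
            (List.mem_range.mpr a.2))
          obtain ⟨l, hl⟩ : ∃ l, mulTwo a a = 0 + 16 * l := ⟨mulTwo a a / 16, by omega⟩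
          have h1 : pauliTwo a * pauliTwo a = Complex.I ^ l • 1 := by
            rw [pauliTwo_mul, hl, pauliTwo_add_sixteen, pauliTwo_zero]
          have h2 : pauliTwo a = Complex.I ^ l • (pauliTwo a)ᴴ := by
            calc pauliTwo a = pauliTwo a * pauliTwo a * (pauliTwo a)ᴴ := by
                  rw [mul_assoc, pauliTwo_mul_conjTranspose, mul_one]
              _ = _ := by rw [h1, Matrix.smul_mul, one_mul]
          have h3 := cube_smul 1 1 (Complex.I ^ l) (pauliTwo a)ᴴ (pauliTwo a)ᴴ 1
          have h4 := cube_smul 1 (Complex.I ^ l) 1 (pauliTwo a)ᴴ (pauliTwo a)ᴴ 1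
          rw [← h2] at h4
          simp only [one_smul, one_mul, mul_one] at h3 h4
          rw [h1, h3, h4]
      · rw [hS₁₃, hS₂₃, Finset.sum_mul_sum]
        simp only [cube_mul, one_mul, mul_one, Finset.smul_sum]
    · rw [hS₁₃, hS₂₃, Finset.sum_mul_sum, Finset.sum_comm]
      simp only [cube_mul, one_mul, mul_one, Finset.smul_sum]
      refine Finset.sum_congr rfl fun b _ => Finset.sum_congr rfl fun a _ => ?_
      have h1 := cube_smul 1 1 ((-1) ^ sympTwo b a) (pauliTwo a)ᴴ (pauliTwo b)ᴴ
        (pauliTwo a * pauliTwo b)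
      have h2 : sympTwo a b = sympTwo b a := by
        simp only [sympTwo]
        congr 1
        ring
      simp only [one_smul, one_mul] at h1
      rw [pauliTwo_comm b a, h1, smul_smul, h2]
  have hM' : M = (64 : ℂ)⁻¹ • ((64 : ℂ) • M) := by
    rw [smul_smul, inv_mul_cancel₀ (by norm_num), one_smul]
  have c₁₂ : Commute S₁₂ (cube U U U) := pauliTwo_frame.commute_swap₁₂ U
  have c₁₃ : Commute S₁₃ (cube U U U) := pauliTwo_frame.commute_swap₁₃ U
  have c₂₃ : Commute S₂₃ (cube U U U) := pauliTwo_frame.commute_swap₂₃ U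
  rw [hM', hsum]
  exact ((((((Commute.one_left _).smul_left _).add_left (c₂₃.smul_left _)).add_left
    (c₁₃.smul_left _)).add_left (c₁₂.smul_left _)).add_left
    ((c₁₃.mul_left c₂₃).smul_left _)).add_left ((c₂₃.mul_left c₁₃).smul_left _) |>.smul_left _

end Commutant

/-! ## Tensor powers of unitary channels -/

section TensorPower

variable {ι : Type}

/-- The tensor power `U^{⊗t}` of an operator. -/
def operatorPower (t : ℕ) (U : Matrix ι ι ℂ) : Matrix (Fin t → ι) (Fin t → ι) ℂ :=
  Matrix.of fun p q => ∏ n, U (p n) (q n)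

lemma operatorPower_apply (t : ℕ) (U : Matrix ι ι ℂ) (p q : Fin t → ι) :
    operatorPower t U p q = ∏ n, U (p n) (q n) := rfl

lemma operatorPower_conjTranspose (t : ℕ) (U : Matrix ι ι ℂ) :
    operatorPower t Uᴴ = (operatorPower t U)ᴴ := by
  ext p q
  simp [operatorPower_apply, Matrix.conjTranspose_apply]

/-- The partial trace over all copies of the environment. -/
def traceCopies {ε : Type} [Fintype ε] (t : ℕ) (M : Matrix (Fin t → ι × ε) (Fin t → ι × ε) ℂ) :
    Matrix (Fin t → ι) (Fin t → ι) ℂ :=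
  traceEnv (M.submatrix (Equiv.arrowProdEquivProdArrow _ _ _).symm
    (Equiv.arrowProdEquivProdArrow _ _ _).symm)

lemma traceCopies_apply {ε : Type} [Fintype ε] (t : ℕ) (M : Matrix (Fin t → ι × ε) (Fin t → ι × ε) ℂ)
    (i j : Fin t → ι) :
    traceCopies t M i j = ∑ l : Fin t → ε, M (fun n => (i n, l n)) fun n => (j n, l n) := rfl

lemma operatorPower_mul [Fintype ι] (t : ℕ) (U W : Matrix ι ι ℂ) :
    operatorPower t (U * W) = operatorPower t U * operatorPower t W := by
  ext p q
  simp only [operatorPower_apply, Matrix.mul_apply, Finset.prod_univ_sum, Fintype.piFinset_univ,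
    Finset.prod_mul_distrib]

lemma operatorPower_one [DecidableEq ι] (t : ℕ) : operatorPower t (1 : Matrix ι ι ℂ) = 1 := by
  ext p q
  by_cases h : p = q
  · subst h
    simp [operatorPower_apply]
  · obtain ⟨n, hn⟩ := Function.ne_iff.mp h
    rw [operatorPower_apply, Matrix.one_apply_ne h]
    exact Finset.prod_eq_zero (Finset.mem_univ n) (Matrix.one_apply_ne hn)

variable [Fintype ι] [DecidableEq ι]

lemma conjBy_single_apply (U : Matrix ι ι ℂ) (a b i j : ι) :
    conjBy U (Matrix.single a b 1) i j = U i a * star (U j b) := by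
  have h : ∀ c, (U * Matrix.single a b (1 : ℂ)) i c = if c = b then U i a else 0 := fun c => by
    simp [Matrix.mul_apply, Matrix.single_apply, ite_and, eq_comm]
  simp only [conjBy_apply, Matrix.mul_apply (N := Uᴴ), h, ite_mul, zero_mul, Finset.sum_ite_eq',
    Finset.mem_univ, if_true, Matrix.conjTranspose_apply]

lemma sandwich_apply {m : Type} [Fintype m] (A M B : Matrix m m ℂ) (i j : m) :
    (A * M * Bᴴ) i j = ∑ a, ∑ b, M a b * (A i a * star (B j b)) := by
  rw [Matrix.mul_apply, Finset.sum_comm]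
  refine Finset.sum_congr rfl fun b _ => ?_
  rw [Matrix.mul_apply, Finset.sum_mul]
  refine Finset.sum_congr rfl fun a _ => ?_
  rw [Matrix.conjTranspose_apply]
  ring

lemma tensorPower_conjBy (t : ℕ) (U : Matrix ι ι ℂ) (M : Matrix (Fin t → ι) (Fin t → ι) ℂ) :
    tensorPower t (conjBy U) M = operatorPower t U * M * (operatorPower t U)ᴴ := by
  ext i j
  rw [sandwich_apply]
  simp only [tensorPower, LinearMap.coe_mk, AddHom.coe_mk, Matrix.of_apply, conjBy_single_apply,
    operatorPower_apply, Finset.prod_mul_distrib, star_prod]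

variable {ε : Type} [Fintype ε] [DecidableEq ε]

/-- The operator `ρ ⊗ |e … e⟩⟨e … e|` with each copy of the environment grouped with its copy of
the system. -/
def withEnvironment (t : ℕ) (e : ε) (ρ : Matrix (Fin t → ι) (Fin t → ι) ℂ) :
    Matrix (Fin t → ι × ε) (Fin t → ι × ε) ℂ :=
  (ρ ⊗ₖ Matrix.single (fun _ : Fin t => e) (fun _ => e) (1 : ℂ)).submatrix
    (Equiv.arrowProdEquivProdArrow _ _ _) (Equiv.arrowProdEquivProdArrow _ _ _)

lemma traceEnv_copies (t : ℕ) (e : ε) (U : Matrix (ι × ε) (ι × ε) ℂ)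
    (ρ : Matrix (Fin t → ι) (Fin t → ι) ℂ) :
    traceEnv (copies t U * (ρ ⊗ₖ Matrix.single (fun _ : Fin t => e) (fun _ => e) (1 : ℂ)) *
      (copies t U)ᴴ) = traceCopies t (tensorPower t (conjBy U) (withEnvironment t e ρ)) := by
  have h : copies t U = (operatorPower t U).submatrix (Equiv.arrowProdEquivProdArrow _ _ _).symm
      (Equiv.arrowProdEquivProdArrow _ _ _).symm := rfl
  rw [tensorPower_conjBy, traceCopies, ← Matrix.submatrix_mul_equiv _ _ _
    (Equiv.arrowProdEquivProdArrow _ _ _).symm, ← Matrix.submatrix_mul_equiv _ _ _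
    (Equiv.arrowProdEquivProdArrow _ _ _).symm, ← Matrix.conjTranspose_submatrix, ← h,
    withEnvironment, Matrix.submatrix_submatrix]
  simp

/-- Tracing out the environments of the copies one by one or all together is the same: a product of
sums over one environment is a sum over tuples. -/
lemma tensorPower_induced_conjBy (t : ℕ) (e : ε) (U : Matrix (ι × ε) (ι × ε) ℂ)
    (ρ : Matrix (Fin t → ι) (Fin t → ι) ℂ) :
    tensorPower t (induced e (conjBy U)) ρ =
      traceCopies t (tensorPower t (conjBy U) (withEnvironment t e ρ)) := by
  have hsingle : ∀ a b i j, induced e (conjBy U) (Matrix.single a b 1) i j =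
      ∑ l, U (i, l) (a, e) * star (U (j, l) (b, e)) := by
    intro a b i j
    simp only [induced, LinearMap.coe_mk, AddHom.coe_mk, traceEnv, Matrix.of_apply,
      Matrix.single_kronecker_single, mul_one, conjBy_single_apply]
  rw [← traceEnv_copies]
  ext i j
  simp only [tensorPower, LinearMap.coe_mk, AddHom.coe_mk, Matrix.of_apply, traceEnv, hsingle,
    sandwich_apply, Fintype.sum_prod_type, Matrix.kroneckerMap_apply, Matrix.single_apply,
    Finset.prod_univ_sum, Fintype.piFinset_univ, copies]
  rw [Finset.sum_comm (s := (Finset.univ : Finset (Fin t → ε)))]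
  refine Finset.sum_congr rfl fun a _ => ?_
  simp only [ite_and, mul_ite, mul_one, mul_zero, ite_mul, zero_mul, Finset.sum_ite_eq,
    Finset.mem_univ, if_true, Finset.sum_ite_irrel, Finset.sum_const_zero, Finset.mul_sum]
  rw [Finset.sum_comm]
  simp only [Finset.prod_mul_distrib, star_prod]

end TensorPower

/-! ## Haar averages -/

section Haar

open MeasureTheory

variable (n : Type) [Fintype n] [DecidableEq n]

instance isHaarMeasure_haarUnitary : Measure.IsHaarMeasure (haarUnitary n) := by
  unfold haarUnitary
  infer_instance

instance isProbabilityMeasure_haarUnitary : IsProbabilityMeasure (haarUnitary n) :=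
  ⟨Measure.haarMeasure_self⟩

/-- Right translation turns the Haar measure into another Haar probability measure, and there is
only one. -/
instance isMulRightInvariant_haarUnitary : Measure.IsMulRightInvariant (haarUnitary n) where
  map_mul_right_eq_self g := by
    have : IsProbabilityMeasure (Measure.map (· * g) (haarUnitary n)) :=
      Measure.isProbabilityMeasure_map (measurable_mul_const g).aemeasurable
    exact Measure.isHaarMeasure_eq_of_isProbabilityMeasure _ _

variable {n}

lemma continuous_tensorPower_conjBy (t : ℕ) (M : Matrix (Fin t → n) (Fin t → n) ℂ)
    (p q : Fin t → n) :
    Continuous fun U : Matrix.unitaryGroup n ℂ => tensorPower t (conjBy U.1) M p q := by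
  have h : ∀ i j, Continuous fun U : Matrix.unitaryGroup n ℂ => U.1 i j :=
    fun i j => continuous_subtype_val.matrix_elem i j
  simp only [tensorPower_conjBy, sandwich_apply, operatorPower_apply]
  exact continuous_finsetSum _ fun a _ => continuous_finsetSum _ fun b _ =>
    continuous_const.mul ((continuous_finsetProd _ fun k _ => h _ _).mul
      (continuous_finsetProd _ fun k _ => h _ _).star)

lemma integrable_tensorPower_conjBy (t : ℕ) (M : Matrix (Fin t → n) (Fin t → n) ℂ)
    (p q : Fin t → n) :
    Integrable (fun U : Matrix.unitaryGroup n ℂ => tensorPower t (conjBy U.1) M p q)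
      (haarUnitary n) :=
  (continuous_tensorPower_conjBy t M p q).integrable_of_hasCompactSupport
    (HasCompactSupport.of_compactSpace _)

lemma integral_tensorPower_conjBy_eq (t : ℕ) (M : Matrix (Fin t → n) (Fin t → n) ℂ)
    {W : Matrix n n ℂ} (hW : W ∈ Matrix.unitaryGroup n ℂ) (p q : Fin t → n) :
    ∫ U : Matrix.unitaryGroup n ℂ, tensorPower t (conjBy U.1) (tensorPower t (conjBy W) M) p q
        ∂haarUnitary n =
      ∫ U : Matrix.unitaryGroup n ℂ, tensorPower t (conjBy U.1) M p q ∂haarUnitary n := by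
  rw [← integral_mul_right_eq_self (fun U : Matrix.unitaryGroup n ℂ =>
    tensorPower t (conjBy U.1) M p q) (⟨W, hW⟩ : Matrix.unitaryGroup n ℂ)]
  congr 1
  ext U
  simp only [tensorPower_conjBy, Submonoid.coe_mul, operatorPower_mul, Matrix.conjTranspose_mul,
    Matrix.mul_assoc]

end Haar

/-! ## The Clifford group is a unitary three-design -/

section Twirl

open MeasureTheory

lemma IsClifford.mul {ι : Type} [Fintype ι] [DecidableEq ι] {Q : Set (Matrix ι ι ℂ)}
    {C C' : Matrix ι ι ℂ} (h : IsClifford Q C) (h' : IsClifford Q C') : IsClifford Q (C * C') := by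
  refine ⟨mul_mem h.1 h'.1, fun P hP => ?_⟩
  have := h.2 _ (h'.2 P hP)
  rwa [Matrix.conjTranspose_mul, show C * C' * P * (C'ᴴ * Cᴴ) = C * (C' * P * C'ᴴ) * Cᴴ by
    simp only [Matrix.mul_assoc]]

/-- Three copies of a system, as a product. -/
def threeCopies (ι : Type) : (Fin 3 → ι) ≃ ι × ι × ι where
  toFun p := (p 0, p 1, p 2)
  invFun x := ![x.1, x.2.1, x.2.2]
  left_inv p := by
    ext n
    fin_cases n <;> rfl
  right_inv x := rfl

lemma operatorPower_three {ι : Type} (U : Matrix ι ι ℂ) :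
    operatorPower 3 U = (cube U U U).submatrix (threeCopies ι) (threeCopies ι) := by
  ext p q
  rw [operatorPower_apply, Fin.prod_univ_three, mul_assoc]
  rfl

lemma commute_operatorPower_of_clifford
    {A : Matrix (Fin 3 → Fin 2 × Fin 2) (Fin 3 → Fin 2 × Fin 2) ℂ}
    (hA : ∀ C, IsClifford pauliGroupTwo C → Commute (operatorPower 3 C) A)
    (U : Matrix (Fin 2 × Fin 2) (Fin 2 × Fin 2) ℂ) : Commute A (operatorPower 3 U) := by
  set e := threeCopies (Fin 2 × Fin 2) with he
  have hsub : A = (A.submatrix e.symm e.symm).submatrix e e := by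
    rw [Matrix.submatrix_submatrix]
    simp
  have hM := commute_cube_of_clifford (M := A.submatrix e.symm e.symm) (fun C hC => by
    have := congrArg (fun B => B.submatrix e.symm e.symm) (hA C hC).eq
    simp only [← Matrix.submatrix_mul_equiv _ _ _ e.symm, operatorPower_three, ← he,
      Matrix.submatrix_submatrix, Equiv.self_comp_symm, Matrix.submatrix_id_id] at this
    exact this) U
  rw [hsub, operatorPower_three, ← he]
  have := congrArg (fun B => B.submatrix e e) hM.eq
  simp only [← Matrix.submatrix_mul_equiv _ _ _ e] at this
  exact this

/-- The two-qubit Clifford group up to phases, as a finite set. -/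
def cliffordFinset : Finset (SuperOp (Fin 2 × Fin 2)) := finite_cliffordOps_two.toFinset

lemma mem_cliffordFinset {T : SuperOp (Fin 2 × Fin 2)} :
    T ∈ cliffordFinset ↔ ∃ C, IsClifford pauliGroupTwo C ∧ T = conjBy C :=
  finite_cliffordOps_two.mem_toFinset

/-- Composition with a Clifford operation permutes the finite Clifford group. -/
lemma sum_tensorPower_clifford_invariant {C : Matrix (Fin 2 × Fin 2) (Fin 2 × Fin 2) ℂ}
    (hC : IsClifford pauliGroupTwo C) (t : ℕ)
    (M : Matrix (Fin t → Fin 2 × Fin 2) (Fin t → Fin 2 × Fin 2) ℂ) :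
    tensorPower t (conjBy C) (∑ T ∈ cliffordFinset, tensorPower t T M) =
      ∑ T ∈ cliffordFinset, tensorPower t T M := by
  have hmaps : Set.MapsTo (fun T => conjBy C ∘ₗ T) (cliffordFinset : Set (SuperOp _))
      cliffordFinset := by
    intro T hT
    obtain ⟨C', hC', rfl⟩ := mem_cliffordFinset.mp hT
    refine mem_cliffordFinset.mpr ⟨C * C', hC.mul hC', ?_⟩
    ext1 X
    simp only [LinearMap.comp_apply, conjBy_apply, Matrix.conjTranspose_mul, Matrix.mul_assoc]
  have hinj : Set.InjOn (fun T => conjBy C ∘ₗ T) (cliffordFinset : Set (SuperOp _)) := by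
    intro T _ T' _ h
    ext1 X
    have h1 : conjBy C (T X) = conjBy C (T' X) := LinearMap.congr_fun h X
    have h2 : ∀ Y, Cᴴ * conjBy C Y * C = Y := fun Y => by
      rw [conjBy_apply, show Cᴴ * (C * Y * Cᴴ) * C = Cᴴ * C * Y * (Cᴴ * C) by
        simp only [Matrix.mul_assoc], hC.conjTranspose_mul, one_mul, mul_one]
    rw [← h2 (T X), h1, h2]
  rw [map_sum]
  refine Finset.sum_nbij (fun T => conjBy C ∘ₗ T) hmaps hinj
    (Finset.surjOn_of_injOn_of_card_le _ hmaps hinj le_rfl) fun T hT => ?_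
  obtain ⟨C', -, rfl⟩ := mem_cliffordFinset.mp hT
  have : conjBy C ∘ₗ conjBy C' = conjBy (C * C') := by
    ext1 X
    simp only [LinearMap.comp_apply, conjBy_apply, Matrix.conjTranspose_mul, Matrix.mul_assoc]
  simp only [this, tensorPower_conjBy, operatorPower_mul, Matrix.conjTranspose_mul,
    Matrix.mul_assoc]

lemma conjTranspose_operatorPower_mul {n : Type} [Fintype n] [DecidableEq n] (t : ℕ)
    {U : Matrix n n ℂ} (hU : Uᴴ * U = 1) : (operatorPower t U)ᴴ * operatorPower t U = 1 := by
  rw [← operatorPower_conjTranspose, ← operatorPower_mul, hU, operatorPower_one]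

/-- The Haar average of `U^{⊗3} M U^{†⊗3}` is the average over the Clifford group. -/
lemma card_mul_integral_tensorPower
    (M : Matrix (Fin 3 → Fin 2 × Fin 2) (Fin 3 → Fin 2 × Fin 2) ℂ) (p q : Fin 3 → Fin 2 × Fin 2) :
    (cliffordFinset.card : ℂ) * ∫ U : Matrix.unitaryGroup (Fin 2 × Fin 2) ℂ,
      tensorPower 3 (conjBy U.1) M p q ∂haarUnitary (Fin 2 × Fin 2) =
        ∑ T ∈ cliffordFinset, tensorPower 3 T M p q := by
  set A := ∑ T ∈ cliffordFinset, tensorPower 3 T M with hA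
  have hcomm : ∀ U, Commute A (operatorPower 3 U) := by
    refine commute_operatorPower_of_clifford fun C hC => ?_
    have h := sum_tensorPower_clifford_invariant hC 3 M
    rw [← hA, tensorPower_conjBy] at h
    change _ * _ = _ * _
    nth_rewrite 2 [← h]
    rw [mul_assoc, conjTranspose_operatorPower_mul 3 hC.conjTranspose_mul, mul_one]
  have hfix : ∀ U : Matrix.unitaryGroup (Fin 2 × Fin 2) ℂ,
      tensorPower 3 (conjBy U.1) A = A := fun U => by
    rw [tensorPower_conjBy, ← (hcomm U.1).eq, mul_assoc, mul_eq_one_comm.mp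
      (conjTranspose_operatorPower_mul 3 (Matrix.mem_unitaryGroup_iff'.mp U.2)), mul_one]
  calc (cliffordFinset.card : ℂ) * ∫ U : Matrix.unitaryGroup (Fin 2 × Fin 2) ℂ,
        tensorPower 3 (conjBy U.1) M p q ∂haarUnitary (Fin 2 × Fin 2)
      = ∑ T ∈ cliffordFinset, ∫ U : Matrix.unitaryGroup (Fin 2 × Fin 2) ℂ,
          tensorPower 3 (conjBy U.1) (tensorPower 3 T M) p q ∂haarUnitary (Fin 2 × Fin 2) := by
        rw [← nsmul_eq_mul, ← Finset.sum_const]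
        refine Finset.sum_congr rfl fun T hT => ?_
        -- By right invariance, M may be replaced by T^{⊗3} M under the integral. Summed over T,
        -- this makes the integrand the constant A.
        obtain ⟨C, hC, rfl⟩ := mem_cliffordFinset.mp hT
        exact (integral_tensorPower_conjBy_eq 3 M
          (Matrix.mem_specialUnitaryGroup_iff.mp hC.1).1 p q).symm
    _ = ∫ U : Matrix.unitaryGroup (Fin 2 × Fin 2) ℂ, A p q ∂haarUnitary (Fin 2 × Fin 2) := by
        rw [← integral_finsetSum _ fun T _ => integrable_tensorPower_conjBy 3 _ p q]
        congr 1
        ext U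
        rw [← Matrix.sum_apply, ← map_sum, ← hA, hfix U]
    _ = _ := by rw [integral_const, probReal_univ, one_smul, hA, Matrix.sum_apply]

/-- The channel average over the Haar measure is the average over the Clifford group. -/
lemma card_smul_haarChannelAverage (ρ : Matrix (Fin 3 → Fin 2) (Fin 3 → Fin 2) ℂ) :
    (cliffordFinset.card : ℂ) • haarChannelAverage 2 3 2 ρ =
      ∑ T ∈ cliffordFinset, tensorPower 3 (induced 0 T) ρ := by
  ext i j
  rw [Matrix.smul_apply, haarChannelAverage, Matrix.of_apply, Matrix.sum_apply, smul_eq_mul]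
  simp only [traceEnv_copies, traceCopies_apply]
  rw [integral_finsetSum _ fun l _ => integrable_tensorPower_conjBy 3 _ _ _, Finset.mul_sum]
  simp only [card_mul_integral_tensorPower]
  rw [Finset.sum_comm]
  refine Finset.sum_congr rfl fun T hT => ?_
  obtain ⟨C, -, rfl⟩ := mem_cliffordFinset.mp hT
  rw [tensorPower_induced_conjBy, traceCopies_apply]

end Twirl

/-! ## The induced channels -/

lemma rankTwo_facts {Φ : SuperOp (Fin 2)} (h : Φ ∈ codedMaps (contractionCodes ++ mixtureCodes)) :
    IsChannel Φ ∧ krausRank Φ = 2 := by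
  rw [codedMaps_append] at h
  obtain h | h := h
  · exact ⟨(contraction_facts h).1, (contraction_facts h).2.1⟩
  · exact ⟨(mixture_facts h).1, (mixture_facts h).2.1⟩

lemma inducedChannels_eq_union : inducedChannels =
    codedMaps unitaryCodes ∪ codedMaps (contractionCodes ++ mixtureCodes) := by
  rw [inducedChannels_eq, allCodes, codedMaps_append]

lemma inducedOfRank_one : inducedOfRank 1 = codedMaps unitaryCodes := by
  ext Φ
  rw [inducedOfRank, inducedChannels_eq_union]
  constructor
  · rintro ⟨h | h, hr⟩
    · exact h
    · rw [(rankTwo_facts h).2] at hr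
      norm_num at hr
  · exact fun h => ⟨Or.inl h, (unitary_facts h).2⟩

lemma inducedOfRank_two : inducedOfRank 2 = codedMaps (contractionCodes ++ mixtureCodes) := by
  ext Φ
  rw [inducedOfRank, inducedChannels_eq_union]
  constructor
  · rintro ⟨h | h, hr⟩
    · rw [(unitary_facts h).2] at hr
      norm_num at hr
    · exact h
  · exact fun h => ⟨Or.inr h, (rankTwo_facts h).2⟩

lemma inducedOfRank_two_mixed :
    {Φ ∈ inducedOfRank 2 | IsMixedUnitary Φ} = codedMaps mixtureCodes := by
  ext Φ
  rw [inducedOfRank_two, codedMaps_append]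
  constructor
  · rintro ⟨h | h, hm⟩
    · exact absurd hm (contraction_facts h).2.2
    · exact h
  · exact fun h => ⟨Or.inr h, (mixture_facts h).2.2⟩

lemma inducedOfRank_two_not_mixed :
    {Φ ∈ inducedOfRank 2 | ¬ IsMixedUnitary Φ} = codedMaps contractionCodes := by
  ext Φ
  rw [inducedOfRank_two, codedMaps_append]
  constructor
  · rintro ⟨h | h, hm⟩
    · exact h
    · exact absurd (mixture_facts h).2.2 hm
  · exact fun h => ⟨Or.inl h, (contraction_facts h).2.2⟩

lemma ncard_codedMaps_of_subset {l : List (ℕ × ℕ × ℕ × ℕ)} (h : l.Sublist allCodes) :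
    (codedMaps l).ncard = l.length :=
  ncard_codedMaps (fun c hc => isCode_of_mem_allCodes c (h.subset hc)) (allCodes_nodup.sublist h)

lemma sublist_unitary : unitaryCodes.Sublist allCodes := List.sublist_append_left _ _

lemma sublist_rankTwo : (contractionCodes ++ mixtureCodes).Sublist allCodes :=
  List.sublist_append_right _ _

lemma multiplicity_unitary {Φ : SuperOp (Fin 2)} (h : Φ ∈ codedMaps unitaryCodes) :
    cliffordMultiplicity Φ = 96 := by
  obtain ⟨c, hc, rfl⟩ := h
  rw [cliffordMultiplicity_codedMap (sublist_unitary.subset hc), length_tableauxOfCode.1 hc]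

lemma multiplicity_rankTwo {Φ : SuperOp (Fin 2)}
    (h : Φ ∈ codedMaps (contractionCodes ++ mixtureCodes)) : cliffordMultiplicity Φ = 384 := by
  obtain ⟨c, hc, rfl⟩ := h
  rw [cliffordMultiplicity_codedMap (sublist_rankTwo.subset hc), length_tableauxOfCode.2 hc]

/-! ## The design -/

/-- The weight of a channel: one for Kraus rank one and four otherwise. -/
def rankWeight (Φ : SuperOp (Fin 2)) : ℝ := if krausRank Φ = 1 then 1 else 4

/-- The weights 1 and 4 are the multiplicities 96 and 384 divided by 96; the common factor drops out
of the normalised average. -/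
lemma cliffordMultiplicity_eq {Φ : SuperOp (Fin 2)} (h : Φ ∈ inducedChannels) :
    (cliffordMultiplicity Φ : ℝ) = 96 * rankWeight Φ := by
  rw [inducedChannels_eq_union] at h
  obtain h | h := h
  · rw [multiplicity_unitary h, rankWeight, (unitary_facts h).2]
    norm_num
  · rw [multiplicity_rankTwo h, rankWeight, (rankTwo_facts h).2]
    norm_num

lemma isChannel_of_mem_inducedChannels {Φ : SuperOp (Fin 2)} (h : Φ ∈ inducedChannels) :
    IsChannel Φ := by
  rw [inducedChannels_eq_union] at h
  exact h.elim (fun h => (unitary_facts h).1) fun h => (rankTwo_facts h).1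

open Classical in
/-- Sums over the Clifford group of functions of the induced channel are weighted sums over the
induced channels. -/
lemma sum_induced {E : Type} [AddCommGroup E] [Module ℂ E] (f : SuperOp (Fin 2) → E) :
    ∑ T ∈ cliffordFinset, f (induced 0 T) =
      (96 : ℂ) • ∑ Φ ∈ cliffordFinset.image (induced 0), (rankWeight Φ : ℂ) • f Φ := by
  rw [Finset.sum_comp, Finset.smul_sum]
  refine Finset.sum_congr rfl fun Φ hΦ => ?_
  have hmem : Φ ∈ inducedChannels := by
    obtain ⟨T, hT, rfl⟩ := Finset.mem_image.mp hΦ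
    exact ⟨T, mem_cliffordFinset.mp hT, rfl⟩
  have hcard : (cliffordFinset.filter fun T => induced (0 : Fin 2) T = Φ).card =
      cliffordMultiplicity Φ := by
    rw [cliffordMultiplicity, ← Set.ncard_coe_finset]
    congr 1
    ext T
    simp only [Finset.coe_filter, mem_cliffordFinset]
    rfl
  have h := congrArg (Complex.ofReal) (cliffordMultiplicity_eq hmem)
  push_cast at h
  rw [hcard, smul_smul, ← h, Nat.cast_smul_eq_nsmul]

open Classical in
lemma isWeightedChannelDesign_induced :
    IsWeightedChannelDesign 3 2 (cliffordFinset.image (induced (0 : Fin 2))) rankWeight := by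
  have hmem : ∀ Φ ∈ cliffordFinset.image (induced (0 : Fin 2)), Φ ∈ inducedChannels := by
    intro Φ hΦ
    obtain ⟨T, hT, rfl⟩ := Finset.mem_image.mp hΦ
    exact ⟨T, mem_cliffordFinset.mp hT, rfl⟩
  have hpos : ∀ Φ, 0 < rankWeight Φ := fun Φ => by
    rw [rankWeight]
    split_ifs <;> norm_num
  have hne : (cliffordFinset.image (induced (0 : Fin 2))).Nonempty := by
    have h1 : IsClifford pauliGroupTwo (pauliTwo 0) := isClifford_pauliTwo 0
    exact ⟨_, Finset.mem_image_of_mem _ (mem_cliffordFinset.mpr ⟨_, h1, rfl⟩)⟩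
  refine ⟨hne, fun Φ hΦ => ⟨isChannel_of_mem_inducedChannels (hmem Φ hΦ), hpos Φ⟩, fun ρ => ?_⟩
  have hcard : (cliffordFinset.card : ℂ) =
      96 * ((∑ Φ ∈ cliffordFinset.image (induced (0 : Fin 2)), rankWeight Φ : ℝ) : ℂ) := by
    -- The constant function 1 gives the order of the Clifford group as 96 times the total weight.
    have := sum_induced fun _ => (1 : ℂ)
    simpa using this
  have hw : ((∑ Φ ∈ cliffordFinset.image (induced (0 : Fin 2)), rankWeight Φ : ℝ) : ℂ) ≠ 0 :=
    Complex.ofReal_ne_zero.mpr (Finset.sum_pos (fun Φ _ => hpos Φ) hne).ne'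
  have h := card_smul_haarChannelAverage ρ
  rw [sum_induced fun Φ => tensorPower 3 Φ ρ, hcard, mul_smul] at h
  rw [← smul_right_injective _ (by norm_num : (96 : ℂ) ≠ 0) h, smul_smul, inv_mul_cancel₀ hw,
    one_smul]

end ChannelDesign

end

/-! ### Assembly of the classification and the design. -/

theorem mainTheorem4 :
    -- the induced channels: 48 in all, of Kraus rank one or two
    inducedChannels.ncard = 48 ∧
    (∀ Φ ∈ inducedChannels, IsChannel Φ) ∧
    inducedChannels = inducedOfRank 1 ∪ inducedOfRank 2 ∧
    -- the unitary ones: the one-qubit Clifford group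
    inducedOfRank 1 = cliffordOps pauliGroupOne ∧
    (inducedOfRank 1).ncard = 24 ∧
    (∀ Φ ∈ inducedOfRank 1, cliffordMultiplicity Φ = 96) ∧
    -- the ones of Kraus rank two
    (inducedOfRank 2).ncard = 24 ∧
    (∀ Φ ∈ inducedOfRank 2, cliffordMultiplicity Φ = 384) ∧
    (∀ Φ ∈ inducedOfRank 2, (choiState Φ).charpoly.roots = {1 / 2, 1 / 2, 0, 0}) ∧
    -- 18 of them are mixed unitary: even mixtures of two different Clifford unitaries
    {Φ ∈ inducedOfRank 2 | IsMixedUnitary Φ}.ncard = 18 ∧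
    (∀ Φ ∈ inducedOfRank 2, IsMixedUnitary Φ →
      ∃ Ψ₁ ∈ cliffordOps pauliGroupOne, ∃ Ψ₂ ∈ cliffordOps pauliGroupOne,
        Ψ₁ ≠ Ψ₂ ∧ Φ = (1 / 2 : ℂ) • (Ψ₁ + Ψ₂)) ∧
    {Φ ∈ inducedOfRank 2 | IsMixedUnitary Φ} = rankTwoFamily 1 ∧
    -- the other 6 contract to the vertices of the octahedron
    vertexContractions.ncard = 6 ∧
    {Φ ∈ inducedOfRank 2 | ¬ IsMixedUnitary Φ} = vertexContractions ∧
    vertexContractions = rankTwoFamily 0 ∧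
    -- weights one and four give a weighted channel [3,2]-design
    (∃ S : Finset (SuperOp (Fin 2)), (S : Set (SuperOp (Fin 2))) = inducedChannels ∧
      IsWeightedChannelDesign 3 2 S (fun Φ => if krausRank Φ = 1 then 1 else 4)) := by
  classical
  have hmix : mixtureCodes.Sublist allCodes :=
    (List.sublist_append_right _ _).trans sublist_rankTwo
  have hcon : contractionCodes.Sublist allCodes :=
    (List.sublist_append_left _ _).trans sublist_rankTwo
  refine ⟨?_, fun Φ => isChannel_of_mem_inducedChannels, ?_, ?_, ?_, ?_, ?_, ?_, ?_, ?_, ?_, ?_, ?_,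
    ?_, ?_, cliffordFinset.image (induced 0), ?_, isWeightedChannelDesign_induced⟩
  · rw [inducedChannels_eq, ncard_codedMaps_of_subset (List.Sublist.refl _)]
    decide +kernel
  · rw [inducedOfRank_one, inducedOfRank_two, inducedChannels_eq_union]
  · rw [inducedOfRank_one, cliffordOps_one_eq]
  · rw [inducedOfRank_one, ncard_codedMaps_of_subset sublist_unitary]
    decide +kernel
  · rw [inducedOfRank_one]
    exact fun Φ => multiplicity_unitary
  · rw [inducedOfRank_two, ncard_codedMaps_of_subset sublist_rankTwo]
    decide +kernel
  · rw [inducedOfRank_two]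
    exact fun Φ => multiplicity_rankTwo
  · rw [inducedOfRank_two, codedMaps_append, ← rankTwoFamily_zero, ← rankTwoFamily_one]
    exact fun Φ h => h.elim choiState_roots choiState_roots
  · rw [inducedOfRank_two_mixed, ncard_codedMaps_of_subset hmix]
    decide +kernel
  · intro Φ h hm
    have h' : Φ ∈ {Φ ∈ inducedOfRank 2 | IsMixedUnitary Φ} := ⟨h, hm⟩
    rw [inducedOfRank_two_mixed] at h'
    exact exists_mixture h'
  · rw [inducedOfRank_two_mixed, rankTwoFamily_one]
  · rw [vertexContractions_eq, ncard_codedMaps_of_subset hcon]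
    decide +kernel
  · rw [inducedOfRank_two_not_mixed, vertexContractions_eq]
  · rw [vertexContractions_eq, rankTwoFamily_zero]
  · rw [Finset.coe_image, cliffordFinset, Set.Finite.coe_toFinset]
    rfl
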